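/- Let $E$ be one of $[0,1]$, $[0,\infty)$, $\mathbb R$, let $\mathcal P(E)$ be the set of Borel probability measures on $E$ with moments of all orders, $m_j(\mu)=\int x^j\,d\mu$, and $\mathcal M_n(E)=\{(m_1(\mu),\dots,m_n(\mu)):\mu\in\mathcal P(E)\}\subset\mathbb R^n$. **Constraint.** Let $\mathcal C=\{m_{i_1}=c_{i_1},\dots,m_{i_k}=c_{i_k}\}$ with $1\le i_1<\dots<i_k$, $k\ge 0$ (put $i_k:=0$ if $k=0$), let $\mathcal M_n^{\mathcal C}(E)$ be the set of all $(m_1(\mu),\dots,m_n(\mu))$ with $\mu\in\mathcal P(E)$ satisfying $\mathcal C$, and let $R_n:=\mathcal M_n^{\mathcal C}(E)\cap\operatorname{Int}\mathcal M_n(E)$. Assume that $\mathcal C$ is admissible, i.e. $R_{i_k}\neq\emptyset$. For a vector $v=(v_1,\dots,v_n)$ let $v^{\mathcal C}=(v_j)_{j\le n,\,j\ne i_1,\dots,i_k}$. **Canonical coordinates.** For $(m_1,\dots,m_n)\in\operatorname{Int}\mathcal M_n(E)$ let $m_j^-\le m_j^+$ be the infimum and supremum of the possible $j$-th moments of measures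 in $\mathcal P(E)$ with first moments $m_1,\dots,m_{j-1}$ ($m_0=1$, $m_0^-=0$). Put $y_j=\frac{m_j-m_j^-}{m_j^+-m_j^-}$ and $D_j=(0,1)$ if $E=[0,1]$; $y_j=\frac{m_j-m_j^-}{m_{j-1}-m_{j-1}^-}$ and $D_j=(0,\infty)$ if $E=[0,\infty)$; and if $E=\mathbb R$, $y_{2j-1}=\alpha_j$, $D_{2j-1}=\mathbb R$, $y_{2j}=\beta_j$, $D_{2j}=(0,\infty)$, where $\alpha_j,\beta_j$ are the coefficients in the recursion $P_j(x)=(x-\alpha_j)P_{j-1}(x)-\beta_{j-1}P_{j-2}(x)$ of the monic orthogonal polynomials. On $R_n$ with $n\ge i_k$, the vector $y^{\mathcal C}$ determines $(m_1,\dots,m_n)$, and hence all of $y_1,\dots,y_n$. **Random moments.** Let $V_j:\overline{D_j}\to\mathbb R$, $1\le j\le i_k+2$, be continuous, and $C^2$ on $D_j$. If $E\ne[0,1]$, assume that for some $\varepsilon>0$, every $1\le j\le i_k+2$ and all $y\in D_j$ with $|y|$ large, $V_j(y)\ge(2+\varepsilon)\log|y|$; for $E=\mathbb R$ and $j$ odd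 only $V_j(y)\ge(1+\varepsilon)\log|y|$ is required. Extend by $V_{i_k+2j-1}:=V_{i_k+1}$, $V_{i_k+2j}:=V_{i_k+2}$ for $j\ge2$. For $n\geq i_k$ let $\mathbb P_n$ be the probability measure on $\mathcal M_n^{\mathcal C}(E)$, concentrated on $R_n$, with density proportional to $\exp(-n\sum_{j=1}^nV_j(y_j))$ with respect to Lebesgue measure in the unconstrained moments $m^{\mathcal C}$, and let $(m_1^{(n)},\dots,m_n^{(n)})$ have law $\mathbb P_n$. Let $W_j(y)=V_j(y)-\log(y(1-y))$ if $E=[0,1]$; $W_j=V_j$ if $E=\mathbb R$ and $j$ is odd; $W_j(y)=V_j(y)-\log y$ otherwise. **Genericity.** Assume: (i) $W_{i_k+1},W_{i_k+2}$ have unique minimizers on $D_{i_k+1},D_{i_k+2}$, and their second derivatives do not vanish there; (ii) the function $y^{\mathcal C}\mapsto\sum_{j=1}^{i_k}W_j(y_j)$, defined on the set of the $y^{\mathcal C}$ of points of $R_{i_k}$, has only finitely many minimizers, and its Hessian determinant does not vanish at any of them. **Limit points.** Let $l\ge i_k$, and let $S_l$ be the finite set of all $m\in R_l$ such that $(y_j)_{j\le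 i_k,\,j\neq i_1,\dots,i_k}$ is one of the minimizers in (ii) and $y_j$ minimizes $W_j$ on $D_j$ for all $i_k<j\le l$. Write $m_l^{(n)}=(m_1^{(n)},\dots,m_l^{(n)})$, let $m_l^*$ be a point of $S_l$ at minimal Euclidean distance from $m_l^{(n)}$ (ties broken by any measurable rule, which may depend on $n$), and for $m\in S_l$ put $$\Sigma_l(m)=T^{\mathcal C}\Big[\Big(\operatorname{Hess}^{\mathcal C}\sum_{j=1}^lW_j\Big)^{1/2}(y^{\mathcal C})\;\cdot\;D\Big],$$ where $\operatorname{Hess}^{\mathcal C}$ is the Hessian with respect to the variables $y^{\mathcal C}$ of $\mathbb R^{l-k}$, $y^{\mathcal C}$ is evaluated at $m$, $D=\big(\partial y_i/\partial m_j\big)_{i,j\le l;\;i,j\ne i_1,\dots,i_k}$ is the Jacobian matrix at $m$ of $m^{\mathcal C}\mapsto y^{\mathcal C}$ (row index $i$, column index $j$), and $T^{\mathcal C}$ inserts zero rows and columns at the positions $i_1,\dots,i_k$. **Theorem (moderate deviations principle).** Let $a_n\to\infty$ with $a_n=o(\sqrt n)$. Then $$Z_n:=a_n\,\Sigma_l(m_l^*)\,\big(m_l^{(n)}-m_l^*\big)$$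 satisfies a large deviations principle on $\mathbb R^l$ with speed $b_n=n/a_n^2\to\infty$ and good rate function $$I(x)=\begin{cases}\frac12\|x\|_2^2,&x_{i_1}=\dots=x_{i_k}=0,\\ \infty,&\text{otherwise,}\end{cases}$$ that is, $I$ is lower semicontinuous with compact level sets, and for every Borel set $\Gamma\subset\mathbb R^l$ $$-\inf_{\operatorname{Int}\Gamma}I\le\liminf_{n\to\infty}\frac1{b_n}\log\mathbb P(Z_n\in\Gamma)\le\limsup_{n\to\infty}\frac1{b_n}\log\mathbb P(Z_n\in\Gamma)\le-\inf_{\overline\Gamma}I .$$ -/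

import Mathlib

open Set Filter Topology MeasureTheory

noncomputable section

/-! ## Large deviations principles -/

/-- `P` satisfies a large deviations principle with speed `b` and good rate function `I`.
The measures `P n` are required to be probability measures for all large `n`. -/
structure SatisfiesGoodLDP {X : Type*} [TopologicalSpace X] [MeasurableSpace X]
    (P : ℕ → Measure X) (b : ℕ → ℝ) (I : X → ENNReal) : Prop where
  isProbability : ∀ᶠ n in atTop, IsProbabilityMeasure (P n)
  speed : Tendsto b atTop atTop
  lowerSemicontinuous : LowerSemicontinuous I
  good : ∀ α : NNReal, IsCompact {x | I x ≤ α}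
  lower : ∀ Γ : Set X, MeasurableSet Γ →
    -(⨅ x ∈ interior Γ, (I x : EReal)) ≤
      liminf (fun n => ENNReal.log (P n Γ) / (b n : EReal)) atTop
  upper : ∀ Γ : Set X, MeasurableSet Γ →
    limsup (fun n => ENNReal.log (P n Γ) / (b n : EReal)) atTop ≤
      -(⨅ x ∈ closure Γ, (I x : EReal))

namespace RandomMoments

/-! ## Moment spaces and constraints -/

/-- The three possible supports `[0,1]`, `[0,∞)`, `ℝ`. -/
inductive Support
  | unit
  | halfLine
  | line

/-- The subset of `ℝ` belonging to a support type. -/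
def Support.carrier : Support → Set ℝ
  | .unit => Icc 0 1
  | .halfLine => Ici 0
  | .line => univ

/-- `𝒫(E)`: the Borel probability measures on `E` having moments of all orders. -/
def probMeasures (E : Support) : Set (Measure ℝ) :=
  {μ | IsProbabilityMeasure μ ∧ μ (E.carrier)ᶜ = 0 ∧ ∀ j : ℕ, Integrable (fun x => x ^ j) μ}

/-- The `j`-th moment of a measure. -/
def moment (μ : Measure ℝ) (j : ℕ) : ℝ := ∫ x, x ^ j ∂μ

/-- A constraint `m_i = val i`, `i ∈ idx`, with a finite (possibly empty) set of indices `i ≥ 1`.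
The values `val i` for `i ∉ idx` play no role. -/
structure Constraint where
  idx : Finset ℕ
  val : ℕ → ℝ
  one_le : ∀ i ∈ idx, 1 ≤ i

/-- The largest constrained index `i_k` (and `0` if there is no constraint). -/
def Constraint.top (C : Constraint) : ℕ := C.idx.sup id

/-- The moment space `ℳ_n(E)`. A vector `m : Fin n → ℝ` stands for `(m_1, …, m_n)`, that is, the
entry `m i` with `i : Fin n` is the moment of order `i + 1`. -/
def momentSpace (E : Support) (n : ℕ) : Set (Fin n → ℝ) :=
  {m | ∃ μ ∈ probMeasures E, ∀ i : Fin n, m i = moment μ (i + 1)}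

/-- The constrained moment space `ℳ_n^C(E)`. -/
def constrainedMomentSpace (E : Support) (C : Constraint) (n : ℕ) : Set (Fin n → ℝ) :=
  {m | ∃ μ ∈ probMeasures E, (∀ i ∈ C.idx, moment μ i = C.val i) ∧
    ∀ i : Fin n, m i = moment μ (i + 1)}

/-- The relative interior `ℳ_n^C(E) ∩ Int ℳ_n(E)` of the constrained moment space. -/
def relInterior (E : Support) (C : Constraint) (n : ℕ) : Set (Fin n → ℝ) :=
  constrainedMomentSpace E C n ∩ interior (momentSpace E n)

/-- Admissibility of a constraint: `ℳ_{i_k}^C(E)` meets the interior of `ℳ_{i_k}(E)`. -/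
def Admissible (E : Support) (C : Constraint) : Prop :=
  (constrainedMomentSpace E C C.top ∩ interior (momentSpace E C.top)).Nonempty

/-- The positions `i : Fin n` of unconstrained coordinates. -/
abbrev Free (C : Constraint) (n : ℕ) : Type := {i : Fin n // (i : ℕ) + 1 ∉ C.idx}

/-- The vector `(m_1, …, m_n)` with unconstrained moments `u` and constrained moments as
prescribed. -/
def fill (C : Constraint) (n : ℕ) (u : Free C n → ℝ) : Fin n → ℝ :=
  fun i => if h : (i : ℕ) + 1 ∉ C.idx then u ⟨i, h⟩ else C.val (i + 1)

/-- Restriction of a vector to the unconstrained coordinates. -/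
def freePart (C : Constraint) {n : ℕ} (v : Fin n → ℝ) : Free C n → ℝ := fun i => v i.1

/-! ## Canonical coordinates -/

/-- The sequence `j ↦ m_j` of a vector `(m_1, …, m_n)`, with `m_0 = 1`
(and with the irrelevant value `0` for `j > n`). -/
def momentSeq {n : ℕ} (m : Fin n → ℝ) (j : ℕ) : ℝ :=
  if j = 0 then 1 else if h : j - 1 < n then m ⟨j - 1, h⟩ else 0

/-- The range of the `j`-th moment of measures on `E` whose moments of order below `j` are given
by `s`. -/
def momentRange (E : Support) (s : ℕ → ℝ) (j : ℕ) : Set ℝ :=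
  {x | ∃ μ ∈ probMeasures E, (∀ i < j, moment μ i = s i) ∧ moment μ j = x}

/-- `m_j^-`, with the convention `m_0^- = 0`. -/
def lowerMoment (E : Support) (s : ℕ → ℝ) (j : ℕ) : ℝ :=
  if j = 0 then 0 else sInf (momentRange E s j)

/-- `m_j^+` (used for bounded `E` only). -/
def upperMoment (E : Support) (s : ℕ → ℝ) (j : ℕ) : ℝ := sSup (momentRange E s j)

/-- The moment functional `x ^ i ↦ s i` on polynomials. -/
def momentFunctional (s : ℕ → ℝ) (p : Polynomial ℝ) : ℝ := p.sum fun i a => a * s i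

/-- The pair `(P_{j-1}, P_j)` of consecutive monic orthogonal polynomials of the moment functional
of `s`, where `P_{-1} = 0`, `P_0 = 1` and
`P_{j+1} = (x - α_{j+1}) P_j - β_j P_{j-1}` with
`α_{j+1} = L(x P_j ^ 2) / L(P_j ^ 2)` and `β_j = L(P_j ^ 2) / L(P_{j-1} ^ 2)`. -/
def orthoPair (s : ℕ → ℝ) : ℕ → Polynomial ℝ × Polynomial ℝ
  | 0 => (0, 1)
  | j + 1 =>
    let Q := (orthoPair s j).1
    let P := (orthoPair s j).2
    (P, (Polynomial.X - Polynomial.C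
          (momentFunctional s (Polynomial.X * P ^ 2) / momentFunctional s (P ^ 2))) * P
        - Polynomial.C (momentFunctional s (P ^ 2) / momentFunctional s (Q ^ 2)) * Q)

/-- The monic orthogonal polynomial `P_j`. -/
def orthoPoly (s : ℕ → ℝ) (j : ℕ) : Polynomial ℝ := (orthoPair s j).2

/-- The recurrence coefficient `α_j`, `j ≥ 1`; it depends on the moments up to order `2j-1`. -/
def recAlpha (s : ℕ → ℝ) (j : ℕ) : ℝ :=
  momentFunctional s (Polynomial.X * orthoPoly s (j - 1) ^ 2) /
    momentFunctional s (orthoPoly s (j - 1) ^ 2)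

/-- The recurrence coefficient `β_j`, `j ≥ 1`; it depends on the moments up to order `2j`. -/
def recBeta (s : ℕ → ℝ) (j : ℕ) : ℝ :=
  momentFunctional s (orthoPoly s j ^ 2) / momentFunctional s (orthoPoly s (j - 1) ^ 2)

/-- The canonical coordinate `y_j`, `j ≥ 1`, of a moment sequence; it depends on the moments up to
order `j`. -/
def canonicalCoord : Support → (ℕ → ℝ) → ℕ → ℝ
  | .unit, s, j => (s j - lowerMoment .unit s j) / (upperMoment .unit s j - lowerMoment .unit s j)
  | .halfLine, s, j =>
      (s j - lowerMoment .halfLine s j) / (s (j - 1) - lowerMoment .halfLine s (j - 1))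
  | .line, s, j => if Odd j then recAlpha s ((j + 1) / 2) else recBeta s (j / 2)

/-- The domain `D_j` of the canonical coordinate `y_j`. -/
def coordDomain : Support → ℕ → Set ℝ
  | .unit, _ => Ioo 0 1
  | .halfLine, _ => Ioi 0
  | .line, j => if Odd j then univ else Ioi 0

/-- The vector `(y_1, …, y_n)` of canonical coordinates of `(m_1, …, m_n)`. -/
def canonicalVec (E : Support) {n : ℕ} (m : Fin n → ℝ) : Fin n → ℝ :=
  fun i => canonicalCoord E (momentSeq m) (i + 1)

/-- The unconstrained canonical coordinates of `(m_1, …, m_n)`. -/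
def freeCoords (E : Support) (C : Constraint) {n : ℕ} (m : Fin n → ℝ) : Free C n → ℝ :=
  freePart C (canonicalVec E m)

/-- The set of vectors of unconstrained canonical coordinates of points of the relative interior
of the constrained moment space. -/
def freeDomain (E : Support) (C : Constraint) (n : ℕ) : Set (Free C n → ℝ) :=
  freeCoords E C '' relInterior E C n

/-- The parametrization of the relative interior of the constrained moment space by the
unconstrained canonical coordinates, i.e. the inverse of `freeCoords` on `relInterior`.
Values outside `freeDomain` play no role. -/
def momentsOfFree (E : Support) (C : Constraint) (n : ℕ) : (Free C n → ℝ) → (Fin n → ℝ) :=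
  Function.invFunOn (freeCoords E C) (relInterior E C n)

/-! ## The potentials and the random moment vectors -/

/-- The extension of `V_1, …, V_{K+2}` to all indices that repeats `V_{K+1}, V_{K+2}`
periodically. -/
def extendPotential (K : ℕ) (V : ℕ → ℝ → ℝ) (j : ℕ) : ℝ → ℝ :=
  if j ≤ K + 2 then V j else if Odd (j - K) then V (K + 1) else V (K + 2)

/-- The distribution of the random constrained moment vector `(m_1, …, m_n)`: it has density
proportional to `exp (-n ∑ V_j(y_j))` with respect to the Lebesgue measure in the unconstrained
moments on the relative interior of the constrained moment space. -/
def momentLaw (E : Support) (C : Constraint) (V : ℕ → ℝ → ℝ) (n : ℕ) : Measure (Fin n → ℝ) :=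
  let ref : Measure (Fin n → ℝ) :=
    ((volume : Measure (Free C n → ℝ)).map (fill C n)).restrict (relInterior E C n)
  let weight : (Fin n → ℝ) → ENNReal := fun m => ENNReal.ofReal
    (Real.exp (-(n : ℝ) * ∑ i : Fin n, extendPotential C.top V (i + 1) (canonicalVec E m i)))
  (∫⁻ m, weight m ∂ref)⁻¹ • ref.withDensity weight

/-- The function `W_j` on `D_j`. -/
def effPotential (E : Support) (C : Constraint) (V : ℕ → ℝ → ℝ) (j : ℕ) (y : ℝ) : ℝ :=
  extendPotential C.top V j y -
    match E with
    | .unit => Real.log (y * (1 - y))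
    | .halfLine => Real.log y
    | .line => if Odd j then 0 else Real.log y

/-- The function `∑_{j ≤ n} W_j(y_j)` in terms of the unconstrained canonical coordinates. -/
def energy (E : Support) (C : Constraint) (V : ℕ → ℝ → ℝ) (n : ℕ) (u : Free C n → ℝ) : ℝ :=
  ∑ i : Fin n, effPotential E C V (i + 1) (canonicalVec E (momentsOfFree E C n u) i)

/-- The Hessian matrix of a function of finitely many real variables. -/
def hessian {ι : Type*} [Fintype ι] [DecidableEq ι] (f : (ι → ℝ) → ℝ) (x : ι → ℝ) :
    Matrix ι ι ℝ :=
  Matrix.of fun i j => iteratedFDeriv ℝ 2 f x ![Pi.single i 1, Pi.single j 1]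

/-- The Jacobian matrix, with `(i, j)` entry `∂ g_i / ∂ x_j`. -/
def jacobian {ι κ : Type*} [Fintype ι] [DecidableEq ι] [Fintype κ] (g : (ι → ℝ) → (κ → ℝ))
    (x : ι → ℝ) : Matrix κ ι ℝ :=
  Matrix.of fun i j => fderiv ℝ g x (Pi.single j 1) i

/-- `y` is a minimizer of `f` over the set `D`. -/
def IsMinimizer {X : Type*} (f : X → ℝ) (D : Set X) (y : X) : Prop := y ∈ D ∧ ∀ z ∈ D, f y ≤ f z

/-- The growth condition on the potentials. It is void for `E = [0,1]`. -/
def GrowthCondition (E : Support) (K : ℕ) (V : ℕ → ℝ → ℝ) : Prop :=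
  match E with
  | .unit => True
  | .halfLine => ∃ ε > 0, ∃ R : ℝ, ∀ j ∈ Icc 1 (K + 2), ∀ y ∈ coordDomain .halfLine j,
      R ≤ |y| → (2 + ε) * Real.log |y| ≤ V j y
  | .line => ∃ ε > 0, ∃ R : ℝ, ∀ j ∈ Icc 1 (K + 2), ∀ y ∈ coordDomain .line j,
      R ≤ |y| → ((if Odd j then 1 else 2) + ε) * Real.log |y| ≤ V j y

/-- The multivariate minimizers: the minimizers of `∑_{j ≤ i_k} W_j(y_j)` in terms of the
unconstrained ones among the first `i_k` canonical coordinates. -/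
def blockMinimizers (E : Support) (C : Constraint) (V : ℕ → ℝ → ℝ) : Set (Free C C.top → ℝ) :=
  {u | IsMinimizer (energy E C V C.top) (freeDomain E C C.top) u}

/-- Generic potentials `V_1, …, V_{i_k + 2}`. Only the values of `V j` on the closure of `D_j` for
`1 ≤ j ≤ i_k + 2` matter. -/
structure Generic (E : Support) (C : Constraint) (V : ℕ → ℝ → ℝ) : Prop where
  continuousOn : ∀ j ∈ Icc 1 (C.top + 2), ContinuousOn (V j) (closure (coordDomain E j))
  contDiffOn : ∀ j ∈ Icc 1 (C.top + 2), ContDiffOn ℝ 2 (V j) (coordDomain E j)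
  growth : GrowthCondition E C.top V
  unique_minimizer : ∀ j ∈ Icc (C.top + 1) (C.top + 2),
    ∃! y : ℝ, IsMinimizer (effPotential E C V j) (coordDomain E j) y
  finite_minimizers : (blockMinimizers E C V).Finite
  nondegenerate : ∀ j ∈ Icc (C.top + 1) (C.top + 2), ∀ y : ℝ,
    IsMinimizer (effPotential E C V j) (coordDomain E j) y →
      iteratedDeriv 2 (effPotential E C V j) y ≠ 0
  nondegenerate_block : ∀ u ∈ blockMinimizers E C V, (hessian (energy E C V C.top) u).det ≠ 0

/-! ## Limit points and standardized fluctuations -/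

/-- The first `l` moments of a vector of (at least `l`) moments. -/
def firstMoments (l : ℕ) {n : ℕ} (m : Fin n → ℝ) : Fin l → ℝ := fun i => momentSeq m (i + 1)

/-- The limit points `m_l^{*,q}`: the vectors of `l` moments satisfying the constraint whose
unconstrained canonical coordinates `y_j`, `j ≤ i_k`, form a multivariate minimizer, and for which
`y_j` minimizes `W_j` for all `i_k < j ≤ l`. -/
def limitPoints (E : Support) (C : Constraint) (V : ℕ → ℝ → ℝ) (l : ℕ) : Set (Fin l → ℝ) :=
  {m | m ∈ relInterior E C l ∧
    freeCoords E C (firstMoments C.top m) ∈ blockMinimizers E C V ∧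
    ∀ i : Fin l, C.top < (i : ℕ) + 1 →
      IsMinimizer (effPotential E C V (i + 1)) (coordDomain E (i + 1)) (canonicalVec E m i)}

/-- The Euclidean norm on `ℝ^l`. -/
def euclNorm {l : ℕ} (x : Fin l → ℝ) : ℝ := ‖WithLp.toLp 2 x‖

/-- Insertion of zero rows and columns at the constrained positions. -/
def insertZeros (C : Constraint) (l : ℕ) (A : Matrix (Free C l) (Free C l) ℝ) :
    Matrix (Fin l) (Fin l) ℝ :=
  Matrix.of fun i j =>
    if h : (i : ℕ) + 1 ∉ C.idx ∧ (j : ℕ) + 1 ∉ C.idx then A ⟨i, h.1⟩ ⟨j, h.2⟩ else 0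

section

open scoped MatrixOrder Matrix.Norms.L2Operator

/-- The square root of a positive semidefinite matrix. -/
def matrixSqrt {ι : Type*} [Fintype ι] [DecidableEq ι] (A : Matrix ι ι ℝ) : Matrix ι ι ℝ :=
  CFC.sqrt A

end

/-- The standardizing matrix at `m`: the square root of the Hessian of `∑_{j ≤ l} W_j` in the
unconstrained canonical coordinates times the Jacobian matrix of the unconstrained canonical
coordinates as functions of the unconstrained moments, with zeros inserted. -/
def standardizer (E : Support) (C : Constraint) (V : ℕ → ℝ → ℝ) (l : ℕ) (m : Fin l → ℝ) :
    Matrix (Fin l) (Fin l) ℝ :=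
  insertZeros C l
    (matrixSqrt (hessian (energy E C V l) (freeCoords E C m)) *
      jacobian (fun u => freeCoords E C (fill C l u)) (freePart C m))

/-- `sel x` is a point of `S` at minimal Euclidean distance from `x`, for every `x`, and `sel` is
measurable. -/
def IsNearestPointMap {l : ℕ} (S : Set (Fin l → ℝ)) (sel : (Fin l → ℝ) → (Fin l → ℝ)) : Prop :=
  Measurable sel ∧ ∀ x, sel x ∈ S ∧ ∀ y ∈ S, euclNorm (x - sel x) ≤ euclNorm (x - y)

/-- The standardized fluctuation `r • Σ_l(m_l^*) (m_l - m_l^*)` with `m_l^* = sel m_l`. -/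
def fluctuation (E : Support) (C : Constraint) (V : ℕ → ℝ → ℝ) (l : ℕ)
    (sel : (Fin l → ℝ) → (Fin l → ℝ)) (r : ℝ) (x : Fin l → ℝ) : Fin l → ℝ :=
  r • (standardizer E C V l (sel x)).mulVec (x - sel x)

open Classical in
/-- The rate function: `‖x‖² / 2` if all constrained coordinates of `x` vanish, `∞` otherwise. -/
def gaussianRate (C : Constraint) (l : ℕ) (x : Fin l → ℝ) : ENNReal :=
  if ∀ i : Fin l, (i : ℕ) + 1 ∈ C.idx → x i = 0 then ENNReal.ofReal (euclNorm x ^ 2 / 2) else ⊤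

end RandomMoments

end

/-! Canonical coordinates reduce the theorem to Laplace's method in finitely many variables. The
moments are weighted Motzkin path sums (`pathSum`) of Jacobi parameters. For `ℝ` these parameters
are the `y_j` themselves; for `[0,1]` and `[0,∞)` one passes to the symmetric measure whose image
under `x ↦ x ^ 2` is the given one, and its parameters are explicit in the `y_j`. Only one path
meets the newest parameter, so `m_n` is affine in `y_n`, and its slope `coordWeight` is a product of
factors of the earlier coordinates (`mom_sub`). Spectral measures of finite Jacobi matrices realise
all coordinates in the open domains (`exists_measure_mom`), and positivity of the moment functional
excludes values outside the closed ones (`mem_closedDomain_of_moment`). This identifies the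
coordinates (`canonicalCoord_eq`) and describes the interior of the moment space
(`mem_interior_iff`).

By this triangular structure the moments of order above `l` integrate out one at a time, each
leaving a constant (`lintegral_restrictedDensity_snoc`). The first `l` moments keep the density `exp
(-n ∑ V_j) * coordWeight ^ (n - l)`, which equals `exp (-n Φ) * g` with `Φ = ∑ W_j` and `g`
independent of `n`. The logarithms in `W_j` are thus the Jacobian of the discarded moments.

The growth condition makes the sublevel sets of `Φ` relatively compact in the region. Hence the
limit points are exactly the global minimizers, and `Φ` has a gap away from them. Genericity makes
each of them nondegenerate, so that `Φ = Φ₀ + |A (v - q)|² / 2 + o(|v - q|²)` with `A` the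
standardizing matrix (`eventually_abs_comp_sub_le`). At distance of order `1 / a_n` the quadratic
term produces the rate `‖z‖² / 2` at speed `n / a_n²`, the same at every minimizer. Constant
prefactors vanish at that speed, and the region away from the minimizers costs `exp (-δ n)`, which
is far smaller. These are `LaplaceSetup.mass_upper` and `LaplaceSetup.mass_lower`. Since the rate
depends only on the Euclidean norm, bounds for complements of balls and for small balls suffice
(`satisfiesGoodLDP_gaussianRate`). -/

namespace RandomMoments

/-! ## Jacobi parameters and moments -/

/-- The weighted number of Motzkin paths of length `n` from height `k` to height `0`, where a level
step at height `i` has weight `a i` and a down step from height `i` has weight `b i`.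
For the monic orthogonal polynomials `P_k` with recursion coefficients `a`, `b` and their moment
functional `L` this is `L (X ^ n * P_k)`. -/
def pathSum (a b : ℕ → ℝ) : ℕ → ℕ → ℝ
  | 0, k => if k = 0 then 1 else 0
  | n + 1, 0 => pathSum a b n 1 + a 0 * pathSum a b n 0
  | n + 1, k + 1 => pathSum a b n (k + 2) + a (k + 1) * pathSum a b n (k + 1)
      + b (k + 1) * pathSum a b n k

lemma pathSum_succ_succ (a b : ℕ → ℝ) (n k : ℕ) : pathSum a b (n + 1) (k + 1)
    = pathSum a b n (k + 2) + a (k + 1) * pathSum a b n (k + 1) + b (k + 1) * pathSum a b n k :=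
  rfl

/-- Each step descends by at most one, so height `0` is out of reach. -/
lemma pathSum_of_lt (a b : ℕ → ℝ) : ∀ {n k : ℕ}, n < k → pathSum a b n k = 0
  | 0, k, h => by simp [pathSum, h.ne']
  | n + 1, 0, h => by omega
  | n + 1, k + 1, h => by
    simp [pathSum, pathSum_of_lt a b (show n < k + 2 by omega),
      pathSum_of_lt a b (show n < k + 1 by omega), pathSum_of_lt a b (show n < k by omega)]

/-- The straight descent is the only path left. -/
lemma pathSum_self (a b : ℕ → ℝ) : ∀ n : ℕ, pathSum a b n n = ∏ i ∈ Finset.range n, b (i + 1)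
  | 0 => by simp [pathSum]
  | n + 1 => by
    simp [pathSum, pathSum_of_lt a b (show n < n + 2 by omega),
      pathSum_of_lt a b (show n < n + 1 by omega), pathSum_self a b n, Finset.prod_range_succ,
      mul_comm]

/-- Path sums depend on the parameters `a i`, `2 i + 1 ≤ n + k`, and `b i`, `2 i ≤ n + k`, only. -/
lemma pathSum_congr {a b a' b' : ℕ → ℝ} : ∀ {n k : ℕ}, (∀ i, 2 * i + 1 ≤ n + k → a i = a' i) →
    (∀ i, 1 ≤ i → 2 * i ≤ n + k → b i = b' i) → pathSum a b n k = pathSum a' b' n k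
  | 0, k, _, _ => by simp [pathSum]
  | n + 1, 0, ha, hb => by
    have h1 : pathSum a b n 1 = pathSum a' b' n 1 :=
      pathSum_congr (fun i hi => ha i (by omega)) (fun i h1 hi => hb i h1 (by omega))
    have h0 : pathSum a b n 0 = pathSum a' b' n 0 :=
      pathSum_congr (fun i hi => ha i (by omega)) (fun i h1 hi => hb i h1 (by omega))
    simp [pathSum, h1, h0, ha 0 (by omega)]
  | n + 1, k + 1, ha, hb => by
    rcases lt_or_ge (n + 1) (k + 1) with h | h
    · rw [pathSum_of_lt _ _ h, pathSum_of_lt _ _ h]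
    have h1 : pathSum a b n (k + 2) = pathSum a' b' n (k + 2) :=
      pathSum_congr (fun i hi => ha i (by omega)) (fun i h1 hi => hb i h1 (by omega))
    have h0 : pathSum a b n k = pathSum a' b' n k :=
      pathSum_congr (fun i hi => ha i (by omega)) (fun i h1 hi => hb i h1 (by omega))
    have h2 : pathSum a b n (k + 1) = pathSum a' b' n (k + 1) :=
      pathSum_congr (fun i hi => ha i (by omega)) (fun i h1 hi => hb i h1 (by omega))
    -- For `n = k` the hypothesis says nothing about `a (k + 1)`, but then the path sum next to it
    -- vanishes.
    have h3 : a (k + 1) * pathSum a' b' n (k + 1) = a' (k + 1) * pathSum a' b' n (k + 1) := by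
      rcases lt_or_ge n (k + 1) with h' | h'
      · simp [pathSum_of_lt _ _ h']
      · rw [ha _ (by omega)]
    simp only [pathSum]
    rw [h1, h0, h2, h3, hb (k + 1) (by omega) (by omega)]

/-- Dependence of a path sum on the top parameter `b m`. -/
lemma pathSum_sub_even {a b a' b' : ℕ → ℝ} {m : ℕ} (ha : ∀ i, i < m + 1 → a i = a' i)
    (hb : ∀ i, 1 ≤ i → i < m + 1 → b i = b' i) : ∀ {n k : ℕ}, n + k = 2 * (m + 1) → k ≤ n →
    pathSum a b n k - pathSum a' b' n k
      = (∏ i ∈ Finset.range m, b (i + 1)) * (b (m + 1) - b' (m + 1))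
  | 0, k, h, h' => by omega
  | n + 1, 0, h, h' => by
    have h1 := pathSum_sub_even ha hb (n := n) (k := 1) (by omega) (by omega)
    have h0 : pathSum a b n 0 = pathSum a' b' n 0 :=
      pathSum_congr (fun i hi => ha i (by omega)) (fun i h1 hi => hb i h1 (by omega))
    rw [← h1, pathSum, pathSum, h0, ha 0 (by omega)]
    ring
  | n + 1, k + 1, h, h' => by
    -- An up step keeps `n + k` fixed, while the other steps lower it and lose sight of the top
    -- parameter. Only the path climbing to height `m + 1` and then descending straight uses `b (m +
    -- 1)`.
    rcases eq_or_lt_of_le h' with h2 | h2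
    · obtain rfl : n = m := by omega
      obtain rfl : k = n := by omega
      rw [pathSum_self, pathSum_self, Finset.prod_range_succ, Finset.prod_range_succ, mul_sub]
      congr 2
      refine Finset.prod_congr rfl fun i hi => (hb _ (by omega) ?_).symm
      have := Finset.mem_range.1 hi
      omega
    · have h1 := pathSum_sub_even ha hb (n := n) (k := k + 2) (by omega) (by omega)
      have h0 : pathSum a b n k = pathSum a' b' n k :=
        pathSum_congr (fun i hi => ha i (by omega)) (fun i h1 hi => hb i h1 (by omega))
      have h3 : pathSum a b n (k + 1) = pathSum a' b' n (k + 1) :=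
        pathSum_congr (fun i hi => ha i (by omega)) (fun i h1 hi => hb i h1 (by omega))
      rw [← h1, pathSum, pathSum, h0, h3, ha (k + 1) (by omega), hb (k + 1) (by omega) (by omega)]
      ring

/-- Dependence of a path sum on the top parameter `a m`. -/
lemma pathSum_sub_odd {a b a' b' : ℕ → ℝ} {m : ℕ} (ha : ∀ i, i < m → a i = a' i)
    (hb : ∀ i, 1 ≤ i → i < m + 1 → b i = b' i) : ∀ {n k : ℕ}, n + k = 2 * m + 1 → k ≤ n →
    pathSum a b n k - pathSum a' b' n k
      = (∏ i ∈ Finset.range m, b (i + 1)) * (a m - a' m)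
  | 0, k, h, h' => by omega
  | n + 1, 0, h, h' => by
    have h0 : pathSum a b n 0 = pathSum a' b' n 0 :=
      pathSum_congr (fun i hi => ha i (by omega)) (fun i h1 hi => hb i h1 (by omega))
    rcases Nat.eq_zero_or_pos m with rfl | hm
    · obtain rfl : n = 0 := by omega
      simp [pathSum]
    have h1 := pathSum_sub_odd ha hb (n := n) (k := 1) (by omega) (by omega)
    rw [← h1, pathSum, pathSum, h0, ha 0 hm]
    ring
  | n + 1, k + 1, h, h' => by
    have h0 : pathSum a b n k = pathSum a' b' n k :=
      pathSum_congr (fun i hi => ha i (by omega)) (fun i h1 hi => hb i h1 (by omega))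
    have h3 : pathSum a b n (k + 1) = pathSum a' b' n (k + 1) :=
      pathSum_congr (fun i hi => ha i (by omega)) (fun i h1 hi => hb i h1 (by omega))
    -- Here the climb ends at height `m`: one level step of weight `a m`, then the straight descent.
    rcases lt_or_ge n (k + 2) with h2 | h2
    · obtain rfl : n = k + 1 := by omega
      obtain rfl : m = k + 1 := by omega
      rw [pathSum_succ_succ _ _ (k + 1), pathSum_succ_succ _ _ (k + 1), h0, h3, pathSum_of_lt _ _ (show k + 1 < k + 2 by omega),
        pathSum_of_lt _ _ (show k + 1 < k + 2 by omega), hb (k + 1) (by omega) (by omega), ← h3,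
        pathSum_self]
      ring
    · have h1 := pathSum_sub_odd ha hb (n := n) (k := k + 2) (by omega) (by omega)
      rw [← h1, pathSum, pathSum, h0, h3, ha (k + 1) (by omega), hb (k + 1) (by omega) (by omega)]
      ring

/-- Without level steps every step changes the parity of the height. -/
lemma pathSum_zero_of_odd {b : ℕ → ℝ} : ∀ {n k : ℕ}, Odd (n + k) →
    pathSum (fun _ => 0) b n k = 0
  | 0, k, h => by
    have : k ≠ 0 := by rintro rfl; simp at h
    simp [pathSum, this]
  | n + 1, 0, h => by
    simp [pathSum, pathSum_zero_of_odd (b := b) (n := n) (k := 1) h]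
  | n + 1, k + 1, h => by
    have h1 : Odd (n + (k + 2)) := by convert h using 1; ring
    have h2 : Odd (n + k) := by
      rw [show n + 1 + (k + 1) = n + k + 2 by ring] at h
      simpa [Nat.odd_add] using h
    simp [pathSum, pathSum_zero_of_odd (b := b) h1, pathSum_zero_of_odd (b := b) h2]

lemma abs_pathSum_le {a b : ℕ → ℝ} {B : ℝ} (hB : 1 ≤ B) (ha : ∀ i, |a i| ≤ B)
    (hb : ∀ i, |b i| ≤ B) : ∀ n k : ℕ, |pathSum a b n k| ≤ (3 * B) ^ n
  | 0, k => by
    rw [pathSum]; split_ifs <;> simp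
  | n + 1, 0 => by
    have h1 := abs_pathSum_le hB ha hb n 1
    have h0 := abs_pathSum_le hB ha hb n 0
    have hp : (0 : ℝ) ≤ (3 * B) ^ n := by positivity
    calc |pathSum a b (n + 1) 0| ≤ |pathSum a b n 1| + |a 0| * |pathSum a b n 0| := by
          rw [pathSum, ← abs_mul]; exact abs_add_le _ _
      _ ≤ (3 * B) ^ n + B * (3 * B) ^ n := by
          gcongr
          exact ha 0
      _ ≤ (3 * B) ^ (n + 1) := by rw [pow_succ]; nlinarith
  | n + 1, k + 1 => by
    have h1 := abs_pathSum_le hB ha hb n (k + 2)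
    have h0 := abs_pathSum_le hB ha hb n (k + 1)
    have h2 := abs_pathSum_le hB ha hb n k
    have hp : (0 : ℝ) ≤ (3 * B) ^ n := by positivity
    calc |pathSum a b (n + 1) (k + 1)| ≤ |pathSum a b n (k + 2)|
          + |a (k + 1)| * |pathSum a b n (k + 1)| + |b (k + 1)| * |pathSum a b n k| := by
          rw [pathSum, ← abs_mul, ← abs_mul]
          exact (abs_add_le _ _).trans (add_le_add_left (abs_add_le _ _) _)
      _ ≤ (3 * B) ^ n + B * (3 * B) ^ n + B * (3 * B) ^ n := by
          gcongr
          · exact ha _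
          · exact hb _
      _ ≤ (3 * B) ^ (n + 1) := by rw [pow_succ]; nlinarith

lemma contDiffAt_pathSum {X : Type*} [NormedAddCommGroup X] [NormedSpace ℝ X] {r : WithTop ℕ∞}
    {a b : X → ℕ → ℝ} {x : X} (ha : ∀ i, ContDiffAt ℝ r (fun x => a x i) x)
    (hb : ∀ i, ContDiffAt ℝ r (fun x => b x i) x) :
    ∀ n k : ℕ, ContDiffAt ℝ r (fun x => pathSum (a x) (b x) n k) x
  | 0, k => by simpa only [pathSum] using contDiffAt_const
  | n + 1, 0 => by
    simp only [pathSum]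
    exact (contDiffAt_pathSum ha hb n 1).add ((ha 0).mul (contDiffAt_pathSum ha hb n 0))
  | n + 1, k + 1 => by
    simp only [pathSum]
    exact ((contDiffAt_pathSum ha hb n (k + 2)).add
      ((ha (k + 1)).mul (contDiffAt_pathSum ha hb n (k + 1)))).add
      ((hb (k + 1)).mul (contDiffAt_pathSum ha hb n k))

/-! ## Spectral measures -/

/-- The atoms are the eigenvalues, weighted by the squared `e`-th entries of an orthonormal
eigenbasis. The last clause serves to confine the support once the spectrum is located. -/
lemma exists_spectralMeasure {n : Type*} [Fintype n] [DecidableEq n] {A : Matrix n n ℝ}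
    (hA : A.IsHermitian) (e : n) :
    ∃ μ : Measure ℝ, IsProbabilityMeasure μ ∧ (∀ f : ℝ → ℝ, Integrable f μ) ∧
      (∀ k : ℕ, ∫ x, x ^ k ∂μ = (A ^ k) e e) ∧
      ∀ S : Set ℝ, (∀ (t : ℝ) (v : n → ℝ), v ≠ 0 → A.mulVec v = t • v → t ∈ S) → μ Sᶜ = 0 := by
  have hpow : ∀ k : ℕ, ∑ i, (hA.eigenvectorBasis i e) ^ 2 * hA.eigenvalues i ^ k
      = (A ^ k) e e := by
    intro k
    conv_rhs => rw [hA.spectral_theorem, ← map_pow, Matrix.diagonal_pow]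
    rw [Unitary.conjStarAlgAut_apply, Matrix.mul_apply]
    refine Finset.sum_congr rfl fun i _ => ?_
    simp [Matrix.mul_diagonal]
    ring
  have hint : ∀ f : ℝ → ℝ, Integrable f
      (∑ i, ENNReal.ofReal ((hA.eigenvectorBasis i e) ^ 2) • Measure.dirac (hA.eigenvalues i)) := by
    intro f
    refine integrable_finsetSum_measure.2 fun i _ => Integrable.smul_measure ?_ (by simp)
    exact integrable_dirac (by simp)
  refine ⟨∑ i, ENNReal.ofReal ((hA.eigenvectorBasis i e) ^ 2) • Measure.dirac (hA.eigenvalues i),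
    ⟨?_⟩, hint, ?_, ?_⟩
  · have h := hpow 0
    simp only [pow_zero, mul_one, Matrix.one_apply_eq] at h
    simp only [Measure.coe_finsetSum, Finset.sum_apply, Measure.smul_apply, measure_univ,
      smul_eq_mul, mul_one]
    rw [← ENNReal.ofReal_sum_of_nonneg (fun _ _ => sq_nonneg _), h, ENNReal.ofReal_one]
  · intro k
    rw [integral_finsetSum_measure (fun i _ => (integrable_finsetSum_measure.1 (hint _)) i (by simp)),
      ← hpow]
    refine Finset.sum_congr rfl fun i _ => ?_
    rw [integral_smul_measure, integral_dirac, ENNReal.toReal_ofReal (sq_nonneg _), smul_eq_mul]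
  · intro S hS
    simp only [Measure.coe_finsetSum, Finset.sum_apply, Measure.smul_apply, smul_eq_mul]
    refine Finset.sum_eq_zero fun i _ => ?_
    have : hA.eigenvalues i ∈ S := by
      refine hS _ (WithLp.ofLp (hA.eigenvectorBasis i)) ?_ (hA.mulVec_eigenvectorBasis i)
      have h := hA.eigenvectorBasis.orthonormal.ne_zero i
      exact fun h0 => h (WithLp.ofLp_injective 2 h0)
    simp [Measure.dirac_apply, this]

/-- The truncated symmetric Jacobi matrix. -/
noncomputable def jacobiMatrix (a b : ℕ → ℝ) (N : ℕ) : Matrix (Fin (N + 1)) (Fin (N + 1)) ℝ :=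
  Matrix.of fun i j => if (i : ℕ) = j then a i else if (i : ℕ) + 1 = j then √(b j) else
    if (j : ℕ) + 1 = i then √(b i) else 0

lemma jacobiMatrix_isHermitian (a b : ℕ → ℝ) (N : ℕ) : (jacobiMatrix a b N).IsHermitian := by
  ext i j
  simp only [Matrix.conjTranspose_apply, jacobiMatrix, Matrix.of_apply, star_trivial]
  split_ifs with h1 h2 h3 h4 h5 h6 <;> first | omega | (simp_all)

/-- The unnormalized basis vector `√(b_1 ⋯ b_k) e_k`. -/
noncomputable def jacobiVec (b : ℕ → ℝ) (N k : ℕ) : Fin (N + 1) → ℝ :=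
  fun i => if (i : ℕ) = k then √(∏ j ∈ Finset.range k, b (j + 1)) else 0

lemma jacobiMatrix_mulVec_zero (a b : ℕ → ℝ) {N : ℕ} (hN : 0 < N) :
    (jacobiMatrix a b N).mulVec (jacobiVec b N 0) = jacobiVec b N 1 + a 0 • jacobiVec b N 0 := by
  ext i
  rw [Matrix.mulVec, dotProduct, Finset.sum_eq_single (⟨0, by omega⟩ : Fin (N + 1))]
  · simp only [jacobiMatrix, jacobiVec, Matrix.of_apply, Pi.add_apply, Pi.smul_apply]
    obtain ⟨i, hi⟩ := i
    rcases i with _ | _ | i <;> simp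
  · intro j _ hj
    have : (j : ℕ) ≠ 0 := fun h => hj (Fin.ext h)
    simp [jacobiVec, this]
  · simp

/-- The scaling in `jacobiVec` turns the symmetric matrix into the recursion of `pathSum`, with
weight `1` upwards and `b` downwards. The bound `k + 1 < N` keeps clear of the truncation. -/
lemma jacobiMatrix_mulVec_succ (a : ℕ → ℝ) {b : ℕ → ℝ} {N k : ℕ} (hN : k + 1 < N)
    (hb : ∀ i, 1 ≤ i → i ≤ N → 0 < b i) :
    (jacobiMatrix a b N).mulVec (jacobiVec b N (k + 1)) = jacobiVec b N (k + 2)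
      + a (k + 1) • jacobiVec b N (k + 1) + b (k + 1) • jacobiVec b N k := by
  have h0 : 0 ≤ ∏ j ∈ Finset.range k, b (j + 1) := Finset.prod_nonneg fun j hj =>
    (hb _ (by omega) (by have := Finset.mem_range.1 hj; omega)).le
  have h1 : 0 ≤ ∏ j ∈ Finset.range (k + 1), b (j + 1) := Finset.prod_nonneg fun j hj =>
    (hb _ (by omega) (by have := Finset.mem_range.1 hj; omega)).le
  have hk := hb (k + 1) (by omega) (by omega)
  ext i
  rw [Matrix.mulVec, dotProduct, Finset.sum_eq_single (⟨k + 1, by omega⟩ : Fin (N + 1))]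
  · simp only [jacobiMatrix, jacobiVec, Matrix.of_apply, Pi.add_apply, Pi.smul_apply, smul_eq_mul,
      if_true]
    obtain ⟨i, hi⟩ := i
    simp only
    rcases lt_trichotomy i (k + 1) with h | rfl | h
    · rw [if_neg (by omega), if_neg (show ¬ i = k + 2 by omega), if_neg (show ¬ i = k + 1 by omega)]
      by_cases hik : i = k
      · subst hik
        rw [if_pos rfl, if_pos rfl, Finset.prod_range_succ, Real.sqrt_mul h0, zero_add, mul_zero,
          zero_add]
        rw [mul_comm (√(∏ _ ∈ _, _)), ← mul_assoc, Real.mul_self_sqrt hk.le]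
      · rw [if_neg (by omega), if_neg (by omega), if_neg hik]; simp
    · simp
    · rw [if_neg (by omega), if_neg (by omega), if_neg (show ¬ i = k + 1 by omega),
        if_neg (show ¬ i = k by omega)]
      by_cases hik : i = k + 2
      · subst hik
        rw [if_pos rfl, if_pos rfl, Finset.prod_range_succ _ (k + 1), Real.sqrt_mul h1]
        ring
      · rw [if_neg (by omega), if_neg hik]; simp
  · intro j _ hj
    have : (j : ℕ) ≠ k + 1 := fun h => hj (Fin.ext h)
    simp [jacobiVec, this]
  · simp

/-- In `n` steps from height `k` no path exceeds `n + k ≤ N`, so the truncation is not felt. -/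
lemma jacobiMatrix_pow_mulVec (a : ℕ → ℝ) {b : ℕ → ℝ} {N : ℕ}
    (hb : ∀ i, 1 ≤ i → i ≤ N → 0 < b i) : ∀ {n k : ℕ}, n + k ≤ N →
    ((jacobiMatrix a b N) ^ n).mulVec (jacobiVec b N k) 0 = pathSum a b n k
  | 0, k, h => by
    rcases k with _ | k <;> simp [pathSum, jacobiVec]
  | n + 1, 0, h => by
    rw [pow_succ, ← Matrix.mulVec_mulVec, jacobiMatrix_mulVec_zero a b (by omega),
      Matrix.mulVec_add, Matrix.mulVec_smul, pathSum, Pi.add_apply, Pi.smul_apply,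
      jacobiMatrix_pow_mulVec a hb (by omega), jacobiMatrix_pow_mulVec a hb (by omega), smul_eq_mul]
  | n + 1, k + 1, h => by
    rw [pow_succ, ← Matrix.mulVec_mulVec, jacobiMatrix_mulVec_succ a (by omega) hb,
      Matrix.mulVec_add, Matrix.mulVec_smul, Matrix.mulVec_add, Matrix.mulVec_smul, pathSum,
      Pi.add_apply, Pi.add_apply, Pi.smul_apply, Pi.smul_apply,
      jacobiMatrix_pow_mulVec a hb (by omega), jacobiMatrix_pow_mulVec a hb (by omega),
      jacobiMatrix_pow_mulVec a hb (by omega), smul_eq_mul, smul_eq_mul]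

lemma jacobiMatrix_pow_apply (a : ℕ → ℝ) {b : ℕ → ℝ} {N : ℕ}
    (hb : ∀ i, 1 ≤ i → i ≤ N → 0 < b i) {n : ℕ} (h : n ≤ N) :
    ((jacobiMatrix a b N) ^ n) 0 0 = pathSum a b n 0 := by
  rw [← jacobiMatrix_pow_mulVec a hb (by omega : n + 0 ≤ N)]
  have : jacobiVec b N 0 = Pi.single 0 1 := by
    ext i
    simp only [jacobiVec, Finset.range_zero, Finset.prod_empty, Real.sqrt_one, Pi.single_apply,
      Fin.ext_iff, Fin.val_zero]
  rw [this, Matrix.mulVec_single_one, Matrix.col_apply]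

/-- Favard's theorem for finitely many parameters. -/
lemma exists_measure_pathSum (a : ℕ → ℝ) {b : ℕ → ℝ} {N : ℕ}
    (hb : ∀ i, 1 ≤ i → i ≤ N → 0 < b i) :
    ∃ μ : Measure ℝ, IsProbabilityMeasure μ ∧ (∀ f : ℝ → ℝ, Integrable f μ) ∧
      ∀ n ≤ N, moment μ n = pathSum a b n 0 := by
  obtain ⟨μ, h1, h2, h3, -⟩ := exists_spectralMeasure (jacobiMatrix_isHermitian a b N) 0
  exact ⟨μ, h1, h2, fun n hn => (h3 n).trans (jacobiMatrix_pow_apply a hb hn)⟩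

lemma sum_fin_succ_eq_le {N : ℕ} (i : Fin (N + 1)) {w : ℝ} (hw : 0 ≤ w) :
    ∑ j : Fin (N + 1), (if (j : ℕ) + 1 = i then w else 0) ≤ w := by
  rw [Finset.sum_fin_eq_sum_range]
  rcases hi : (i : ℕ) with _ | k
  · rw [Finset.sum_eq_zero]
    · exact hw
    · intro j _; split_ifs <;> simp_all
  · rw [Finset.sum_eq_single k]
    · split_ifs <;> simp_all
    · intro j _ hj; split_ifs <;> first | rfl | (simp only at *; omega)
    · intro hk
      have := i.2
      simp only [Finset.mem_range] at hk
      omega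

lemma sum_fin_eq_succ_le {N : ℕ} (i : Fin (N + 1)) {w : ℝ} (hw : 0 ≤ w) :
    ∑ j : Fin (N + 1), (if (i : ℕ) + 1 = j then w else 0) ≤ w := by
  rw [Finset.sum_fin_eq_sum_range]
  by_cases hi : (i : ℕ) + 1 < N + 1
  · rw [Finset.sum_eq_single_of_mem _ (Finset.mem_range.2 hi)]
    · simp [hi]
    · intro j _ hj
      split_ifs <;> first | rfl | (simp only at *; omega)
  · rw [Finset.sum_eq_zero]
    · exact hw
    · intro j _
      split_ifs <;> first | rfl | (simp only at *; omega)

/-- If the parameters form a chain sequence, then the spectrum is contained in `[-1, 1]`. -/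
lemma jacobiMatrix_eigenvalue_mem_Icc {b g : ℕ → ℝ} {N : ℕ} (hg : ∀ i, g i ∈ Icc (0 : ℝ) 1)
    (hb : ∀ i, 1 ≤ i → b i = (1 - g (i - 1)) * g i) {t : ℝ} {v : Fin (N + 1) → ℝ} (hv : v ≠ 0)
    (h : (jacobiMatrix (fun _ => 0) b N).mulVec v = t • v) : t ∈ Icc (-1 : ℝ) 1 := by
  have hpos : 0 < ∑ i, v i ^ 2 := by
    obtain ⟨i, hi⟩ := Function.ne_iff.1 hv
    exact Finset.sum_pos' (fun _ _ => sq_nonneg _) ⟨i, by simp, sq_pos_of_ne_zero hi⟩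
  -- The weights split `b j = (1 - g (j - 1)) * g j` between its two rows by the inequality of
  -- arithmetic and geometric means; row `i` receives at most `g i + (1 - g i) = 1`.
  let c : Fin (N + 1) → Fin (N + 1) → ℝ := fun i j =>
    (if (j : ℕ) + 1 = i then g i else 0) + (if (i : ℕ) + 1 = j then 1 - g i else 0)
  have hc : ∀ i, ∑ j, c i j ≤ 1 := by
    intro i
    rw [Finset.sum_add_distrib]
    have h1 := sum_fin_succ_eq_le i (hg i).1
    have h2 := sum_fin_eq_succ_le i (sub_nonneg.2 (hg i).2)
    linarith
  have key : ∀ i j, |v i * (jacobiMatrix (fun _ => 0) b N i j * v j)| ≤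
      (c i j * v i ^ 2 + c j i * v j ^ 2) / 2 := by
    intro i j
    have aux : ∀ p q x y : ℝ, 0 ≤ p → 0 ≤ q → |x * (√(p * q) * y)| ≤ (p * x ^ 2 + q * y ^ 2) / 2 := by
      intro p q x y hp hq
      obtain ⟨r, hr, rfl⟩ : ∃ r, 0 ≤ r ∧ p = r ^ 2 := ⟨√p, Real.sqrt_nonneg p, (Real.sq_sqrt hp).symm⟩
      obtain ⟨s, hs, rfl⟩ : ∃ s, 0 ≤ s ∧ q = s ^ 2 := ⟨√q, Real.sqrt_nonneg q, (Real.sq_sqrt hq).symm⟩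
      rw [Real.sqrt_mul hp, Real.sqrt_sq hr, Real.sqrt_sq hs, abs_le]
      constructor <;> nlinarith [sq_nonneg (r * x + s * y), sq_nonneg (r * x - s * y)]
    simp only [jacobiMatrix, Matrix.of_apply, c]
    rcases lt_trichotomy (i : ℕ) j with hij | hij | hij
    · by_cases h1 : (i : ℕ) + 1 = j
      · rw [if_neg (by omega), if_pos h1, if_neg (by omega), if_pos h1, if_pos h1, if_neg (by omega),
          hb j (by omega), show (j : ℕ) - 1 = i by omega]
        simpa using aux _ _ (v i) (v j) (sub_nonneg.2 (hg i).2) (hg j).1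
      · rw [if_neg (by omega), if_neg h1, if_neg (by omega), if_neg (by omega), if_neg (by omega),
          if_neg (by omega), if_neg (by omega)]
        simp
    · rw [if_pos hij, if_neg (by omega), if_neg (by omega), if_neg (by omega), if_neg (by omega)]
      simp
    · by_cases h1 : (j : ℕ) + 1 = i
      · rw [if_neg (by omega), if_neg (by omega), if_pos h1, if_pos h1, if_neg (by omega),
          if_neg (by omega), if_pos h1,
          hb i (by omega), show (i : ℕ) - 1 = j by omega, mul_comm (1 - g j)]
        simpa using aux _ _ (v i) (v j) (hg i).1 (sub_nonneg.2 (hg j).2)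
      · rw [if_neg (by omega), if_neg (by omega), if_neg h1, if_neg (by omega), if_neg (by omega),
          if_neg (by omega), if_neg (by omega)]
        simp
  have hsum : |∑ i, ∑ j, v i * (jacobiMatrix (fun _ => 0) b N i j * v j)| ≤ ∑ i, v i ^ 2 := by
    calc |∑ i, ∑ j, v i * (jacobiMatrix (fun _ => 0) b N i j * v j)|
        ≤ ∑ i, ∑ j, (c i j * v i ^ 2 + c j i * v j ^ 2) / 2 :=
          (Finset.abs_sum_le_sum_abs _ _).trans (Finset.sum_le_sum fun i _ =>
            (Finset.abs_sum_le_sum_abs _ _).trans (Finset.sum_le_sum fun j _ => key i j))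
      _ = ∑ i, (∑ j, c i j) * v i ^ 2 := by
          simp only [add_div, Finset.sum_add_distrib]
          rw [Finset.sum_comm (f := fun i j => c j i * v j ^ 2 / 2), ← Finset.sum_add_distrib]
          refine Finset.sum_congr rfl fun i _ => ?_
          rw [← Finset.sum_add_distrib, Finset.sum_mul]
          exact Finset.sum_congr rfl fun j _ => by ring
      _ ≤ ∑ i, v i ^ 2 := Finset.sum_le_sum fun i _ =>
          mul_le_of_le_one_left (sq_nonneg _) (hc i)
  have heq : ∑ i, ∑ j, v i * (jacobiMatrix (fun _ => 0) b N i j * v j) = t * ∑ i, v i ^ 2 := by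
    rw [Finset.mul_sum]
    refine Finset.sum_congr rfl fun i _ => ?_
    have := congrFun h i
    simp only [Matrix.mulVec, dotProduct, Pi.smul_apply, smul_eq_mul] at this
    rw [← Finset.mul_sum, this]; ring
  rw [heq, abs_mul, abs_of_pos hpos] at hsum
  exact abs_le.1 (le_of_mul_le_mul_right (by linarith) hpos)

lemma exists_measure_pathSum_chain {b g : ℕ → ℝ} {N : ℕ} (hg : ∀ i, g i ∈ Icc (0 : ℝ) 1)
    (hb : ∀ i, 1 ≤ i → b i = (1 - g (i - 1)) * g i) (hb0 : ∀ i, 1 ≤ i → i ≤ N → 0 < b i) :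
    ∃ μ : Measure ℝ, IsProbabilityMeasure μ ∧ (∀ f : ℝ → ℝ, Integrable f μ) ∧
      (∀ n ≤ N, moment μ n = pathSum (fun _ => 0) b n 0) ∧ μ (Icc (-1) 1)ᶜ = 0 := by
  obtain ⟨μ, h1, h2, h3, h4⟩ :=
    exists_spectralMeasure (jacobiMatrix_isHermitian (fun _ => 0) b N) 0
  exact ⟨μ, h1, h2, fun n hn => (h3 n).trans (jacobiMatrix_pow_apply _ hb0 hn),
    h4 _ fun t v hv h => jacobiMatrix_eigenvalue_mem_Icc hg hb hv h⟩

/-! ## The moment functional and orthogonal polynomials -/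

lemma momentFunctional_add (s : ℕ → ℝ) (p q : Polynomial ℝ) :
    momentFunctional s (p + q) = momentFunctional s p + momentFunctional s q :=
  Polynomial.sum_add_index p q _ (fun _ => zero_mul _) (fun _ _ _ => add_mul _ _ _)

lemma momentFunctional_C_mul (s : ℕ → ℝ) (c : ℝ) (p : Polynomial ℝ) :
    momentFunctional s (Polynomial.C c * p) = c * momentFunctional s p := by
  rw [← Polynomial.smul_eq_C_mul, momentFunctional,
    Polynomial.sum_smul_index p c (fun i a => a * s i) (fun _ => zero_mul _), momentFunctional, Polynomial.sum_def,
    Polynomial.sum_def, Finset.mul_sum]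
  exact Finset.sum_congr rfl fun i _ => by ring

lemma momentFunctional_sub (s : ℕ → ℝ) (p q : Polynomial ℝ) :
    momentFunctional s (p - q) = momentFunctional s p - momentFunctional s q := by
  have := momentFunctional_add s p (Polynomial.C (-1) * q)
  rw [momentFunctional_C_mul] at this
  rw [show p - q = p + Polynomial.C (-1) * q by simp [sub_eq_add_neg], this]
  ring

lemma momentFunctional_monomial (s : ℕ → ℝ) (n : ℕ) (c : ℝ) :
    momentFunctional s (Polynomial.monomial n c) = c * s n :=
  Polynomial.sum_monomial_index c _ (zero_mul _)

lemma momentFunctional_X_pow (s : ℕ → ℝ) (n : ℕ) :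
    momentFunctional s (Polynomial.X ^ n) = s n := by
  rw [Polynomial.X_pow_eq_monomial, momentFunctional_monomial, one_mul]

lemma momentFunctional_sum {ι : Type*} (s : ℕ → ℝ) (S : Finset ι) (f : ι → Polynomial ℝ) :
    momentFunctional s (∑ i ∈ S, f i) = ∑ i ∈ S, momentFunctional s (f i) := by
  classical
  induction S using Finset.induction_on with
  | empty => simp [momentFunctional]
  | insert i S hi ih => rw [Finset.sum_insert hi, Finset.sum_insert hi, momentFunctional_add, ih]

/-- The monic polynomials with recursion coefficients `a`, `b`. -/
noncomputable def jacobiPoly (a b : ℕ → ℝ) : ℕ → Polynomial ℝ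
  | 0 => 1
  | 1 => Polynomial.X - Polynomial.C (a 0)
  | k + 2 => (Polynomial.X - Polynomial.C (a (k + 1))) * jacobiPoly a b (k + 1)
      - Polynomial.C (b (k + 1)) * jacobiPoly a b k

lemma jacobiPoly_monic_natDegree (a b : ℕ → ℝ) :
    ∀ k, (jacobiPoly a b k).Monic ∧ (jacobiPoly a b k).natDegree = k
  | 0 => by simp [jacobiPoly]
  | 1 => by simp [jacobiPoly, Polynomial.monic_X_sub_C]
  | k + 2 => by
    obtain ⟨h1, h2⟩ := jacobiPoly_monic_natDegree a b (k + 1)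
    obtain ⟨h3, h4⟩ := jacobiPoly_monic_natDegree a b k
    have h5 : ((Polynomial.X - Polynomial.C (a (k + 1))) * jacobiPoly a b (k + 1)).Monic :=
      (Polynomial.monic_X_sub_C _).mul h1
    have h6 : ((Polynomial.X - Polynomial.C (a (k + 1))) * jacobiPoly a b (k + 1)).natDegree
        = k + 2 := by
      rw [(Polynomial.monic_X_sub_C _).natDegree_mul h1, h2, Polynomial.natDegree_X_sub_C]
      ring
    have h7 : (Polynomial.C (b (k + 1)) * jacobiPoly a b k).natDegree ≤ k :=
      (Polynomial.natDegree_C_mul_le _ _).trans h4.le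
    have h8 : (Polynomial.C (b (k + 1)) * jacobiPoly a b k).degree <
        ((Polynomial.X - Polynomial.C (a (k + 1))) * jacobiPoly a b (k + 1)).degree :=
      Polynomial.degree_lt_degree (by omega)
    refine ⟨h5.sub_of_left h8, ?_⟩
    rw [jacobiPoly, Polynomial.natDegree_sub_eq_left_of_natDegree_lt (by omega), h6]

lemma natDegree_jacobiPoly (a b : ℕ → ℝ) (k : ℕ) : (jacobiPoly a b k).natDegree = k :=
  (jacobiPoly_monic_natDegree a b k).2

lemma coeff_jacobiPoly (a b : ℕ → ℝ) (k : ℕ) : (jacobiPoly a b k).coeff k = 1 := by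
  have := (jacobiPoly_monic_natDegree a b k).1.coeff_natDegree
  rwa [natDegree_jacobiPoly] at this

section Functional

variable {a b s : ℕ → ℝ} {N : ℕ}

/-- Multiplied by `X ^ n`, the three-term recursion becomes the recursion of `pathSum`; the
hypothesis on `s` is the case `k = 0`. -/
lemma momentFunctional_X_pow_mul_jacobiPoly (hs : ∀ i ≤ N, s i = pathSum a b i 0) :
    ∀ {k n : ℕ}, n + k ≤ N →
      momentFunctional s (Polynomial.X ^ n * jacobiPoly a b k) = pathSum a b n k
  | 0, n, h => by rw [jacobiPoly, mul_one, momentFunctional_X_pow, hs n (by omega)]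
  | 1, n, h => by
    have h1 := momentFunctional_X_pow_mul_jacobiPoly hs (k := 0) (n := n + 1) (by omega)
    have h0 := momentFunctional_X_pow_mul_jacobiPoly hs (k := 0) (n := n) (by omega)
    rw [jacobiPoly] at h1 h0
    rw [jacobiPoly, show Polynomial.X ^ n * (Polynomial.X - Polynomial.C (a 0))
      = Polynomial.X ^ (n + 1) * 1 - Polynomial.C (a 0) * (Polynomial.X ^ n * 1) by ring,
      momentFunctional_sub, momentFunctional_C_mul, h1, h0, pathSum]
    ring
  | k + 2, n, h => by
    have h1 := momentFunctional_X_pow_mul_jacobiPoly hs (k := k + 1) (n := n + 1) (by omega)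
    have h0 := momentFunctional_X_pow_mul_jacobiPoly hs (k := k + 1) (n := n) (by omega)
    have h2 := momentFunctional_X_pow_mul_jacobiPoly hs (k := k) (n := n) (by omega)
    rw [jacobiPoly, show Polynomial.X ^ n * ((Polynomial.X - Polynomial.C (a (k + 1)))
        * jacobiPoly a b (k + 1) - Polynomial.C (b (k + 1)) * jacobiPoly a b k)
      = Polynomial.X ^ (n + 1) * jacobiPoly a b (k + 1)
        - Polynomial.C (a (k + 1)) * (Polynomial.X ^ n * jacobiPoly a b (k + 1))
        - Polynomial.C (b (k + 1)) * (Polynomial.X ^ n * jacobiPoly a b k) by ring,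
      momentFunctional_sub, momentFunctional_sub, momentFunctional_C_mul, momentFunctional_C_mul,
      h1, h0, h2, pathSum_succ_succ]
    ring

lemma momentFunctional_mul_jacobiPoly (hs : ∀ i ≤ N, s i = pathSum a b i 0) {q : Polynomial ℝ}
    {k d : ℕ} (hd : q.natDegree ≤ d) (h : d + k ≤ N) :
    momentFunctional s (q * jacobiPoly a b k)
      = ∑ i ∈ Finset.range (d + 1), q.coeff i * pathSum a b i k := by
  conv_lhs => rw [q.as_sum_range' (d + 1) (by omega)]
  rw [Finset.sum_mul, momentFunctional_sum]
  refine Finset.sum_congr rfl fun i hi => ?_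
  have := Finset.mem_range.1 hi
  rw [← Polynomial.C_mul_X_pow_eq_monomial, mul_assoc, momentFunctional_C_mul,
    momentFunctional_X_pow_mul_jacobiPoly hs (by omega)]

/-- Orthogonality: powers below `k` give paths too short to descend from height `k`. -/
lemma momentFunctional_mul_jacobiPoly_of_lt (hs : ∀ i ≤ N, s i = pathSum a b i 0)
    {q : Polynomial ℝ} {k d : ℕ} (hd : q.natDegree ≤ d) (hdk : d < k) (h : d + k ≤ N) :
    momentFunctional s (q * jacobiPoly a b k) = 0 := by
  rw [momentFunctional_mul_jacobiPoly hs hd h]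
  refine Finset.sum_eq_zero fun i hi => ?_
  have := Finset.mem_range.1 hi
  rw [pathSum_of_lt _ _ (by omega), mul_zero]

lemma momentFunctional_mul_jacobiPoly_of_le (hs : ∀ i ≤ N, s i = pathSum a b i 0)
    {q : Polynomial ℝ} {k : ℕ} (hd : q.natDegree ≤ k) (h : 2 * k ≤ N) :
    momentFunctional s (q * jacobiPoly a b k)
      = q.coeff k * ∏ i ∈ Finset.range k, b (i + 1) := by
  rw [momentFunctional_mul_jacobiPoly hs hd (by omega), Finset.sum_range_succ, pathSum_self,
    Finset.sum_eq_zero, zero_add]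
  intro i hi
  rw [pathSum_of_lt _ _ (Finset.mem_range.1 hi), mul_zero]

lemma momentFunctional_jacobiPoly_sq (hs : ∀ i ≤ N, s i = pathSum a b i 0) {k : ℕ}
    (h : 2 * k ≤ N) :
    momentFunctional s (jacobiPoly a b k ^ 2) = ∏ i ∈ Finset.range k, b (i + 1) := by
  rw [sq, momentFunctional_mul_jacobiPoly_of_le hs (natDegree_jacobiPoly a b k).le h,
    coeff_jacobiPoly, one_mul]

lemma momentFunctional_X_mul_jacobiPoly_sq (hs : ∀ i ≤ N, s i = pathSum a b i 0) {k : ℕ}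
    (h : 2 * k + 1 ≤ N) :
    momentFunctional s (Polynomial.X * jacobiPoly a b k ^ 2)
      = a k * ∏ i ∈ Finset.range k, b (i + 1) := by
  have h2 := momentFunctional_jacobiPoly_sq hs (show 2 * k ≤ N by omega)
  have h1 : momentFunctional s (jacobiPoly a b k * jacobiPoly a b (k + 1)) = 0 :=
    momentFunctional_mul_jacobiPoly_of_lt hs (natDegree_jacobiPoly a b k).le (by omega) (by omega)
  rcases k with _ | k
  · rw [show Polynomial.X * jacobiPoly a b 0 ^ 2 = jacobiPoly a b 0 * jacobiPoly a b 1
        + Polynomial.C (a 0) * jacobiPoly a b 0 ^ 2 by simp [jacobiPoly], momentFunctional_add,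
        momentFunctional_C_mul, h2, h1, zero_add]
  · have h3 : momentFunctional s (jacobiPoly a b k * jacobiPoly a b (k + 1)) = 0 :=
      momentFunctional_mul_jacobiPoly_of_lt hs (natDegree_jacobiPoly a b k).le (by omega) (by omega)
    rw [show Polynomial.X * jacobiPoly a b (k + 1) ^ 2 = jacobiPoly a b (k + 1) * jacobiPoly a b (k + 2)
        + Polynomial.C (a (k + 1)) * jacobiPoly a b (k + 1) ^ 2
        + Polynomial.C (b (k + 1)) * (jacobiPoly a b k * jacobiPoly a b (k + 1)) by
          rw [jacobiPoly]; ring, momentFunctional_add, momentFunctional_add, momentFunctional_C_mul,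
      momentFunctional_C_mul, h2, h1, h3]
    ring

/-- The quotients in `orthoPair` reduce to `a k` and `b k` because `P_k ^ 2` has value `b_1 ⋯ b_k`.
At `k = 0` the quotient for `β` multiplies the zero polynomial, so its value is irrelevant. A `b i`
with `2 * i = N` never enters a denominator. -/
lemma orthoPair_eq (hs : ∀ i ≤ N, s i = pathSum a b i 0) (hb : ∀ i, 1 ≤ i → 2 * i < N → b i ≠ 0) :
    ∀ {k : ℕ}, 2 * k ≤ N + 1 →
      orthoPair s k = (if k = 0 then 0 else jacobiPoly a b (k - 1), jacobiPoly a b k)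
  | 0, _ => by simp [orthoPair, jacobiPoly]
  | k + 1, hk => by
    have ih := orthoPair_eq hs hb (k := k) (by omega)
    have hne : ∀ m ≤ k, ∏ i ∈ Finset.range m, b (i + 1) ≠ 0 := fun m hm =>
      Finset.prod_ne_zero_iff.2 fun i hi => hb _ (by omega) (by
        have := Finset.mem_range.1 hi; omega)
    have h1 := momentFunctional_jacobiPoly_sq hs (show 2 * k ≤ N by omega)
    have h2 := momentFunctional_X_mul_jacobiPoly_sq hs (show 2 * k + 1 ≤ N by omega)
    rw [orthoPair, ih]
    simp only [h1, h2, mul_div_cancel_right₀ _ (hne k le_rfl)]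
    rcases k with _ | k
    · simp [jacobiPoly]
    · have h3 := momentFunctional_jacobiPoly_sq hs (show 2 * k ≤ N by omega)
      simp only [Nat.add_eq_zero_iff, one_ne_zero, and_false, if_false, Nat.add_sub_cancel, h3,
        jacobiPoly]
      rw [Finset.prod_range_succ, mul_div_cancel_left₀ _ (hne k (by omega))]

lemma recAlpha_eq (hs : ∀ i ≤ N, s i = pathSum a b i 0) (hb : ∀ i, 1 ≤ i → 2 * i < N → b i ≠ 0)
    {k : ℕ} (hk : 2 * k + 1 ≤ N) : recAlpha s (k + 1) = a k := by
  rw [recAlpha, orthoPoly, Nat.add_sub_cancel, orthoPair_eq hs hb (by omega),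
    momentFunctional_X_mul_jacobiPoly_sq hs hk, momentFunctional_jacobiPoly_sq hs (by omega),
    mul_div_cancel_right₀]
  exact Finset.prod_ne_zero_iff.2 fun i hi => hb _ (by omega) (by
        have := Finset.mem_range.1 hi; omega)

lemma recBeta_eq (hs : ∀ i ≤ N, s i = pathSum a b i 0) (hb : ∀ i, 1 ≤ i → 2 * i < N → b i ≠ 0)
    {k : ℕ} (hk : 2 * (k + 1) ≤ N) : recBeta s (k + 1) = b (k + 1) := by
  rw [recBeta, orthoPoly, orthoPoly, Nat.add_sub_cancel, orthoPair_eq hs hb (by omega),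
    orthoPair_eq hs hb (by omega), momentFunctional_jacobiPoly_sq hs hk,
    momentFunctional_jacobiPoly_sq hs (by omega), Finset.prod_range_succ, mul_div_cancel_left₀]
  exact Finset.prod_ne_zero_iff.2 fun i hi => hb _ (by omega) (by
        have := Finset.mem_range.1 hi; omega)

end Functional

lemma momentFunctional_moment {μ : Measure ℝ} (hμ : ∀ j : ℕ, Integrable (fun x => x ^ j) μ)
    (p : Polynomial ℝ) : momentFunctional (moment μ) p = ∫ x, p.eval x ∂μ := by
  simp only [momentFunctional, Polynomial.sum_def, Polynomial.eval_eq_sum]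
  rw [integral_finsetSum _ fun i _ => (hμ i).const_mul _]
  exact Finset.sum_congr rfl fun i _ => by rw [integral_const_mul, moment]

/-- The moment sequence of the symmetric measure whose image under `x ↦ x ^ 2` has moments `s`. -/
noncomputable def symmSeq (s : ℕ → ℝ) (i : ℕ) : ℝ := if Even i then s (i / 2) else 0

/-- `symmSeq` gives the moments of `±√x` with a fair random sign: odd powers cancel and `2 * k`
returns `x ^ k`. -/
lemma momentFunctional_symmSeq {μ : Measure ℝ} (hμ : ∀ j : ℕ, Integrable (fun x => x ^ j) μ)
    (hpos : ∀ᵐ x ∂μ, 0 ≤ x) (p : Polynomial ℝ) :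
    Integrable (fun x => (p.eval √x + p.eval (-√x)) / 2) μ ∧
      momentFunctional (symmSeq (moment μ)) p = ∫ x, (p.eval √x + p.eval (-√x)) / 2 ∂μ := by
  induction p using Polynomial.induction_on' with
  | add p q hp hq =>
    have : (fun x => ((p + q).eval √x + (p + q).eval (-√x)) / 2)
        = fun x => (p.eval √x + p.eval (-√x)) / 2 + (q.eval √x + q.eval (-√x)) / 2 := by
      ext x; simp only [Polynomial.eval_add]; ring
    rw [this]
    exact ⟨hp.1.add hq.1, by rw [integral_add hp.1 hq.1, momentFunctional_add, hp.2, hq.2]⟩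
  | monomial n c =>
    rw [momentFunctional_monomial]
    rcases Nat.even_or_odd' n with ⟨k, rfl | rfl⟩
    · have h : (fun x => ((Polynomial.monomial (2 * k) c).eval √x
          + (Polynomial.monomial (2 * k) c).eval (-√x)) / 2) =ᵐ[μ] fun x => c * x ^ k := by
        filter_upwards [hpos] with x hx
        simp only [Polynomial.eval_monomial, pow_mul, neg_sq, Real.sq_sqrt hx]
        ring
      refine ⟨(integrable_congr h).2 ((hμ k).const_mul _), ?_⟩
      rw [integral_congr_ae h, integral_const_mul, symmSeq, if_pos (even_two_mul k),
        Nat.mul_div_cancel_left _ two_pos, moment]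
    · have h : (fun x => ((Polynomial.monomial (2 * k + 1) c).eval √x
          + (Polynomial.monomial (2 * k + 1) c).eval (-√x)) / 2) = fun _ => 0 := by
        ext x
        simp only [Polynomial.eval_monomial, pow_succ, pow_mul]
        ring
      rw [h]
      exact ⟨integrable_zero _ _ _, by simp [symmSeq]⟩

/-! ## Moments as functions of the canonical coordinates -/

/-- The parameters `(1 - y_{k-1}) y_k`, where `y_0` is replaced with `0`. -/
noncomputable def chainParam (y : ℕ → ℝ) (k : ℕ) : ℝ := (1 - if k = 1 then 0 else y (k - 1)) * y k

/-- The diagonal Jacobi parameters (after symmetrization for `E ≠ ℝ`). -/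
def jacobiA : Support → (ℕ → ℝ) → ℕ → ℝ
  | .line, y => fun k => y (2 * k + 1)
  | _, _ => fun _ => 0

/-- The off-diagonal Jacobi parameters (after symmetrization for `E ≠ ℝ`). -/
noncomputable def jacobiB : Support → (ℕ → ℝ) → ℕ → ℝ
  | .line, y => fun k => y (2 * k)
  | .halfLine, y => y
  | .unit, y => chainParam y

/-- The order, after symmetrization for `E ≠ ℝ`, of the `n`-th moment. -/
def jacobiOrder : Support → ℕ → ℕ
  | .line, n => n
  | _, n => 2 * n

/-- The `n`-th moment as a function of the canonical coordinates. -/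
noncomputable def mom (E : Support) (y : ℕ → ℝ) (n : ℕ) : ℝ :=
  pathSum (jacobiA E y) (jacobiB E y) (jacobiOrder E n) 0

/-- The contribution of `y_j` to the Jacobian determinant of the higher moments. -/
def coordFactor : Support → ℕ → ℝ → ℝ
  | .unit, _, t => t * (1 - t)
  | .halfLine, _, t => t
  | .line, j, t => if Odd j then 1 else t

/-- The derivative of `m_n` with respect to `y_n`. -/
def coordWeight (E : Support) (y : ℕ → ℝ) (n : ℕ) : ℝ := ∏ i ∈ Finset.Ico 1 n, coordFactor E i (y i)

/-- `y_1, …, y_n` are possible canonical coordinates. -/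
def InDomain (E : Support) (y : ℕ → ℝ) (n : ℕ) : Prop := ∀ j, 1 ≤ j → j ≤ n → y j ∈ coordDomain E j

lemma InDomain.mono {E : Support} {y : ℕ → ℝ} {n k : ℕ} (h : InDomain E y n) (hk : k ≤ n) :
    InDomain E y k := fun j h1 h2 => h j h1 (h2.trans hk)

lemma coordFactor_pos {E : Support} {j : ℕ} {t : ℝ} (h : t ∈ coordDomain E j) :
    0 < coordFactor E j t := by
  rcases E with _ | _ | _
  · exact mul_pos h.1 (sub_pos.2 h.2)
  · exact h
  · simp only [coordFactor, coordDomain] at h ⊢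
    split_ifs with h'
    · exact one_pos
    · simpa [h'] using h

lemma coordWeight_pos {E : Support} {y : ℕ → ℝ} {n : ℕ} (h : InDomain E y (n - 1)) :
    0 < coordWeight E y n := Finset.prod_pos fun i hi => by
  have := Finset.mem_Ico.1 hi
  exact coordFactor_pos (h i this.1 (by omega))

lemma mom_zero (E : Support) (y : ℕ → ℝ) : mom E y 0 = 1 := by
  cases E <;> simp [mom, jacobiOrder, pathSum]

lemma mom_congr {E : Support} {y y' : ℕ → ℝ} {n : ℕ} (h : ∀ i, 1 ≤ i → i ≤ n → y i = y' i) :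
    mom E y n = mom E y' n := by
  refine pathSum_congr ?_ ?_
  · intro i hi
    rcases E with _ | _ | _ <;> simp only [jacobiA, jacobiOrder] at hi ⊢
    exact h _ (by omega) (by omega)
  · intro i h1 hi
    rcases E with _ | _ | _ <;> simp only [jacobiB, jacobiOrder, chainParam] at hi ⊢
    · rw [h i h1 (by omega)]
      split_ifs with h2
      · rfl
      · rw [h (i - 1) (by omega) (by omega)]
    · exact h _ h1 (by omega)
    · exact h _ (by omega) (by omega)

lemma coordWeight_congr {E : Support} {y y' : ℕ → ℝ} {n : ℕ} (h : ∀ i, 1 ≤ i → i < n → y i = y' i) :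
    coordWeight E y n = coordWeight E y' n := Finset.prod_congr rfl fun i hi => by
  rw [h i (Finset.mem_Ico.1 hi).1 (Finset.mem_Ico.1 hi).2]

lemma coordWeight_succ {E : Support} {y : ℕ → ℝ} {n : ℕ} (h : 1 ≤ n) :
    coordWeight E y (n + 1) = coordWeight E y n * coordFactor E n (y n) :=
  Finset.prod_Ico_succ_top h _

/-- The factors `y_i (1 - y_i)` regroup into `(1 - y_{i-1}) y_i`, and `1 - y_n` is left over. -/
lemma coordWeight_unit (y : ℕ → ℝ) (n : ℕ) : coordWeight .unit y (n + 1)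
    = (∏ i ∈ Finset.range n, chainParam y (i + 1)) * (1 - if n = 0 then 0 else y n) := by
  induction n with
  | zero => simp [coordWeight]
  | succ n ih =>
    rw [coordWeight_succ (by omega), ih, Finset.prod_range_succ, chainParam, coordFactor]
    simp only [Nat.add_eq_right, Nat.add_sub_cancel, Nat.add_eq_zero_iff, one_ne_zero, and_false,
      if_false]
    ring

lemma coordWeight_halfLine (y : ℕ → ℝ) (n : ℕ) : coordWeight .halfLine y (n + 1)
    = ∏ i ∈ Finset.range n, y (i + 1) := by
  rw [coordWeight, Finset.prod_Ico_eq_prod_range]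
  exact Finset.prod_congr rfl fun i _ => by rw [coordFactor, add_comm]

lemma coordWeight_line (y : ℕ → ℝ) (n : ℕ) :
    coordWeight .line y (2 * n + 1) = (∏ i ∈ Finset.range n, y (2 * (i + 1))) ∧
      coordWeight .line y (2 * n + 2) = ∏ i ∈ Finset.range n, y (2 * (i + 1)) := by
  have h2 : ∀ n, coordWeight .line y (2 * n + 2) = coordWeight .line y (2 * n + 1) := by
    intro n
    rw [coordWeight_succ (by omega), coordFactor, if_pos (by simp), mul_one]
  rw [h2, and_self]
  induction n with
  | zero => simp [coordWeight]
  | succ n ih =>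
    rw [show 2 * (n + 1) + 1 = (2 * n + 2) + 1 by ring, coordWeight_succ (by omega), h2, ih,
      coordFactor, if_neg (by simp [parity_simps]), Finset.prod_range_succ]
    rfl

/-- The triangular structure on which the rest depends: `m_n` is affine in `y_n`, with a slope made
of earlier coordinates. It comes from the single path that meets the top Jacobi parameter. -/
lemma mom_sub {E : Support} {y y' : ℕ → ℝ} {n : ℕ} (hn : 1 ≤ n)
    (h : ∀ i, 1 ≤ i → i < n → y i = y' i) :
    mom E y n - mom E y' n = coordWeight E y n * (y n - y' n) := by
  rcases E with _ | _ | _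
  · obtain ⟨n, rfl⟩ : ∃ k, n = k + 1 := ⟨n - 1, by omega⟩
    have hc : ∀ i, 1 ≤ i → i < n + 1 → chainParam y i = chainParam y' i := by
      intro i h1 h2
      simp only [chainParam]
      rw [h i h1 h2]
      split_ifs with h3
      · rfl
      · rw [h (i - 1) (by omega) (by omega)]
    simp only [mom, jacobiA, jacobiB, jacobiOrder]
    rw [pathSum_sub_even (m := n) (fun _ _ => rfl) hc (by omega) (by omega), coordWeight_unit,
      mul_assoc]
    congr 1
    simp only [chainParam, Nat.add_eq_right, Nat.add_sub_cancel]
    split_ifs with h3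
    · ring
    · rw [h n (by omega) (by omega)]; ring
  · obtain ⟨n, rfl⟩ : ∃ k, n = k + 1 := ⟨n - 1, by omega⟩
    simp only [mom, jacobiA, jacobiB, jacobiOrder]
    rw [pathSum_sub_even (m := n) (fun _ _ => rfl) h (by omega) (by omega), coordWeight_halfLine]
  · simp only [mom, jacobiA, jacobiB, jacobiOrder]
    rcases Nat.even_or_odd' n with ⟨k, rfl | rfl⟩
    · obtain ⟨k, rfl⟩ : ∃ j, k = j + 1 := ⟨k - 1, by omega⟩
      rw [pathSum_sub_even (m := k) (fun i hi => h _ (by omega) (by omega))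
        (fun i h1 hi => h _ (by omega) (by omega)) (by omega) (by omega),
        show 2 * (k + 1) = 2 * k + 2 by ring, (coordWeight_line y k).2]
    · rw [pathSum_sub_odd (m := k) (fun i hi => h _ (by omega) (by omega))
        (fun i h1 hi => h _ (by omega) (by omega)) (by omega) (by omega), (coordWeight_line y k).1]

/-- The value of `m_n` for `y_n = 0`. -/
noncomputable def momBase (E : Support) (y : ℕ → ℝ) (n : ℕ) : ℝ :=
  mom E (fun i => if i < n then y i else 0) n

lemma mom_eq {E : Support} {y : ℕ → ℝ} {n : ℕ} (hn : 1 ≤ n) :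
    mom E y n = momBase E y n + coordWeight E y n * y n := by
  have := mom_sub (E := E) (y := y) (y' := fun i => if i < n then y i else 0) hn
    (fun i _ hi => by simp [hi])
  rw [momBase, ← sub_eq_iff_eq_add', this]
  simp

lemma momBase_congr {E : Support} {y y' : ℕ → ℝ} {n : ℕ} (h : ∀ i, 1 ≤ i → i < n → y i = y' i) :
    momBase E y n = momBase E y' n := mom_congr fun i h1 h2 => by
  split_ifs with h3
  · exact h i h1 h3
  · rfl

/-! ## Existence of measures with given canonical coordinates -/

lemma half_mem_coordDomain (E : Support) (j : ℕ) : (1 / 2 : ℝ) ∈ coordDomain E j := by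
  rcases E with _ | _ | _ <;> simp only [coordDomain]
  · constructor <;> norm_num
  · simp
  · split_ifs <;> simp

lemma measurableSet_carrier (E : Support) : MeasurableSet E.carrier := by
  cases E <;> simp only [Support.carrier] <;> measurability

lemma moment_map_sq (μ : Measure ℝ) (n : ℕ) :
    moment (μ.map (fun x => x ^ 2)) n = moment μ (2 * n) := by
  rw [moment, integral_map (by fun_prop) (by fun_prop), moment]
  simp only [pow_mul]

/-- For `[0,1]` and `[0,∞)` the squaring map is applied to the spectral measure of a Jacobi matrix
with zero diagonal. For `[0,1]` the parameters form a chain sequence, so that spectrum lies in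
`[-1,1]`. -/
lemma exists_measure_mom {E : Support} {y : ℕ → ℝ} {n : ℕ} (h : InDomain E y n) :
    ∃ μ ∈ probMeasures E, ∀ j ≤ n, moment μ j = mom E y j := by
  -- Coordinates beyond `n` are replaced by `1 / 2`, which lies in every domain: the Jacobi matrix
  -- uses further parameters, but the moments up to order `n` do not see them.
  obtain ⟨y', hy', hd⟩ : ∃ y' : ℕ → ℝ, (∀ i ≤ n, y' i = y i) ∧ ∀ j, 1 ≤ j → y' j ∈ coordDomain E j := by
    refine ⟨fun i => if i ≤ n then y i else 1 / 2, fun i hi => by simp [hi], fun j hj => ?_⟩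
    by_cases h' : j ≤ n
    · simpa [h'] using h j hj h'
    · simpa [h'] using half_mem_coordDomain E j
  have hm : ∀ j ≤ n, mom E y j = mom E y' j := fun j hj =>
    mom_congr fun i _ hi => (hy' i (hi.trans hj)).symm
  rcases E with _ | _ | _
  · have hg : ∀ i, (if i = 0 then 0 else y' i) ∈ Icc (0 : ℝ) 1 := by
      intro i
      split_ifs with h0
      · simp
      · exact Ioo_subset_Icc_self (hd i (by omega))
    obtain ⟨ν, h1, h2, h3, h4⟩ := exists_measure_pathSum_chain (b := chainParam y')
      (g := fun i => if i = 0 then 0 else y' i) (N := 2 * n) hg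
      (fun i hi => by
        simp only [chainParam, show i ≠ 0 by omega, if_false]
        rcases eq_or_ne i 1 with rfl | h1
        · simp
        · simp [h1, show i - 1 ≠ 0 by omega])
      (fun i hi _ => by
        rw [chainParam]
        refine mul_pos ?_ (hd i hi).1
        split_ifs with h1
        · simp
        · exact sub_pos.2 (hd (i - 1) (by omega)).2)
    refine ⟨ν.map (fun x => x ^ 2), ⟨Measure.isProbabilityMeasure_map (by fun_prop), ?_, ?_⟩, ?_⟩
    · rw [Measure.map_apply (by fun_prop) (measurableSet_carrier _).compl]
      refine measure_mono_null (fun x (hx : x ^ 2 ∉ Icc (0 : ℝ) 1) (hx' : x ∈ Icc (-1 : ℝ) 1) =>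
        hx ?_) h4
      exact ⟨sq_nonneg x, (sq_le_one_iff_abs_le_one x).2 (abs_le.2 hx')⟩
    · intro j
      exact (integrable_map_measure (by fun_prop) (by fun_prop)).2 (h2 _)
    · intro j hj
      rw [moment_map_sq, h3 _ (by omega), hm j hj]
      rfl
  · obtain ⟨ν, h1, h2, h3⟩ := exists_measure_pathSum (fun _ => 0) (b := y') (N := 2 * n)
      (fun i hi _ => hd i hi)
    refine ⟨ν.map (fun x => x ^ 2), ⟨Measure.isProbabilityMeasure_map (by fun_prop), ?_, ?_⟩, ?_⟩
    · rw [Measure.map_apply (by fun_prop) (measurableSet_carrier _).compl]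
      convert measure_empty (μ := ν)
      ext x
      simp [Support.carrier, sq_nonneg]
    · intro j
      exact (integrable_map_measure (by fun_prop) (by fun_prop)).2 (h2 _)
    · intro j hj
      rw [moment_map_sq, h3 _ (by omega), hm j hj]
      rfl
  · obtain ⟨ν, h1, h2, h3⟩ := exists_measure_pathSum (jacobiA .line y') (b := jacobiB .line y')
      (N := n) (fun i hi _ => by simpa [coordDomain, parity_simps, jacobiB] using hd (2 * i) (by omega))
    exact ⟨ν, ⟨h1, by simp [Support.carrier], fun j => h2 _⟩, fun j hj => by
      rw [h3 j hj, hm j hj]; rfl⟩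

/-! ## Bounds for the canonical coordinates of a measure -/

/-- The closure of the domain of the `j`-th canonical coordinate. -/
def closedDomain : Support → ℕ → Set ℝ
  | .unit, _ => Icc 0 1
  | .halfLine, _ => Ici 0
  | .line, j => if Odd j then univ else Ici 0

lemma interior_closedDomain (E : Support) (j : ℕ) : interior (closedDomain E j) = coordDomain E j := by
  rcases E with _ | _ | _ <;> simp only [closedDomain, coordDomain]
  · exact interior_Icc
  · exact interior_Ici
  · split_ifs
    · exact interior_univ
    · exact interior_Ici

lemma closure_coordDomain (E : Support) (j : ℕ) : closure (coordDomain E j) = closedDomain E j := by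
  rcases E with _ | _ | _ <;> simp only [closedDomain, coordDomain]
  · exact closure_Ioo zero_ne_one
  · exact closure_Ioi 0
  · split_ifs
    · exact closure_univ
    · exact closure_Ioi 0

lemma isOpen_coordDomain (E : Support) (j : ℕ) : IsOpen (coordDomain E j) := by
  rw [← interior_closedDomain]
  exact isOpen_interior

lemma symmSeq_eq_pathSum {s b : ℕ → ℝ} {n : ℕ}
    (h : ∀ j ≤ n, s j = pathSum (fun _ => 0) b (2 * j) 0) :
    ∀ i ≤ 2 * n + 1, symmSeq s i = pathSum (fun _ => 0) b i 0 := by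
  intro i hi
  rcases Nat.even_or_odd' i with ⟨k, rfl | rfl⟩
  · rw [symmSeq, if_pos (even_two_mul k), Nat.mul_div_cancel_left _ two_pos, h k (by omega)]
  · rw [symmSeq, if_neg (by simp), pathSum_zero_of_odd (by simp)]

/-- When the square is expanded, orthogonality kills `f * P`, leaves only the top coefficient in `X
* f * P`, and `X * P ^ 2` vanishes because the diagonal parameters are zero. -/
lemma momentFunctional_step {b s : ℕ → ℝ} {N m : ℕ}
    (hs : ∀ i ≤ N, s i = pathSum (fun _ => 0) b i 0) (hN : 2 * (m + 1) + 1 ≤ N)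
    {f : Polynomial ℝ} (hf : f.natDegree ≤ m) (c : ℝ) :
    momentFunctional s ((1 - Polynomial.X) * (f + Polynomial.C c * jacobiPoly (fun _ => 0) b (m + 1)) ^ 2)
      = momentFunctional s ((1 - Polynomial.X) * f ^ 2)
        - 2 * c * f.coeff m * ∏ i ∈ Finset.range (m + 1), b (i + 1)
        + c ^ 2 * ∏ i ∈ Finset.range (m + 1), b (i + 1) := by
  have h1 := momentFunctional_mul_jacobiPoly_of_lt hs hf (Nat.lt_succ_self m) (by omega)
  have hX : (Polynomial.X * f).natDegree ≤ m + 1 :=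
    Polynomial.natDegree_mul_le.trans (by rw [Polynomial.natDegree_X]; omega)
  have h2 := momentFunctional_mul_jacobiPoly_of_le hs hX (by omega)
  rw [Polynomial.coeff_X_mul] at h2
  have h3 := momentFunctional_jacobiPoly_sq hs (show 2 * (m + 1) ≤ N by omega)
  have h4 := momentFunctional_X_mul_jacobiPoly_sq hs (show 2 * (m + 1) + 1 ≤ N by omega)
  set P := jacobiPoly (fun _ => 0) b (m + 1)
  have hC : Polynomial.C (2 * c) = 2 * Polynomial.C c := by rw [map_mul, map_ofNat]
  have hC2 : Polynomial.C (c ^ 2) = Polynomial.C c ^ 2 := by simp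
  rw [show (1 - Polynomial.X) * (f + Polynomial.C c * P) ^ 2 = (1 - Polynomial.X) * f ^ 2
      + Polynomial.C (2 * c) * (f * P) - Polynomial.C (2 * c) * (Polynomial.X * f * P)
      + Polynomial.C (c ^ 2) * P ^ 2 - Polynomial.C (c ^ 2) * (Polynomial.X * P ^ 2) by
    rw [hC, hC2]; ring]
  simp only [momentFunctional_sub, momentFunctional_add, momentFunctional_C_mul]
  rw [h1, h2, h3, h4]
  ring

/-- A test polynomial for the upper bound on the top canonical coordinate. -/
lemma exists_testPolynomial {y s : ℕ → ℝ} {n : ℕ} (hn : 1 ≤ n)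
    (hs : ∀ i ≤ 2 * n + 1, s i = pathSum (fun _ => 0) (chainParam y) i 0)
    (hy : ∀ j, 1 ≤ j → j < n → y j ∈ Ioo (0 : ℝ) 1) : ∀ m < n,
    ∃ f : Polynomial ℝ, f.natDegree ≤ m ∧ f.coeff m ≠ 0 ∧
      momentFunctional s ((1 - Polynomial.X) * f ^ 2)
        = f.coeff m ^ 2 * (∏ i ∈ Finset.range m, chainParam y (i + 1))
          * (1 - if m = 0 then 0 else y m) := by
  intro m
  induction m with
  | zero =>
    refine fun _ => ⟨1, by simp, by simp, ?_⟩
    have h0 : s 0 = 1 := by rw [hs 0 (by omega)]; simp [pathSum]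
    have h1 : s 1 = 0 := by rw [hs 1 (by omega)]; simp [pathSum]
    rw [one_pow, mul_one, momentFunctional_sub, ← pow_zero Polynomial.X, momentFunctional_X_pow,
      ← pow_one Polynomial.X, pow_zero, momentFunctional_X_pow]
    simp [h0, h1]
  | succ m ih =>
    intro hm
    obtain ⟨f, h1, h2, h3⟩ := ih (by omega)
    have hy1 := hy (m + 1) (by omega) hm
    have hy0 : y (m + 1) ≠ 0 := hy1.1.ne'
    have hc : (f + Polynomial.C (f.coeff m / y (m + 1)) * jacobiPoly (fun _ => 0) (chainParam y)
        (m + 1)).coeff (m + 1) = f.coeff m / y (m + 1) := by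
      rw [Polynomial.coeff_add, Polynomial.coeff_C_mul, coeff_jacobiPoly,
        Polynomial.coeff_eq_zero_of_natDegree_lt (by omega)]
      ring
    -- The coefficient `c = f.coeff m / y (m + 1)` is the one for which the new value again has the
    -- asserted form, with `c` as top coefficient.
    refine ⟨f + Polynomial.C (f.coeff m / y (m + 1)) * jacobiPoly (fun _ => 0) (chainParam y) (m + 1),
      ?_, ?_, ?_⟩
    · refine Polynomial.natDegree_add_le_of_degree_le (by omega) ?_
      exact (Polynomial.natDegree_C_mul_le _ _).trans (natDegree_jacobiPoly _ _ _).le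
    · rw [hc]
      exact div_ne_zero h2 hy0
    · rw [hc, momentFunctional_step hs (by omega) h1, h3, Finset.prod_range_succ]
      simp only [chainParam, Nat.add_eq_right, Nat.add_sub_cancel, Nat.add_eq_zero_iff, one_ne_zero,
        and_false, if_false]
      field_simp
      ring

/-- Nonnegative test functions give the bounds: `P_n ^ 2` yields `coordWeight * y_n ≥ 0`, and for
`[0,1]` a multiple of `1 - X` by a square yields `y_n ≤ 1`. -/
lemma mem_closedDomain_of_moment {E : Support} {μ : Measure ℝ} (hμ : μ ∈ probMeasures E)
    {y : ℕ → ℝ} {n : ℕ} (hn : 1 ≤ n) (hm : ∀ j ≤ n, moment μ j = mom E y j)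
    (hy : InDomain E y (n - 1)) : y n ∈ closedDomain E n := by
  obtain ⟨hprob, hsupp, hint⟩ := hμ
  have hwt := coordWeight_pos hy
  rcases E with _ | _ | _
  · have hs := symmSeq_eq_pathSum (s := moment μ) (b := chainParam y) (n := n) hm
    have hae : ∀ᵐ x ∂μ, x ∈ Icc (0 : ℝ) 1 := hsupp
    have hL := fun p => (momentFunctional_symmSeq hint (hae.mono fun x hx => hx.1) p).2
    obtain ⟨n, rfl⟩ : ∃ k, n = k + 1 := ⟨n - 1, by omega⟩
    have hw := coordWeight_unit y n
    have hchain : (∏ i ∈ Finset.range (n + 1), chainParam y (i + 1))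
        = coordWeight .unit y (n + 1) * y (n + 1) := by
      rw [hw, Finset.prod_range_succ, chainParam]
      simp only [Nat.add_eq_right, Nat.add_sub_cancel]
      ring
    constructor
    · have h1 := momentFunctional_jacobiPoly_sq hs (show 2 * (n + 1) ≤ 2 * (n + 1) + 1 by omega)
      rw [hL, hchain] at h1
      have h2 : 0 ≤ coordWeight .unit y (n + 1) * y (n + 1) := by
        rw [← h1]
        refine integral_nonneg fun x => ?_
        simp only [Polynomial.eval_pow, Pi.zero_apply]
        positivity
      exact nonneg_of_mul_nonneg_right h2 hwt
    · obtain ⟨f, h1, h2, h3⟩ := exists_testPolynomial (by omega) hs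
        (fun j h1 h2 => hy j h1 (by omega)) n (by omega)
      -- Now `c = f.coeff n`, with no division by the top coordinate, which may vanish. The value
      -- becomes `(f.coeff n) ^ 2 * coordWeight * (1 - y (n + 1))`.
      have h4 := momentFunctional_step hs (by omega) h1 (f.coeff n)
      have h5 : 0 ≤ momentFunctional (symmSeq (moment μ)) ((1 - Polynomial.X) * (f
          + Polynomial.C (f.coeff n) * jacobiPoly (fun _ => 0) (chainParam y) (n + 1)) ^ 2) := by
        rw [hL]
        refine integral_nonneg_of_ae (hae.mono fun x hx => ?_)
        simp only [Polynomial.eval_mul, Polynomial.eval_pow, Polynomial.eval_sub, Polynomial.eval_one,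
          Polynomial.eval_X, Pi.zero_apply, sub_neg_eq_add]
        have h6 : 0 ≤ 1 - √x := sub_nonneg.2 (Real.sqrt_le_one.2 hx.2)
        positivity
      rw [h4, h3, hchain] at h5
      have h6 : 0 ≤ f.coeff n ^ 2 * coordWeight .unit y (n + 1) * (1 - y (n + 1)) := by
        refine h5.trans (le_of_eq ?_)
        rw [mul_assoc (f.coeff n ^ 2), ← hw]
        ring
      have h7 : 0 < f.coeff n ^ 2 * coordWeight .unit y (n + 1) := by positivity
      linarith [nonneg_of_mul_nonneg_right h6 h7]
  · have hs := symmSeq_eq_pathSum (s := moment μ) (b := y) (n := n) hm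
    have hL := fun p => (momentFunctional_symmSeq hint hsupp p).2
    have h1 := momentFunctional_jacobiPoly_sq hs (show 2 * n ≤ 2 * n + 1 by omega)
    obtain ⟨n, rfl⟩ : ∃ k, n = k + 1 := ⟨n - 1, by omega⟩
    rw [hL, Finset.prod_range_succ, ← coordWeight_halfLine] at h1
    have h2 : 0 ≤ coordWeight .halfLine y (n + 1) * y (n + 1) := by
      rw [← h1]
      refine integral_nonneg fun x => ?_
      simp only [Polynomial.eval_pow, Pi.zero_apply]
      positivity
    exact nonneg_of_mul_nonneg_right h2 hwt
  · simp only [closedDomain]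
    split_ifs with hodd
    · trivial
    · obtain ⟨k, rfl⟩ : ∃ k, n = 2 * k + 2 := by
        obtain ⟨k, hk⟩ := Nat.not_odd_iff_even.1 hodd
        exact ⟨k - 1, by omega⟩
      have hs : ∀ i ≤ 2 * k + 2, moment μ i
          = pathSum (jacobiA .line y) (jacobiB .line y) i 0 := hm
      have h1 := momentFunctional_jacobiPoly_sq hs (show 2 * (k + 1) ≤ 2 * k + 2 by omega)
      rw [momentFunctional_moment hint, Finset.prod_range_succ] at h1
      have h2 : 0 ≤ coordWeight .line y (2 * k + 2) * y (2 * k + 2) := by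
        rw [(coordWeight_line y k).2]
        refine le_of_le_of_eq ?_ h1
        refine integral_nonneg fun x => ?_
        simp only [Polynomial.eval_pow, Pi.zero_apply]
        positivity
      exact nonneg_of_mul_nonneg_right h2 hwt

/-! ## The canonical coordinates -/

/-- With `mem_momentRange` this places the range between the affine images of the open and the
closed domain, which is enough to read off infimum and supremum. -/
lemma momentRange_subset {E : Support} {s y : ℕ → ℝ} {n : ℕ} (hn : 1 ≤ n)
    (hs : ∀ i < n, s i = mom E y i) (hy : InDomain E y (n - 1)) {x : ℝ}
    (hx : x ∈ momentRange E s n) :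
    ∃ t ∈ closedDomain E n, x = momBase E y n + coordWeight E y n * t := by
  obtain ⟨μ, hμ, h1, h2⟩ := hx
  have hwt := coordWeight_pos hy
  set t := (x - momBase E y n) / coordWeight E y n with ht
  have hxt : x = momBase E y n + coordWeight E y n * t := by
    rw [ht, mul_div_cancel₀ _ hwt.ne']; ring
  have hup : ∀ i < n, Function.update y n t i = y i := fun i hi =>
    Function.update_of_ne hi.ne _ _
  have := mem_closedDomain_of_moment hμ (y := Function.update y n t) hn (fun j hj => by
    rcases hj.lt_or_eq with hj | rfl
    · rw [h1 j hj, hs j hj]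
      exact mom_congr fun i _ hi => (hup i (by omega)).symm
    · rw [h2, mom_eq hn, momBase_congr (y' := y) fun i _ hi => hup i hi,
        coordWeight_congr (y' := y) fun i _ hi => hup i hi, Function.update_self, ← hxt])
    (fun j hj1 hj2 => by rw [hup j (by omega)]; exact hy j hj1 hj2)
  exact ⟨t, by simpa using this, hxt⟩

lemma mem_momentRange {E : Support} {s y : ℕ → ℝ} {n : ℕ} (hn : 1 ≤ n)
    (hs : ∀ i < n, s i = mom E y i) (hy : InDomain E y (n - 1)) {t : ℝ} (ht : t ∈ coordDomain E n) :
    momBase E y n + coordWeight E y n * t ∈ momentRange E s n := by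
  have hup : ∀ i < n, Function.update y n t i = y i := fun i hi =>
    Function.update_of_ne hi.ne _ _
  obtain ⟨μ, hμ, h1⟩ := exists_measure_mom (E := E) (y := Function.update y n t) (n := n)
    (fun j h1 h2 => by
      rcases h2.lt_or_eq with hj | rfl
      · rw [hup j hj]; exact hy j h1 (by omega)
      · simpa using ht)
  refine ⟨μ, hμ, fun i hi => ?_, ?_⟩
  · rw [h1 i hi.le, hs i hi]
    exact mom_congr fun j _ hj => hup j (by omega)
  · rw [h1 n le_rfl, mom_eq hn, momBase_congr (y' := y) fun i _ hi => hup i hi,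
      coordWeight_congr (y' := y) fun i _ hi => hup i hi, Function.update_self]

lemma lowerMoment_eq {E : Support} (hE : E ≠ .line) {s y : ℕ → ℝ} {n : ℕ} (hn : 1 ≤ n)
    (hs : ∀ i < n, s i = mom E y i) (hy : InDomain E y (n - 1)) :
    lowerMoment E s n = momBase E y n := by
  have hwt := coordWeight_pos hy
  rw [lowerMoment, if_neg (by omega)]
  refine csInf_eq_of_forall_ge_of_forall_gt_exists_lt
    ⟨_, mem_momentRange hn hs hy (half_mem_coordDomain E n)⟩ ?_ ?_
  · intro x hx
    obtain ⟨t, ht, rfl⟩ := momentRange_subset hn hs hy hx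
    have : 0 ≤ t := by
      rcases E with _ | _ | _
      · exact ht.1
      · exact ht
      · exact absurd rfl hE
    have := mul_nonneg hwt.le this
    linarith
  · intro w hw
    -- A parameter small enough for its moment to fall below `w`; the cap `1 / 2` keeps it inside
    -- `(0,1)`.
    set t := min (1 / 2) ((w - momBase E y n) / coordWeight E y n / 2) with ht
    have h0 : 0 < (w - momBase E y n) / coordWeight E y n := div_pos (by linarith) hwt
    have h1 : 0 < t := lt_min (by norm_num) (by linarith)
    have h2 : t < 1 := (min_le_left _ _).trans_lt (by norm_num)
    refine ⟨_, mem_momentRange hn hs hy (t := t) ?_, ?_⟩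
    · rcases E with _ | _ | _
      · exact ⟨h1, h2⟩
      · exact h1
      · exact absurd rfl hE
    · have h3 : t < (w - momBase E y n) / coordWeight E y n :=
        (min_le_right _ _).trans_lt (by linarith)
      rw [lt_div_iff₀ hwt] at h3
      linarith

lemma upperMoment_unit_eq {s y : ℕ → ℝ} {n : ℕ} (hn : 1 ≤ n)
    (hs : ∀ i < n, s i = mom .unit y i) (hy : InDomain .unit y (n - 1)) :
    upperMoment .unit s n = momBase .unit y n + coordWeight .unit y n := by
  have hwt := coordWeight_pos hy
  refine csSup_eq_of_forall_le_of_forall_lt_exists_gt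
    ⟨_, mem_momentRange hn hs hy (half_mem_coordDomain .unit n)⟩ ?_ ?_
  · intro x hx
    obtain ⟨t, ht, rfl⟩ := momentRange_subset hn hs hy hx
    have := mul_le_of_le_one_right hwt.le ht.2
    linarith
  · intro w hw
    set r := (momBase .unit y n + coordWeight .unit y n - w) / coordWeight .unit y n with hr
    have h0 : 0 < r := div_pos (by linarith) hwt
    set t := max (1 / 2) (1 - r / 2) with ht
    have h1 : 0 < t := lt_max_of_lt_left (by norm_num)
    have h2 : t < 1 := max_lt (by norm_num) (by linarith)
    refine ⟨_, mem_momentRange hn hs hy (t := t) ⟨h1, h2⟩, ?_⟩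
    have h3 : 1 - r < t := lt_of_lt_of_le (by linarith) (le_max_right _ _)
    have h4 : coordWeight .unit y n * r = momBase .unit y n + coordWeight .unit y n - w :=
      mul_div_cancel₀ _ hwt.ne'
    have h5 := mul_lt_mul_of_pos_left h3 hwt
    linarith

/-- Normalising the affine map `y_n ↦ m_n` recovers its parameter. On the half line the divisor
`m_{n-1} - m_{n-1}^-` is `coordWeight` at `n`, thanks to the convention `m_0^- = 0` when `n = 1`. On
the line the recursion coefficients are the Jacobi parameters. -/
lemma canonicalCoord_eq {E : Support} {s y : ℕ → ℝ} {n : ℕ} (hn : 1 ≤ n)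
    (hs : ∀ i ≤ n, s i = mom E y i) (hy : InDomain E y n) : canonicalCoord E s n = y n := by
  have hy' := hy.mono (Nat.sub_le n 1)
  have hwt := coordWeight_pos hy'
  rcases E with _ | _ | _
  · rw [canonicalCoord, lowerMoment_eq (by simp) hn (fun i hi => hs i hi.le) hy',
      upperMoment_unit_eq hn (fun i hi => hs i hi.le) hy', hs n le_rfl, mom_eq hn,
      add_sub_cancel_left, add_sub_cancel_left, mul_div_cancel_left₀ _ hwt.ne']
  · rw [canonicalCoord, lowerMoment_eq (by simp) hn (fun i hi => hs i hi.le) hy', hs n le_rfl,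
      mom_eq hn, add_sub_cancel_left]
    have : s (n - 1) - lowerMoment .halfLine s (n - 1) = coordWeight .halfLine y n := by
      rcases hn.eq_or_lt with rfl | hn
      · simp [lowerMoment, hs 0 (by omega), mom_zero, coordWeight]
      · rw [lowerMoment_eq (by simp) (by omega) (fun i hi => hs i (by omega))
          (hy.mono (by omega)), hs (n - 1) (by omega), mom_eq (by omega), add_sub_cancel_left]
        obtain ⟨k, rfl⟩ : ∃ k, n = k + 1 := ⟨n - 1, by omega⟩
        rw [coordWeight_succ (by omega), coordFactor, Nat.add_sub_cancel]
    rw [this, mul_div_cancel_left₀ _ hwt.ne']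
  · have hb : ∀ i, 1 ≤ i → 2 * i < n → jacobiB .line y i ≠ 0 := by
      intro i h1 h2
      have := hy (2 * i) (by omega) (by omega)
      simp only [coordDomain, Nat.not_odd_iff_even.2 (even_two_mul i), if_false] at this
      exact ne_of_gt this
    have hs' : ∀ i ≤ n, s i = pathSum (jacobiA .line y) (jacobiB .line y) i 0 := hs
    simp only [canonicalCoord]
    rcases Nat.even_or_odd' n with ⟨k, rfl | rfl⟩
    · obtain ⟨k, rfl⟩ : ∃ j, k = j + 1 := ⟨k - 1, by omega⟩
      rw [if_neg (by simp), Nat.mul_div_cancel_left _ two_pos, recBeta_eq hs' hb le_rfl]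
      rfl
    · rw [if_pos (by simp), show (2 * k + 1 + 1) / 2 = k + 1 by omega, recAlpha_eq hs' hb le_rfl]
      rfl

/-! ## Solving for the canonical coordinates -/

/-- Successively computes canonical coordinates `y_j`: for `j ∈ I` from the condition `m_j = c_j`,
otherwise as `y_j = u_j`. -/
noncomputable def solveCoords (E : Support) (I : Finset ℕ) (c u : ℕ → ℝ) : ℕ → ℕ → ℝ
  | 0 => fun _ => 0
  | j + 1 => Function.update (solveCoords E I c u j) (j + 1)
      (if j + 1 ∈ I then (c (j + 1) - momBase E (solveCoords E I c u j) (j + 1)) /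
        coordWeight E (solveCoords E I c u j) (j + 1) else u (j + 1))

section Solve

variable {E : Support} {I : Finset ℕ} {c u y : ℕ → ℝ}

lemma solveCoords_succ_self (n : ℕ) : solveCoords E I c u (n + 1) (n + 1) =
    if n + 1 ∈ I then (c (n + 1) - momBase E (solveCoords E I c u n) (n + 1)) /
        coordWeight E (solveCoords E I c u n) (n + 1) else u (n + 1) := by
  rw [solveCoords, Function.update_self]

lemma solveCoords_of_le {n i : ℕ} (h : i ≤ n) :
    solveCoords E I c u n i = solveCoords E I c u i i := by
  induction n, h using Nat.le_induction with
  | base => rfl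
  | succ n hn ih => rw [solveCoords, Function.update_of_ne (by omega), ih]

lemma solveCoords_of_le_of_le {n k i : ℕ} (h : i ≤ n) (hk : i ≤ k) :
    solveCoords E I c u n i = solveCoords E I c u k i := by
  rw [solveCoords_of_le h, solveCoords_of_le hk]

/-- Uniqueness: `m_j` is affine in `y_j` with nonzero slope, so a constraint determines `y_j` from
its predecessors. The slopes involve only `y_1, …, y_{n-1}`, hence the domain condition up to `n -
1`. -/
lemma solveCoords_eq {n : ℕ} (hy : InDomain E y (n - 1))
    (hc : ∀ j, 1 ≤ j → j ≤ n → j ∈ I → mom E y j = c j)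
    (hu : ∀ j, 1 ≤ j → j ≤ n → j ∉ I → y j = u j) :
    ∀ j, 1 ≤ j → j ≤ n → solveCoords E I c u n j = y j := by
  have key : ∀ k ≤ n, ∀ j, 1 ≤ j → j ≤ k → solveCoords E I c u k j = y j := by
    intro k
    induction k with
    | zero => intro _ j h1 h2; omega
    | succ k ih =>
      intro hk j h1 h2
      rcases h2.lt_or_eq with h2 | rfl
      · rw [solveCoords, Function.update_of_ne h2.ne, ih (by omega) j h1 (by omega)]
      · have ih' := ih (by omega)
        rw [solveCoords_succ_self]
        split_ifs with hI
        · rw [momBase_congr (y' := y) fun i h1 h2 => ih' i h1 (by omega),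
            coordWeight_congr (y' := y) fun i h1 h2 => ih' i h1 (by omega), ← hc _ h1 hk hI,
            mom_eq h1, add_sub_cancel_left, mul_div_cancel_left₀]
          exact (coordWeight_pos (hy.mono (by omega))).ne'
        · exact (hu _ h1 hk hI).symm
  exact key n le_rfl

lemma mom_solveCoords {n : ℕ} (hy : InDomain E (solveCoords E I c u n) (n - 1)) {j : ℕ} (h1 : 1 ≤ j)
    (h2 : j ≤ n) (hj : j ∈ I) : mom E (solveCoords E I c u n) j = c j := by
  obtain ⟨k, rfl⟩ : ∃ k, j = k + 1 := ⟨j - 1, by omega⟩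
  have hwt : coordWeight E (solveCoords E I c u n) (k + 1) ≠ 0 :=
    (coordWeight_pos (hy.mono (by omega))).ne'
  rw [mom_eq h1, solveCoords_of_le h2, solveCoords_succ_self, if_pos hj,
    momBase_congr (y' := solveCoords E I c u n) (y := solveCoords E I c u k)
      fun i _ hi => solveCoords_of_le_of_le (by omega) (by omega),
    coordWeight_congr (y' := solveCoords E I c u n) (y := solveCoords E I c u k)
      fun i _ hi => solveCoords_of_le_of_le (by omega) (by omega), mul_div_cancel₀ _ hwt]
  ring

lemma solveCoords_of_notMem {n : ℕ} {j : ℕ} (h1 : 1 ≤ j) (h2 : j ≤ n) (hj : j ∉ I) :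
    solveCoords E I c u n j = u j := by
  obtain ⟨k, rfl⟩ : ∃ k, j = k + 1 := ⟨j - 1, by omega⟩
  rw [solveCoords_of_le h2, solveCoords_succ_self, if_neg hj]

end Solve

/-! ### Smooth dependence of moments and solved coordinates on parameters. -/

section Smooth

variable {E : Support} {X : Type*} [NormedAddCommGroup X] [NormedSpace ℝ X] {r : WithTop ℕ∞} {x : X}

lemma contDiffAt_mom {y : X → ℕ → ℝ} (hy : ∀ i, ContDiffAt ℝ r (fun x => y x i) x) (n : ℕ) :
    ContDiffAt ℝ r (fun x => mom E (y x) n) x := by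
  refine contDiffAt_pathSum ?_ ?_ _ _
  · intro i
    rcases E with _ | _ | _
    · exact contDiffAt_const
    · exact contDiffAt_const
    · exact hy _
  · intro i
    rcases E with _ | _ | _
    · simp only [jacobiB, chainParam]
      refine (contDiffAt_const.sub ?_).mul (hy i)
      split_ifs
      · exact contDiffAt_const
      · exact hy _
    · exact hy _
    · exact hy _

lemma contDiffAt_momBase {y : X → ℕ → ℝ} (hy : ∀ i, ContDiffAt ℝ r (fun x => y x i) x) (n : ℕ) :
    ContDiffAt ℝ r (fun x => momBase E (y x) n) x := by
  refine contDiffAt_mom (fun i => ?_) n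
  split_ifs
  · exact hy i
  · exact contDiffAt_const

lemma contDiffAt_coordWeight {y : X → ℕ → ℝ} (hy : ∀ i, ContDiffAt ℝ r (fun x => y x i) x) (n : ℕ) :
    ContDiffAt ℝ r (fun x => coordWeight E (y x) n) x := by
  refine contDiffAt_prod fun i _ => ?_
  rcases E with _ | _ | _ <;> simp only [coordFactor]
  · exact (hy i).mul (contDiffAt_const.sub (hy i))
  · exact hy i
  · split_ifs
    · exact contDiffAt_const
    · exact hy i

/-- The only divisions are by `coordWeight`, which is positive while the coordinates lie in their
domains. -/
lemma contDiffAt_solveCoords {I : Finset ℕ} {c u : X → ℕ → ℝ}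
    (hc : ∀ i, ContDiffAt ℝ r (fun x => c x i) x) (hu : ∀ i, ContDiffAt ℝ r (fun x => u x i) x)
    {n : ℕ} (hy : InDomain E (solveCoords E I (c x) (u x) n) (n - 1)) (i : ℕ) :
    ContDiffAt ℝ r (fun x => solveCoords E I (c x) (u x) n i) x := by
  induction n generalizing i with
  | zero => exact contDiffAt_const
  | succ n ih =>
    have hd : InDomain E (solveCoords E I (c x) (u x) n) n := fun j h1 h2 => by
      rw [solveCoords_of_le_of_le h2 (h2.trans n.le_succ)]
      exact hy j h1 h2
    have ih' := ih (hd.mono (Nat.sub_le n 1))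
    rcases eq_or_ne i (n + 1) with rfl | hi
    · simp only [solveCoords_succ_self]
      split_ifs with hI
      · exact ((hc _).sub (contDiffAt_momBase ih' _)).div (contDiffAt_coordWeight ih' _)
          (coordWeight_pos hd).ne'
      · exact hu _
    · simp only [solveCoords, Function.update_of_ne hi]
      exact ih' i

end Smooth

lemma jacobian_mulVec {ι κ : Type*} [Fintype ι] [DecidableEq ι] [Fintype κ] (g : (ι → ℝ) → (κ → ℝ))
    (x h : ι → ℝ) : (jacobian g x).mulVec h = fderiv ℝ g x h := by
  ext i
  conv_rhs => rw [show h = ∑ j, h j • Pi.single j (1 : ℝ) by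
    ext k; simp [Finset.sum_apply, Pi.single_apply]]
  simp only [map_sum, map_smul, Finset.sum_apply, Pi.smul_apply, smul_eq_mul, Matrix.mulVec,
    dotProduct, jacobian, Matrix.of_apply]
  exact Finset.sum_congr rfl fun j _ => mul_comm _ _

/-! ## The interior of the moment space -/

lemma momentSeq_zero {n : ℕ} (m : Fin n → ℝ) : momentSeq m 0 = 1 := if_pos rfl

lemma momentSeq_val_succ {n : ℕ} (m : Fin n → ℝ) (i : Fin n) : momentSeq m (i + 1) = m i := by
  simp [momentSeq]

lemma forall_fin_iff {n : ℕ} {p : ℕ → Prop} :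
    (∀ i : Fin n, p (i + 1)) ↔ ∀ j, 1 ≤ j → j ≤ n → p j := by
  constructor
  · intro h j h1 h2
    have := h ⟨j - 1, by omega⟩
    rwa [show ((⟨j - 1, by omega⟩ : Fin n) : ℕ) + 1 = j by simp; omega] at this
  · exact fun h i => h _ (by omega) (by omega)

lemma momentSeq_eq_iff {E : Support} {n : ℕ} {m : Fin n → ℝ} {y : ℕ → ℝ} :
    (∀ j ≤ n, momentSeq m j = mom E y j) ↔ ∀ i : Fin n, m i = mom E y (i + 1) := by
  constructor
  · intro h i
    rw [← h (i + 1) (by omega), momentSeq_val_succ]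
  · intro h j hj
    rcases Nat.eq_zero_or_pos j with rfl | h0
    · rw [momentSeq_zero, mom_zero]
    · obtain ⟨i, rfl⟩ : ∃ i : Fin n, j = i + 1 := ⟨⟨j - 1, by omega⟩, by simp; omega⟩
      rw [momentSeq_val_succ, h]

lemma contDiff_momentSeq {r : WithTop ℕ∞} (n j : ℕ) :
    ContDiff ℝ r (fun m : Fin n → ℝ => momentSeq m j) := by
  unfold momentSeq
  split_ifs
  · exact contDiff_const
  · exact contDiff_apply ℝ ℝ _
  · exact contDiff_const

lemma eventually_inDomain {E : Support} {X : Type*} [TopologicalSpace X] {x : X} {y : X → ℕ → ℝ}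
    {n : ℕ} (hy : ∀ i, ContinuousAt (fun x => y x i) x) (h : InDomain E (y x) n) :
    ∀ᶠ z in 𝓝 x, InDomain E (y z) n := by
  have : ∀ᶠ z in 𝓝 x, ∀ i ∈ Finset.Icc 1 n, y z i ∈ coordDomain E i := by
    rw [Filter.eventually_all_finset]
    intro i hi
    have hi' := Finset.mem_Icc.1 hi
    exact hy i ((isOpen_coordDomain E i).mem_nhds (h i hi'.1 hi'.2))
  filter_upwards [this] with z hz j h1 h2
  exact hz j (Finset.mem_Icc.2 ⟨h1, h2⟩)

/-- Canonical coordinates computed from all moments. -/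
noncomputable def coordsOfMoments (E : Support) {n : ℕ} (m : Fin n → ℝ) : ℕ → ℝ :=
  solveCoords E (Finset.range (n + 1)) (momentSeq m) 0 n

lemma coordsOfMoments_eq {E : Support} {n : ℕ} {m : Fin n → ℝ} {y : ℕ → ℝ} (hy : InDomain E y n)
    (h : ∀ j ≤ n, momentSeq m j = mom E y j) : ∀ j, 1 ≤ j → j ≤ n → coordsOfMoments E m j = y j :=
  solveCoords_eq (hy.mono (Nat.sub_le _ _)) (fun _ _ h2 _ => (h _ h2).symm)
    (fun _ _ h2 h3 => absurd (Finset.mem_range.2 (Nat.lt_succ_of_le h2)) h3)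

lemma contDiffAt_coordsOfMoments {E : Support} {n : ℕ} {m : Fin n → ℝ} {r : WithTop ℕ∞}
    (h : InDomain E (coordsOfMoments E m) n) (i : ℕ) :
    ContDiffAt ℝ r (fun m : Fin n → ℝ => coordsOfMoments E m i) m :=
  contDiffAt_solveCoords (c := fun m : Fin n → ℝ => momentSeq m) (u := fun _ => 0)
    (fun i => (contDiff_momentSeq n i).contDiffAt) (fun _ => contDiffAt_const)
    (h.mono (Nat.sub_le _ _)) i

lemma eventually_coordsOfMoments {E : Support} {n : ℕ} {m : Fin n → ℝ}
    (h : InDomain E (coordsOfMoments E m) n) :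
    ∀ᶠ m' in 𝓝 m, InDomain E (coordsOfMoments E m') n ∧
      ∀ j ≤ n, momentSeq m' j = mom E (coordsOfMoments E m') j := by
  filter_upwards [eventually_inDomain
    (fun i => (contDiffAt_coordsOfMoments (r := 0) h i).continuousAt) h] with m' hm'
  refine ⟨hm', fun j hj => ?_⟩
  rcases Nat.eq_zero_or_pos j with rfl | h0
  · rw [momentSeq_zero, mom_zero]
  · exact (mom_solveCoords (hm'.mono (Nat.sub_le _ _)) h0 hj (by simpa using hj)).symm

/-- The coordinates vary continuously with the moments and the domains are open, so nearby vectors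
are realised by measures as well. -/
lemma mem_interior_of_inDomain {E : Support} {n : ℕ} {m : Fin n → ℝ} {y : ℕ → ℝ}
    (hy : InDomain E y n) (h : ∀ j ≤ n, momentSeq m j = mom E y j) :
    m ∈ interior (momentSpace E n) := by
  have h1 : InDomain E (coordsOfMoments E m) n := fun j hj1 hj2 => by
    rw [coordsOfMoments_eq hy h j hj1 hj2]
    exact hy j hj1 hj2
  rw [mem_interior_iff_mem_nhds]
  filter_upwards [eventually_coordsOfMoments h1] with m' hm'
  obtain ⟨μ, hμ, h2⟩ := exists_measure_mom hm'.1
  exact ⟨μ, hμ, fun i => by rw [h2 _ (by omega), ← hm'.2 _ (by omega), momentSeq_val_succ]⟩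

/-- Induction on the number of moments: with the earlier ones fixed, the last may move in a
neighbourhood. Its parameter therefore has a neighbourhood inside the closed domain and lies in the
open one. -/
lemma exists_inDomain_of_mem_interior {E : Support} {n : ℕ} {m : Fin n → ℝ}
    (hm : m ∈ interior (momentSpace E n)) :
    ∃ y, InDomain E y n ∧ ∀ i : Fin n, m i = mom E y (i + 1) := by
  induction n with
  | zero => exact ⟨0, fun j h1 h2 => by omega, fun i => i.elim0⟩
  | succ n ih =>
    rw [mem_interior_iff_mem_nhds] at hm
    have hinit : (fun i => m (Fin.castSucc i)) ∈ interior (momentSpace E n) := by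
      rw [mem_interior_iff_mem_nhds]
      have hc : Continuous fun m' : Fin n → ℝ =>
          (Fin.snoc m' (m (Fin.last n)) : Fin (n + 1) → ℝ) :=
        Continuous.finSnoc continuous_id continuous_const
      have hm0 : (Fin.snoc (fun i => m (Fin.castSucc i)) (m (Fin.last n)) : Fin (n + 1) → ℝ) = m :=
        Fin.snoc_init_self m
      filter_upwards [hc.continuousAt.preimage_mem_nhds (by rw [hm0]; exact hm)] with m' hm'
      obtain ⟨μ, hμ, h⟩ := hm'
      exact ⟨μ, hμ, fun i => by simpa using h (Fin.castSucc i)⟩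
    obtain ⟨y, hy, h⟩ := ih hinit
    have hwt : 0 < coordWeight E y (n + 1) := coordWeight_pos hy
    set t := (m (Fin.last n) - momBase E y (n + 1)) / coordWeight E y (n + 1) with ht
    have hup : ∀ (x : ℝ), ∀ i < n + 1, Function.update y (n + 1) x i = y i := fun x i hi =>
      Function.update_of_ne hi.ne _ _
    have hmom : ∀ x : ℝ, mom E (Function.update y (n + 1) x) (n + 1)
        = momBase E y (n + 1) + coordWeight E y (n + 1) * x := fun x => by
      rw [mom_eq (by omega), momBase_congr (y' := y) fun i _ hi => hup x i hi,
        coordWeight_congr (y' := y) fun i _ hi => hup x i hi, Function.update_self]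
    have hmt : m (Fin.last n) = momBase E y (n + 1) + coordWeight E y (n + 1) * t := by
      rw [ht, mul_div_cancel₀ _ hwt.ne']; ring
    have htmem : t ∈ coordDomain E (n + 1) := by
      rw [← interior_closedDomain, mem_interior_iff_mem_nhds]
      have hc : Continuous fun x : ℝ => (Function.update m (Fin.last n)
          (momBase E y (n + 1) + coordWeight E y (n + 1) * x)) := by fun_prop
      filter_upwards [hc.continuousAt.preimage_mem_nhds (x := t)
        (by rw [← hmt, Function.update_eq_self]; exact hm)] with x hx
      obtain ⟨μ, hμ, h2⟩ := hx
      simp only at h2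
      have := mem_closedDomain_of_moment hμ (y := Function.update y (n + 1) x) (n := n + 1)
        (by omega) (fun j hj => by
          rcases Nat.eq_zero_or_pos j with rfl | h0
          · have := hμ.1
            simp [moment, mom_zero]
          rcases hj.lt_or_eq with hj | rfl
          · have h3 := h2 (Fin.castSucc ⟨j - 1, by omega⟩)
            rw [Function.update_of_ne (Fin.castSucc_lt_last _).ne, h] at h3
            simp only [Fin.val_castSucc, show j - 1 + 1 = j by omega] at h3
            rw [← h3]
            exact mom_congr fun i _ hi => (hup x i (by omega)).symm
          · have h3 := h2 (Fin.last n)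
            rw [Function.update_self, Fin.val_last] at h3
            rw [← h3, hmom])
        (fun j h1 h2 => by rw [hup x j (by omega)]; exact hy j h1 (by omega))
      simpa using this
    refine ⟨Function.update y (n + 1) t, fun j h1 h2 => ?_, fun i => ?_⟩
    · rcases h2.lt_or_eq with h2 | rfl
      · rw [hup t j h2]; exact hy j h1 (by omega)
      · rwa [Function.update_self]
    · refine Fin.lastCases ?_ (fun i => ?_) i
      · rw [Fin.val_last, hmom, ← hmt]
      · have := h i
        rw [this, Fin.val_castSucc]
        exact mom_congr fun k _ hk => (hup t k (by omega)).symm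

/-- The canonical coordinates as a sequence. -/
noncomputable def coords (E : Support) {n : ℕ} (m : Fin n → ℝ) : ℕ → ℝ :=
  canonicalCoord E (momentSeq m)

lemma mem_interior_iff {E : Support} {n : ℕ} {m : Fin n → ℝ} :
    m ∈ interior (momentSpace E n) ↔
      ∃ y, InDomain E y n ∧ ∀ j ≤ n, momentSeq m j = mom E y j :=
  ⟨fun h => (exists_inDomain_of_mem_interior h).imp fun _ hy => ⟨hy.1, momentSeq_eq_iff.2 hy.2⟩,
    fun ⟨_, hy, h⟩ => mem_interior_of_inDomain hy h⟩

lemma coords_eq {E : Support} {n k : ℕ} {m : Fin k → ℝ} {y : ℕ → ℝ} (hy : InDomain E y n)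
    (h : ∀ j ≤ n, momentSeq m j = mom E y j) {j : ℕ} (h1 : 1 ≤ j) (h2 : j ≤ n) :
    coords E m j = y j :=
  canonicalCoord_eq h1 (fun i hi => h i (hi.trans h2)) (hy.mono h2)

lemma coords_of_mem_interior {E : Support} {n : ℕ} {m : Fin n → ℝ}
    (hm : m ∈ interior (momentSpace E n)) :
    InDomain E (coords E m) n ∧ ∀ j ≤ n, momentSeq m j = mom E (coords E m) j := by
  obtain ⟨y, hy, h⟩ := mem_interior_iff.1 hm
  refine ⟨fun j h1 h2 => ?_, fun j hj => ?_⟩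
  · rw [coords_eq hy h h1 h2]; exact hy j h1 h2
  · rw [h j hj]
    exact mom_congr fun i h1 h2 => (coords_eq hy h h1 (h2.trans hj)).symm

lemma contDiffAt_coords {E : Support} {n : ℕ} {m : Fin n → ℝ} {r : WithTop ℕ∞}
    (hm : m ∈ interior (momentSpace E n)) {j : ℕ} (h1 : 1 ≤ j) (h2 : j ≤ n) :
    ContDiffAt ℝ r (fun m : Fin n → ℝ => coords E m j) m := by
  obtain ⟨hd, h⟩ := coords_of_mem_interior hm
  have hd' : InDomain E (coordsOfMoments E m) n := fun j h1 h2 => by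
    rw [coordsOfMoments_eq hd h j h1 h2]; exact hd j h1 h2
  refine (contDiffAt_coordsOfMoments hd' j).congr_of_eventuallyEq ?_
  filter_upwards [isOpen_interior.mem_nhds hm] with m' hm'
  obtain ⟨hd'', h''⟩ := coords_of_mem_interior hm'
  exact (coordsOfMoments_eq hd'' h'' j h1 h2).symm

/-! ## Constraints -/

section Constraint

variable {E : Support} {C : Constraint} {n : ℕ}

lemma Constraint.le_top {i : ℕ} (hi : i ∈ C.idx) : i ≤ C.top := Finset.le_sup (f := id) hi

/-- Every constrained index is at most `n`, so the constraint can be read off from `m`, whatever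
measure represents it. -/
lemma mem_relInterior_iff (hn : C.top ≤ n) {m : Fin n → ℝ} :
    m ∈ relInterior E C n ↔ m ∈ interior (momentSpace E n) ∧
      ∀ i ∈ C.idx, momentSeq m i = C.val i := by
  constructor
  · rintro ⟨⟨μ, hμ, h1, h2⟩, h⟩
    refine ⟨h, fun i hi => ?_⟩
    have hi1 := C.one_le i hi
    have hi2 := (C.le_top hi).trans hn
    obtain ⟨j, rfl⟩ : ∃ j : Fin n, i = j + 1 := ⟨⟨i - 1, by omega⟩, by simp; omega⟩
    rw [momentSeq_val_succ, h2, h1 _ hi]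
  · rintro ⟨h1, h2⟩
    obtain ⟨hd, h⟩ := coords_of_mem_interior h1
    obtain ⟨μ, hμ, h3⟩ := exists_measure_mom hd
    refine ⟨⟨μ, hμ, fun i hi => ?_, fun i => ?_⟩, h1⟩
    · rw [h3 i ((C.le_top hi).trans hn), ← h i ((C.le_top hi).trans hn), h2 i hi]
    · rw [h3 _ (by omega), ← h _ (by omega), momentSeq_val_succ]

lemma mem_relInterior_of_inDomain (hn : C.top ≤ n) {m : Fin n → ℝ} {y : ℕ → ℝ}
    (hy : InDomain E y n) (h : ∀ j ≤ n, momentSeq m j = mom E y j)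
    (hc : ∀ i ∈ C.idx, mom E y i = C.val i) : m ∈ relInterior E C n :=
  (mem_relInterior_iff hn).2 ⟨mem_interior_of_inDomain hy h, fun i hi => by
    rw [h i ((C.le_top hi).trans hn), hc i hi]⟩

lemma fill_of_notMem (u : Free C n → ℝ) {i : Fin n} (h : (i : ℕ) + 1 ∉ C.idx) :
    fill C n u i = u ⟨i, h⟩ := dif_pos h

lemma fill_of_mem (u : Free C n → ℝ) {i : Fin n} (h : (i : ℕ) + 1 ∈ C.idx) :
    fill C n u i = C.val (i + 1) := dif_neg (not_not.2 h)

lemma freePart_fill (u : Free C n → ℝ) : freePart C (fill C n u) = u := by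
  ext ⟨i, hi⟩
  exact fill_of_notMem u hi

lemma fill_freePart (hn : C.top ≤ n) {m : Fin n → ℝ} (hm : m ∈ relInterior E C n) :
    fill C n (freePart C m) = m := by
  ext i
  by_cases hi : (i : ℕ) + 1 ∈ C.idx
  · rw [fill_of_mem _ hi, ← ((mem_relInterior_iff hn).1 hm).2 _ hi, momentSeq_val_succ]
  · rw [fill_of_notMem _ hi]; rfl

lemma momentSeq_fill_of_mem (hn : C.top ≤ n) (u : Free C n → ℝ) {j : ℕ} (hj : j ∈ C.idx) :
    momentSeq (fill C n u) j = C.val j := by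
  have hi1 := C.one_le j hj
  have hi2 := (C.le_top hj).trans hn
  obtain ⟨i, rfl⟩ : ∃ i : Fin n, j = i + 1 := ⟨⟨j - 1, by omega⟩, by simp; omega⟩
  rw [momentSeq_val_succ, fill_of_mem u hj]

lemma fill_mem_relInterior_iff (hn : C.top ≤ n) {u : Free C n → ℝ} :
    fill C n u ∈ relInterior E C n ↔ fill C n u ∈ interior (momentSpace E n) := by
  rw [mem_relInterior_iff hn]
  exact and_iff_left fun i hi => momentSeq_fill_of_mem hn u hi

lemma contDiff_fill {r : WithTop ℕ∞} : ContDiff ℝ r (fill C n) := by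
  rw [contDiff_pi]
  intro i
  by_cases hi : (i : ℕ) + 1 ∈ C.idx
  · simp only [fill_of_mem _ hi]; exact contDiff_const
  · simp only [fill_of_notMem _ hi]; exact contDiff_apply ℝ ℝ _

/-- The points of the relative interior in terms of the free moments. -/
def freeRegion (E : Support) (C : Constraint) (n : ℕ) : Set (Free C n → ℝ) :=
  fill C n ⁻¹' relInterior E C n

lemma isOpen_freeRegion (hn : C.top ≤ n) : IsOpen (freeRegion E C n) := by
  have : freeRegion E C n = fill C n ⁻¹' interior (momentSpace E n) := by
    ext u
    exact fill_mem_relInterior_iff hn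
  rw [this]
  exact isOpen_interior.preimage (contDiff_fill (r := 0)).continuous

lemma freePart_mem_freeRegion (hn : C.top ≤ n) {m : Fin n → ℝ} (hm : m ∈ relInterior E C n) :
    freePart C m ∈ freeRegion E C n := by
  rw [freeRegion, mem_preimage, fill_freePart hn hm]
  exact hm

/-- All canonical coordinates as functions of the free ones. -/
noncomputable def coordsOfFree (E : Support) (C : Constraint) (n : ℕ) (u : Free C n → ℝ) : ℕ → ℝ :=
  solveCoords E C.idx C.val (momentSeq (fill C n u)) n

lemma coordsOfFree_freeCoords (hn : C.top ≤ n) {m : Fin n → ℝ} (hm : m ∈ relInterior E C n) {j : ℕ}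
    (h1 : 1 ≤ j) (h2 : j ≤ n) : coordsOfFree E C n (freeCoords E C m) j = coords E m j := by
  obtain ⟨hi, hc⟩ := (mem_relInterior_iff hn).1 hm
  obtain ⟨hd, h⟩ := coords_of_mem_interior hi
  refine solveCoords_eq (hd.mono (Nat.sub_le _ _)) (fun j _ h2 h3 => ?_) (fun j h1 h2 h3 => ?_) j h1 h2
  · rw [← h j h2, hc j h3]
  · obtain ⟨i, rfl⟩ : ∃ i : Fin n, j = i + 1 := ⟨⟨j - 1, by omega⟩, by simp; omega⟩
    rw [momentSeq_val_succ, fill_of_notMem _ h3]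
    rfl

/-- Free coordinates and constraints determine all coordinates by successive solving, and these
determine the moments. -/
lemma injOn_freeCoords (hn : C.top ≤ n) : InjOn (freeCoords E C) (relInterior E C n) := by
  intro m hm m' hm' heq
  ext i
  have h := (coords_of_mem_interior ((mem_relInterior_iff hn).1 hm).1).2
  have h' := (coords_of_mem_interior ((mem_relInterior_iff hn).1 hm').1).2
  rw [← momentSeq_val_succ m, ← momentSeq_val_succ m', h _ (by omega), h' _ (by omega)]
  refine mom_congr fun j h1 h2 => ?_
  rw [← coordsOfFree_freeCoords hn hm h1 (by omega), heq, coordsOfFree_freeCoords hn hm' h1 (by omega)]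

lemma momentsOfFree_freeCoords (hn : C.top ≤ n) {m : Fin n → ℝ} (hm : m ∈ relInterior E C n) :
    momentsOfFree E C n (freeCoords E C m) = m :=
  (injOn_freeCoords hn).leftInvOn_invFunOn hm

lemma momentsOfFree_mem {u : Free C n → ℝ} (hu : u ∈ freeDomain E C n) :
    momentsOfFree E C n u ∈ relInterior E C n :=
  Function.invFunOn_mem hu

lemma freeCoords_momentsOfFree {u : Free C n → ℝ} (hu : u ∈ freeDomain E C n) :
    freeCoords E C (momentsOfFree E C n u) = u :=
  Function.invFunOn_eq hu

/-- A criterion by finitely many open conditions on solved coordinates; it yields the openness of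
`freeDomain`. -/
lemma mem_freeDomain_of_inDomain (hn : C.top ≤ n) {u : Free C n → ℝ}
    (h : InDomain E (coordsOfFree E C n u) n) : u ∈ freeDomain E C n := by
  have hm : ∀ j ≤ n, momentSeq (fun i : Fin n => mom E (coordsOfFree E C n u) (i + 1)) j
      = mom E (coordsOfFree E C n u) j := momentSeq_eq_iff.2 fun i => rfl
  refine ⟨fun i => mom E (coordsOfFree E C n u) (i + 1), ?_, ?_⟩
  · exact mem_relInterior_of_inDomain hn h hm fun i hi =>
      mom_solveCoords (h.mono (Nat.sub_le _ _)) (C.one_le i hi) ((C.le_top hi).trans hn) hi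
  · ext ⟨i, hi⟩
    have h1 := coords_eq h hm (j := i + 1) (by omega) (by omega)
    have h2 : coordsOfFree E C n u (i + 1) = momentSeq (fill C n u) (i + 1) :=
      solveCoords_of_notMem (by omega) (by omega) hi
    rw [momentSeq_val_succ, fill_of_notMem _ hi] at h2
    exact h1.trans h2

lemma coordsOfFree_eq (hn : C.top ≤ n) {u : Free C n → ℝ} (hu : u ∈ freeDomain E C n) {j : ℕ}
    (h1 : 1 ≤ j) (h2 : j ≤ n) :
    coordsOfFree E C n u j = coords E (momentsOfFree E C n u) j := by
  conv_lhs => rw [← freeCoords_momentsOfFree hu]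
  exact coordsOfFree_freeCoords hn (momentsOfFree_mem hu) h1 h2

lemma inDomain_coordsOfFree (hn : C.top ≤ n) {u : Free C n → ℝ} (hu : u ∈ freeDomain E C n) :
    InDomain E (coordsOfFree E C n u) n := fun j h1 h2 => by
  rw [coordsOfFree_eq hn hu h1 h2]
  exact (coords_of_mem_interior ((mem_relInterior_iff hn).1 (momentsOfFree_mem hu)).1).1 j h1 h2

lemma momentsOfFree_eq (hn : C.top ≤ n) {u : Free C n → ℝ} (hu : u ∈ freeDomain E C n) (i : Fin n) :
    momentsOfFree E C n u i = mom E (coordsOfFree E C n u) (i + 1) := by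
  rw [← momentSeq_val_succ (momentsOfFree E C n u), (coords_of_mem_interior
    ((mem_relInterior_iff hn).1 (momentsOfFree_mem hu)).1).2 _ (by omega)]
  exact mom_congr fun j h1 h2 => (coordsOfFree_eq hn hu h1 (by omega)).symm

lemma contDiffAt_coordsOfFree (hn : C.top ≤ n) {u : Free C n → ℝ} (hu : u ∈ freeDomain E C n)
    {r : WithTop ℕ∞} (j : ℕ) : ContDiffAt ℝ r (fun u => coordsOfFree E C n u j) u :=
  contDiffAt_solveCoords (c := fun _ => C.val) (u := fun u => momentSeq (fill C n u))
    (fun _ => contDiffAt_const)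
    (fun i => ((contDiff_momentSeq n i).comp contDiff_fill).contDiffAt)
    ((inDomain_coordsOfFree hn hu).mono (Nat.sub_le _ _)) j

lemma isOpen_freeDomain (hn : C.top ≤ n) : IsOpen (freeDomain E C n) := by
  rw [isOpen_iff_mem_nhds]
  intro u hu
  filter_upwards [eventually_inDomain
    (fun i => (contDiffAt_coordsOfFree (r := 0) hn hu i).continuousAt)
    (inDomain_coordsOfFree hn hu)] with u' hu'
  exact mem_freeDomain_of_inDomain hn hu'

lemma contDiffAt_momentsOfFree (hn : C.top ≤ n) {u : Free C n → ℝ} (hu : u ∈ freeDomain E C n)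
    {r : WithTop ℕ∞} : ContDiffAt ℝ r (momentsOfFree E C n) u := by
  rw [contDiffAt_pi]
  intro i
  refine (contDiffAt_mom (E := E) (fun j => contDiffAt_coordsOfFree hn hu j)
    (i + 1)).congr_of_eventuallyEq ?_
  filter_upwards [(isOpen_freeDomain hn).mem_nhds hu] with u' hu'
  exact momentsOfFree_eq hn hu' i

lemma contDiffAt_freeCoords_fill (hn : C.top ≤ n) {v : Free C n → ℝ} (hv : v ∈ freeRegion E C n)
    {r : WithTop ℕ∞} : ContDiffAt ℝ r (fun v => freeCoords E C (fill C n v)) v := by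
  rw [contDiffAt_pi]
  rintro ⟨i, hi⟩
  have h1 := contDiffAt_coords (r := r) ((mem_relInterior_iff hn).1 hv).1 (j := i + 1) (by omega)
    (by omega)
  exact h1.comp v contDiff_fill.contDiffAt

lemma freeCoords_mem_freeDomain {m : Fin n → ℝ} (hm : m ∈ relInterior E C n) :
    freeCoords E C m ∈ freeDomain E C n := ⟨m, hm, rfl⟩

/-- The Jacobian of the free canonical coordinates with respect to the free moments is
injective. -/
lemma jacobian_mulVec_injective (hn : C.top ≤ n) {v : Free C n → ℝ} (hv : v ∈ freeRegion E C n) :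
    Function.Injective (jacobian (fun v => freeCoords E C (fill C n v)) v).mulVec := by
  set F : (Free C n → ℝ) → (Free C n → ℝ) := fun v => freeCoords E C (fill C n v) with hF
  set G : (Free C n → ℝ) → (Free C n → ℝ) := fun u => freePart C (momentsOfFree E C n u) with hG
  have hFd : DifferentiableAt ℝ F v :=
    (contDiffAt_freeCoords_fill (r := 1) hn hv).differentiableAt one_ne_zero
  have hGd : DifferentiableAt ℝ G (F v) := by
    have h1 := (contDiffAt_momentsOfFree (r := 1) hn (freeCoords_mem_freeDomain hv)).differentiableAt
      one_ne_zero
    rw [differentiableAt_pi] at h1 ⊢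
    exact fun i => h1 i.1
  -- `G` is a local left inverse of `F`, so the chain rule makes the derivative of `F` injective.
  have hGF : G ∘ F =ᶠ[𝓝 v] id := by
    filter_upwards [(isOpen_freeRegion hn).mem_nhds hv] with v' hv'
    simp only [hG, hF, Function.comp, id, momentsOfFree_freeCoords hn hv', freePart_fill]
  have hcomp := (hGd.hasFDerivAt.comp v hFd.hasFDerivAt).congr_of_eventuallyEq hGF.symm
  have hid := hcomp.unique (hasFDerivAt_id v)
  intro x x' h
  rw [jacobian_mulVec, jacobian_mulVec] at h
  have h1 := congrArg (fun L => L x) hid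
  have h2 := congrArg (fun L => L x') hid
  simp only [ContinuousLinearMap.comp_apply, ContinuousLinearMap.id_apply] at h1 h2
  rw [← h1, ← h2, h]

end Constraint

/-! ## The potentials -/

/-- The index in `{1, …, K + 2}` whose potential is used at `j`. -/
def repIndex (K j : ℕ) : ℕ := if j ≤ K + 2 then j else if Odd (j - K) then K + 1 else K + 2

lemma repIndex_mem {K j : ℕ} (hj : 1 ≤ j) : repIndex K j ∈ Icc 1 (K + 2) := by
  unfold repIndex
  split_ifs <;> constructor <;> omega

lemma repIndex_mem_of_lt {K j : ℕ} (hj : K < j) : repIndex K j ∈ Icc (K + 1) (K + 2) := by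
  unfold repIndex
  split_ifs <;> constructor <;> omega

/-- `repIndex` shifts the index by an even number, and domains and factors depend on the index only
through its parity. -/
lemma odd_repIndex {K j : ℕ} : Odd (repIndex K j) ↔ Odd j := by
  unfold repIndex
  split_ifs with h1 h2
  · rfl
  · simp only [Nat.odd_iff] at *; omega
  · simp only [Nat.odd_iff] at *; omega

lemma extendPotential_eq (K : ℕ) (V : ℕ → ℝ → ℝ) (j : ℕ) :
    extendPotential K V j = V (repIndex K j) := by
  unfold extendPotential repIndex
  split_ifs <;> rfl

lemma coordDomain_repIndex (E : Support) (K j : ℕ) :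
    coordDomain E (repIndex K j) = coordDomain E j := by
  rcases E with _ | _ | _ <;> simp only [coordDomain, odd_repIndex]

lemma coordFactor_repIndex (E : Support) (K j : ℕ) :
    coordFactor E (repIndex K j) = coordFactor E j := by
  rcases E with _ | _ | _ <;> funext t <;> simp only [coordFactor, odd_repIndex]

lemma effPotential_eq (E : Support) (C : Constraint) (V : ℕ → ℝ → ℝ) (j : ℕ) (t : ℝ) :
    effPotential E C V j t = extendPotential C.top V j t - Real.log (coordFactor E j t) := by
  rcases E with _ | _ | _ <;> simp only [effPotential, coordFactor]
  split_ifs <;> simp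

lemma effPotential_repIndex (E : Support) (C : Constraint) (V : ℕ → ℝ → ℝ) (j : ℕ) :
    effPotential E C V (repIndex C.top j) = effPotential E C V j := by
  funext t
  rw [effPotential_eq, effPotential_eq, coordFactor_repIndex, extendPotential_eq,
    extendPotential_eq]
  congr 2
  unfold repIndex
  split_ifs <;> first | rfl | omega

lemma coordFactor_le {E : Support} {j : ℕ} {t : ℝ} (ht : t ∈ coordDomain E j) :
    coordFactor E j t ≤ max 1 |t| := by
  rcases E with _ | _ | _ <;> simp only [coordFactor, coordDomain] at *
  · exact le_max_of_le_left (by nlinarith [ht.1, ht.2])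
  · exact le_max_of_le_right (le_abs_self t)
  · split_ifs
    · exact le_max_left _ _
    · exact le_max_of_le_right (le_abs_self t)

lemma continuous_coordFactor (E : Support) (j : ℕ) : Continuous (coordFactor E j) := by
  rcases E with _ | _ | _ <;> unfold coordFactor
  · fun_prop
  · fun_prop
  · by_cases h : Odd j <;> simp only [h, if_true, if_false] <;> fun_prop

lemma contDiff_coordFactor (E : Support) (j : ℕ) {r : WithTop ℕ∞} :
    ContDiff ℝ r (coordFactor E j) := by
  rcases E with _ | _ | _ <;> unfold coordFactor
  · fun_prop
  · fun_prop
  · by_cases h : Odd j <;> simp only [h, if_true, if_false] <;> fun_prop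

/-- The exponent needed for the growth of the `j`-th potential. -/
noncomputable def growthExponent : Support → ℕ → ℝ
  | .line, j => if Odd j then 1 else 2
  | _, _ => 2

/-- The Jacobian factor uses up all of the growth exponent except `1`. Subtracting its logarithm
therefore still leaves growth of order `1 + ε`. -/
lemma log_coordFactor_le {E : Support} {j : ℕ} {t : ℝ} (ht : t ∈ coordDomain E j) (h : 1 ≤ |t|) :
    Real.log (coordFactor E j t) ≤ (growthExponent E j - 1) * Real.log |t| := by
  have h0 := Real.log_nonneg h
  have h1 : Real.log (coordFactor E j t) ≤ Real.log |t| :=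
    Real.log_le_log (coordFactor_pos ht) ((coordFactor_le ht).trans (max_eq_right h).le)
  rcases E with _ | _ | _
  · simp only [growthExponent]; linarith
  · simp only [growthExponent]; linarith
  · simp only [growthExponent, coordFactor] at h1 ⊢
    split_ifs at h1 ⊢
    · simp
    · linarith

lemma one_le_growthExponent (E : Support) (j : ℕ) : 1 ≤ growthExponent E j := by
  rcases E with _ | _ | _ <;> simp only [growthExponent] <;> (try split_ifs) <;> norm_num

lemma GrowthCondition.exists_bound {E : Support} {K : ℕ} {V : ℕ → ℝ → ℝ} (h : GrowthCondition E K V) :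
    ∃ ε > 0, ∃ R : ℝ, 1 ≤ R ∧ ∀ j ∈ Icc 1 (K + 2), ∀ t ∈ coordDomain E j, R ≤ |t| →
      (growthExponent E j + ε) * Real.log |t| ≤ V j t := by
  rcases E with _ | _ | _
  -- Vacuous: no point of `(0,1)` satisfies `2 ≤ |t|`.
  · refine ⟨1, one_pos, 2, by norm_num, fun j _ t ht h2 => ?_⟩
    have ht' : t ∈ Ioo (0 : ℝ) 1 := ht
    rw [abs_of_pos ht'.1] at h2
    linarith [ht'.2]
  · obtain ⟨ε, hε, R, hR⟩ := h
    exact ⟨ε, hε, max 1 R, le_max_left _ _, fun j hj t ht h2 =>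
      hR j hj t ht ((le_max_right _ _).trans h2)⟩
  · obtain ⟨ε, hε, R, hR⟩ := h
    exact ⟨ε, hε, max 1 R, le_max_left _ _, fun j hj t ht h2 =>
      hR j hj t ht ((le_max_right _ _).trans h2)⟩

section Generic

variable {E : Support} {C : Constraint} {V : ℕ → ℝ → ℝ}

lemma Generic.continuousOn_closure (hV : Generic E C V) {j : ℕ} (hj : 1 ≤ j) :
    ContinuousOn (extendPotential C.top V j) (closedDomain E j) := by
  rw [extendPotential_eq, ← closure_coordDomain, ← coordDomain_repIndex E C.top j]
  exact hV.continuousOn _ (repIndex_mem hj)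

lemma coordDomain_subset (E : Support) (j : ℕ) : coordDomain E j ⊆ closedDomain E j :=
  closure_coordDomain E j ▸ subset_closure

lemma isClosed_closedDomain (E : Support) (j : ℕ) : IsClosed (closedDomain E j) :=
  closure_coordDomain E j ▸ isClosed_closure

lemma Generic.continuousOn_potential (hV : Generic E C V) {j : ℕ} (hj : 1 ≤ j) :
    ContinuousOn (extendPotential C.top V j) (coordDomain E j) :=
  (hV.continuousOn_closure hj).mono (coordDomain_subset E j)

lemma Generic.contDiffAt_effPotential (hV : Generic E C V) {j : ℕ} (hj : 1 ≤ j) {t : ℝ}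
    (ht : t ∈ coordDomain E j) : ContDiffAt ℝ 2 (effPotential E C V j) t := by
  have h1 : ContDiffAt ℝ 2 (extendPotential C.top V j) t := by
    rw [extendPotential_eq]
    refine (hV.contDiffOn _ (repIndex_mem hj)).contDiffAt ?_
    rw [coordDomain_repIndex]
    exact (isOpen_coordDomain E j).mem_nhds ht
  have h2 : effPotential E C V j = fun t => extendPotential C.top V j t
      - Real.log (coordFactor E j t) := funext (effPotential_eq E C V j)
  rw [h2]
  exact h1.sub ((contDiff_coordFactor E j).contDiffAt.log (coordFactor_pos ht).ne')

/-- Logarithmic lower bounds for the potentials. -/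
lemma Generic.exists_lower_bound (hV : Generic E C V) :
    ∃ ε > 0, ∃ B : ℝ, ∀ j, 1 ≤ j → ∀ t ∈ coordDomain E j,
      B + (1 + ε) * Real.log (1 + |t|) ≤ extendPotential C.top V j t ∧
      B + (1 + ε) * Real.log (1 + |t|) ≤ effPotential E C V j t := by
  obtain ⟨ε, hε, R, hR1, hR⟩ := hV.growth.exists_bound
  have hcomp : ∀ j ∈ Icc 1 (C.top + 2), ∃ b : ℝ, ∀ t ∈ coordDomain E j, |t| ≤ R →
      b ≤ V j t := by
    intro j hj
    have hc : IsCompact (closedDomain E j ∩ Icc (-R) R) :=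
      isCompact_Icc.inter_left (isClosed_closedDomain E j)
    obtain ⟨b, hb⟩ := (hc.image_of_continuousOn (((closure_coordDomain E j) ▸
      hV.continuousOn j hj).mono inter_subset_left)).bddBelow
    exact ⟨b, fun t ht h => hb ⟨t, ⟨coordDomain_subset E j ht, abs_le.1 h⟩, rfl⟩⟩
  choose! b hb using hcomp
  obtain ⟨b0, hb0⟩ := ((finite_Icc 1 (C.top + 2)).image b).bddBelow
  have hlR : 0 ≤ Real.log R := Real.log_nonneg hR1
  have hl1R : 0 ≤ Real.log (1 + R) := Real.log_nonneg (by linarith)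
  have hl2 : 0 ≤ Real.log 2 := Real.log_nonneg (by norm_num)
  -- The first entry serves `|t| ≤ R`, by compactness; the second serves `|t| ≥ R`, where `log (1 +
  -- |t|) ≤ log 2 + log |t|`.
  set B := min (b0 - Real.log R - (1 + ε) * Real.log (1 + R)) (-(1 + ε) * Real.log 2) with hB
  refine ⟨ε, hε, B, fun j hj t ht => ?_⟩
  have hB1 : B ≤ b0 - Real.log R - (1 + ε) * Real.log (1 + R) := min_le_left _ _
  have hB2 : B ≤ -(1 + ε) * Real.log 2 := min_le_right _ _
  rw [effPotential_eq, extendPotential_eq, ← coordFactor_repIndex E C.top j]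
  rw [← coordDomain_repIndex E C.top j] at ht
  have hk := repIndex_mem (K := C.top) hj
  set k := repIndex C.top j
  rcases le_total |t| R with htR | htR
  · have h1 := hb k hk t ht htR
    have h2 : b0 ≤ b k := hb0 ⟨k, hk, rfl⟩
    have h3 : Real.log (1 + |t|) ≤ Real.log (1 + R) :=
      Real.log_le_log (by positivity) (by linarith)
    have h4 : Real.log (coordFactor E k t) ≤ Real.log R :=
      Real.log_le_log (coordFactor_pos ht) ((coordFactor_le ht).trans (max_le hR1 htR))
    have h5 := mul_le_mul_of_nonneg_left h3 (by linarith : 0 ≤ 1 + ε)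
    constructor <;> linarith
  · have h1 := hR k hk t ht htR
    have ht1 : 1 ≤ |t| := hR1.trans htR
    have h0 := Real.log_nonneg ht1
    have h2 := log_coordFactor_le ht ht1
    have h3 := mul_le_mul_of_nonneg_right (one_le_growthExponent E k) h0
    have h4 : Real.log (1 + |t|) ≤ Real.log 2 + Real.log |t| := by
      rw [← Real.log_mul two_ne_zero (by positivity)]
      exact Real.log_le_log (by positivity) (by linarith)
    have h5 := mul_le_mul_of_nonneg_left h4 (by linarith : 0 ≤ 1 + ε)
    constructor <;> nlinarith

lemma mem_coordDomain_of_coordFactor_pos {j : ℕ} {t : ℝ} (ht : t ∈ closedDomain E j)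
    (h : 0 < coordFactor E j t) : t ∈ coordDomain E j := by
  rcases E with _ | _ | _ <;> simp only [closedDomain, coordFactor, coordDomain] at *
  · exact ⟨lt_of_le_of_ne ht.1 (by rintro rfl; simp at h), lt_of_le_of_ne ht.2 (by rintro rfl; simp at h)⟩
  · exact h
  · split_ifs at * with h1
    · trivial
    · exact h

/-- Sublevel sets of the effective potentials are contained in compact subsets of the domain. -/
lemma Generic.exists_compact_sublevel (hV : Generic E C V) (c : ℝ) {j : ℕ} (hj : 1 ≤ j) :
    ∃ S : Set ℝ, IsCompact S ∧ S ⊆ coordDomain E j ∧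
      ∀ t ∈ coordDomain E j, effPotential E C V j t ≤ c → t ∈ S := by
  obtain ⟨ε, hε, B, hB⟩ := hV.exists_lower_bound
  set M := Real.exp ((c - B) / (1 + ε)) with hM
  -- Since `V_j ≥ B`, the inequality `W_j ≤ c` keeps the factor above `exp (B - c)`, hence `t` off
  -- the boundary of the domain. Logarithmic growth of `W_j` bounds `|t|` by `M`.
  refine ⟨(closedDomain E j ∩ {t | Real.exp (B - c) ≤ coordFactor E j t}) ∩ Icc (-M) M, ?_, ?_, ?_⟩
  · exact isCompact_Icc.inter_left ((isClosed_closedDomain E j).inter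
      (isClosed_le continuous_const (continuous_coordFactor E j)))
  · rintro t ⟨⟨h1, h2⟩, -⟩
    exact mem_coordDomain_of_coordFactor_pos h1 ((Real.exp_pos _).trans_le h2)
  · intro t ht htc
    obtain ⟨h1, h2⟩ := hB j hj t ht
    have hl : 0 ≤ Real.log (1 + |t|) := Real.log_nonneg (by linarith [abs_nonneg t])
    refine ⟨⟨coordDomain_subset E j ht, ?_⟩, ?_⟩
    · rw [mem_ofPred_eq, ← Real.le_log_iff_exp_le (coordFactor_pos ht)]
      rw [effPotential_eq] at htc
      nlinarith
    · refine abs_le.1 ?_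
      have h3 : Real.log (1 + |t|) ≤ (c - B) / (1 + ε) := by
        rw [le_div_iff₀ (by linarith)]
        linarith
      rw [Real.log_le_iff_le_exp (by positivity)] at h3
      linarith

end Generic

/-! ## The energy as a function of the free moments -/

section Energy

variable {E : Support} {C : Constraint} {V : ℕ → ℝ → ℝ} {l : ℕ}

/-- The function `∑_{j ≤ l} W_j(y_j)` of the moments. -/
noncomputable def momentEnergy (E : Support) (C : Constraint) (V : ℕ → ℝ → ℝ) {l : ℕ} (m : Fin l → ℝ) : ℝ :=
  ∑ i : Fin l, effPotential E C V (i + 1) (coords E m (i + 1))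

lemma coords_mem {n : ℕ} {m : Fin n → ℝ} (hm : m ∈ relInterior E C n) (i : Fin n) :
    coords E m (i + 1) ∈ coordDomain E (i + 1) :=
  (coords_of_mem_interior hm.2).1 _ (by omega) (by omega)

lemma energy_freeCoords (hl : C.top ≤ l) {m : Fin l → ℝ} (hm : m ∈ relInterior E C l) :
    energy E C V l (freeCoords E C m) = momentEnergy E C V m := by
  rw [energy, momentsOfFree_freeCoords hl hm]
  rfl

lemma momentSeq_firstMoments {k n j : ℕ} (hj : j ≤ k) (m : Fin n → ℝ) :
    momentSeq (firstMoments k m) j = momentSeq m j := by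
  rcases Nat.eq_zero_or_pos j with rfl | h0
  · rw [momentSeq_zero, momentSeq_zero]
  · obtain ⟨i, rfl⟩ : ∃ i : Fin k, j = i + 1 := ⟨⟨j - 1, by omega⟩, by simp; omega⟩
    rw [momentSeq_val_succ]; rfl

lemma firstMoments_mem_relInterior {k n : ℕ} (hk : C.top ≤ k) (h : k ≤ n) {m : Fin n → ℝ}
    (hm : m ∈ relInterior E C n) : firstMoments k m ∈ relInterior E C k := by
  obtain ⟨h1, h2⟩ := (mem_relInterior_iff (hk.trans h)).1 hm
  obtain ⟨hd, hy⟩ := coords_of_mem_interior h1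
  refine mem_relInterior_of_inDomain hk (hd.mono h) (fun j hj => ?_) fun i hi => ?_
  · rw [momentSeq_firstMoments hj, hy j (hj.trans h)]
  · rw [← hy i ((C.le_top hi).trans (hk.trans h)), h2 i hi]

lemma coords_firstMoments {k n j : ℕ} (h : k ≤ n) {m : Fin n → ℝ}
    (hm : m ∈ relInterior E C n) (h1 : 1 ≤ j) (hj : j ≤ k) :
    coords E (firstMoments k m) j = coords E m j := by
  obtain ⟨hd, hy⟩ := coords_of_mem_interior hm.2
  exact coords_eq (hd.mono h) (fun j hj => by rw [momentSeq_firstMoments hj, hy j (hj.trans h)]) h1 hj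

lemma momentEnergy_split {k : ℕ} (h : k ≤ l) {m : Fin l → ℝ} (hm : m ∈ relInterior E C l) :
    momentEnergy E C V m = momentEnergy E C V (firstMoments k m)
      + ∑ i : Fin l, if k < (i : ℕ) + 1 then effPotential E C V (i + 1) (coords E m (i + 1)) else 0 := by
  have h1 : momentEnergy E C V (firstMoments k m)
      = ∑ i : Fin l, if k < (i : ℕ) + 1 then 0 else effPotential E C V (i + 1) (coords E m (i + 1)) := by
    rw [momentEnergy, Finset.sum_fin_eq_sum_range, Finset.sum_fin_eq_sum_range]
    rw [← Finset.sum_subset (Finset.range_mono h)]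
    · refine Finset.sum_congr rfl fun i hi => ?_
      have hi' := Finset.mem_range.1 hi
      rw [dif_pos hi', dif_pos (hi'.trans_le h), if_neg (by simp; omega)]
      simp only
      rw [coords_firstMoments h hm (by omega) (by omega)]
    · intro i hi1 hi2
      simp only [Finset.mem_range] at hi1 hi2
      rw [dif_pos hi1, if_pos (by simp; omega)]
  rw [h1, ← Finset.sum_add_distrib]
  refine Finset.sum_congr rfl fun i _ => ?_
  split_ifs <;> simp

lemma canonicalVec_apply {n : ℕ} (m : Fin n → ℝ) (i : Fin n) :
    canonicalVec E m i = coords E m (i + 1) := rfl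

/-- Minimizers have smaller energy. -/
lemma momentEnergy_le_of_mem_limitPoints (hl : C.top ≤ l) {p m : Fin l → ℝ}
    (hp : p ∈ limitPoints E C V l) (hm : m ∈ relInterior E C l) :
    momentEnergy E C V p ≤ momentEnergy E C V m := by
  obtain ⟨hp1, hp2, hp3⟩ := hp
  rw [momentEnergy_split hl hp1, momentEnergy_split hl hm]
  have hpK := firstMoments_mem_relInterior le_rfl hl hp1
  have hmK := firstMoments_mem_relInterior le_rfl hl hm
  refine add_le_add ?_ (Finset.sum_le_sum fun i _ => ?_)
  · rw [← energy_freeCoords le_rfl hpK, ← energy_freeCoords le_rfl hmK]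
    exact hp2.2 _ (freeCoords_mem_freeDomain hmK)
  · split_ifs with h
    · exact (hp3 i h).2 _ (coords_mem hm i)
    · exact le_rfl

/-- Each summand is bounded below by its value at `p`, so equal totals force equality in every
summand. -/
lemma mem_limitPoints_of_momentEnergy_le (hl : C.top ≤ l) {p m : Fin l → ℝ}
    (hp : p ∈ limitPoints E C V l) (hm : m ∈ relInterior E C l)
    (h : momentEnergy E C V m ≤ momentEnergy E C V p) : m ∈ limitPoints E C V l := by
  obtain ⟨hp1, hp2, hp3⟩ := hp
  rw [momentEnergy_split hl hp1, momentEnergy_split hl hm] at h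
  have hpK := firstMoments_mem_relInterior le_rfl hl hp1
  have hmK := firstMoments_mem_relInterior le_rfl hl hm
  rw [← energy_freeCoords le_rfl hpK, ← energy_freeCoords le_rfl hmK] at h
  have h1 := hp2.2 _ (freeCoords_mem_freeDomain hmK)
  have h2 : ∀ i : Fin l, (if C.top < (i : ℕ) + 1 then effPotential E C V (i + 1) (coords E p (i + 1)) else 0)
      ≤ if C.top < (i : ℕ) + 1 then effPotential E C V (i + 1) (coords E m (i + 1)) else 0 := by
    intro i
    split_ifs with hi
    · exact (hp3 i hi).2 _ (coords_mem hm i)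
    · exact le_rfl
  have h3 := Finset.sum_le_sum fun i (_ : i ∈ Finset.univ) => h2 i
  refine ⟨hm, ⟨freeCoords_mem_freeDomain hmK, fun z hz => ?_⟩, fun i hi => ⟨coords_mem hm i, fun z hz => ?_⟩⟩
  · exact le_trans (by linarith) (hp2.2 z hz)
  · have h4 := (Finset.sum_eq_sum_iff_of_le fun i (_ : i ∈ Finset.univ) => h2 i).1 (by linarith) i
      (Finset.mem_univ i)
    rw [if_pos hi, if_pos hi] at h4
    rw [canonicalVec_apply, ← h4]
    exact (hp3 i hi).2 z hz

lemma Generic.existsUnique_minimizer (hV : Generic E C V) {j : ℕ} (hj : C.top < j) :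
    ∃! y : ℝ, IsMinimizer (effPotential E C V j) (coordDomain E j) y := by
  have := hV.unique_minimizer _ (repIndex_mem_of_lt hj)
  rwa [effPotential_repIndex, coordDomain_repIndex] at this

lemma Generic.nondegenerate_minimizer (hV : Generic E C V) {j : ℕ} (hj : C.top < j) {y : ℝ}
    (hy : IsMinimizer (effPotential E C V j) (coordDomain E j) y) :
    iteratedDeriv 2 (effPotential E C V j) y ≠ 0 := by
  have := hV.nondegenerate _ (repIndex_mem_of_lt hj) y
  rw [effPotential_repIndex, coordDomain_repIndex] at this
  exact this hy

/-- The block coordinates determine a limit point, as the later effective potentials have unique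
minimizers. -/
lemma finite_limitPoints (hl : C.top ≤ l) (hV : Generic E C V) : (limitPoints E C V l).Finite := by
  refine Finite.of_finite_image (f := fun m => freeCoords E C (firstMoments C.top m))
    (hV.finite_minimizers.subset ?_) ?_
  · rintro _ ⟨m, hm, rfl⟩
    exact hm.2.1
  · intro p hp m hm heq
    refine injOn_freeCoords hl hp.1 hm.1 ?_
    have hK := injOn_freeCoords le_rfl (firstMoments_mem_relInterior le_rfl hl hp.1)
      (firstMoments_mem_relInterior le_rfl hl hm.1) heq
    ext ⟨i, hi⟩
    change coords E p (i + 1) = coords E m (i + 1)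
    rcases lt_or_ge C.top ((i : ℕ) + 1) with h | h
    · exact (hV.existsUnique_minimizer h).unique (hp.2.2 i h) (hm.2.2 i h)
    · rw [← coords_firstMoments hl hp.1 (by omega) h, ← coords_firstMoments hl hm.1 (by omega) h, hK]

/-- Sublevel sets of the energy are contained in compact subsets of the relative interior. -/
lemma Generic.exists_compact_energy_sublevel (hl : C.top ≤ l) (hV : Generic E C V) (c : ℝ) :
    ∃ S : Set (Fin l → ℝ), IsCompact S ∧ S ⊆ relInterior E C l ∧
      ∀ m ∈ relInterior E C l, momentEnergy E C V m ≤ c → m ∈ S := by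
  obtain ⟨ε, hε, B, hB⟩ := hV.exists_lower_bound
  have hlow : ∀ j, 1 ≤ j → ∀ t ∈ coordDomain E j, B ≤ effPotential E C V j t := by
    intro j hj t ht
    have h1 := (hB j hj t ht).2
    have h2 : 0 ≤ Real.log (1 + |t|) := Real.log_nonneg (by linarith [abs_nonneg t])
    nlinarith
  -- The other `l - 1` summands are at least `B`, which leaves at most `c - (l - 1) * B` for the
  -- `i`-th.
  have hS : ∀ i : Fin l, ∃ S : Set ℝ, IsCompact S ∧ S ⊆ coordDomain E (i + 1) ∧
      ∀ t ∈ coordDomain E (i + 1), effPotential E C V (i + 1) t ≤ c - (l - 1) * B → t ∈ S := fun i =>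
    hV.exists_compact_sublevel _ (by omega)
  choose S hS1 hS2 hS3 using hS
  have hcont : Continuous fun y : Fin l → ℝ => fun i : Fin l => mom E (momentSeq y) (i + 1) :=
    continuous_pi fun i => continuous_iff_continuousAt.2 fun y => (contDiffAt_mom (r := 0)
      (fun j => (contDiff_momentSeq l j).contDiffAt) _).continuousAt
  have hpi : IsCompact (Set.pi univ S) := isCompact_univ_pi hS1
  refine ⟨(fun y : Fin l → ℝ => fun i : Fin l => mom E (momentSeq y) (i + 1)) '' (Set.pi univ S) ∩
    ⋂ i ∈ C.idx, {m | momentSeq m i = C.val i}, ?_, ?_, ?_⟩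
  · refine (hpi.image hcont).inter_right (isClosed_biInter fun i _ => ?_)
    exact isClosed_eq (contDiff_momentSeq (r := 0) l i).continuous continuous_const
  · rintro _ ⟨⟨y, hy, rfl⟩, hc⟩
    simp only [mem_iInter, mem_ofPred_eq] at hc
    refine (mem_relInterior_iff hl).2 ⟨?_, hc⟩
    refine mem_interior_of_inDomain (y := momentSeq y) ?_ (momentSeq_eq_iff.2 fun i => rfl)
    refine forall_fin_iff.1 fun i => ?_
    rw [momentSeq_val_succ]
    exact hS2 i (hy i (mem_univ i))
  · intro m hm hmc
    obtain ⟨h1, h2⟩ := (mem_relInterior_iff hl).1 hm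
    obtain ⟨hd, hy⟩ := coords_of_mem_interior h1
    refine ⟨⟨fun i => coords E m (i + 1), fun i _ => hS3 i _ (coords_mem hm i) ?_, ?_⟩, ?_⟩
    · have h3 : ∑ j ∈ Finset.univ.erase i, B ≤
          ∑ j ∈ Finset.univ.erase i, effPotential E C V (j + 1) (coords E m (j + 1)) :=
        Finset.sum_le_sum fun j _ => hlow _ (by omega) _ (coords_mem hm j)
      rw [Finset.sum_const, Finset.card_erase_of_mem (Finset.mem_univ i), Finset.card_univ,
        Fintype.card_fin, nsmul_eq_mul, Nat.cast_sub (by have := i.2; omega), Nat.cast_one] at h3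
      rw [momentEnergy, ← Finset.add_sum_erase _ _ (Finset.mem_univ i)] at hmc
      linarith
    · ext i
      simp only
      rw [← momentSeq_val_succ m, hy _ (by omega)]
      refine mom_congr fun j hj1 hj2 => ?_
      obtain ⟨k, rfl⟩ : ∃ k : Fin l, j = k + 1 := ⟨⟨j - 1, by omega⟩, by simp; omega⟩
      rw [momentSeq_val_succ]
    · simpa using h2

lemma Generic.continuousAt_momentEnergy (hV : Generic E C V) {m : Fin l → ℝ}
    (hm : m ∈ interior (momentSpace E l)) : ContinuousAt (momentEnergy E C V) m := by
  refine tendsto_finsetSum _ fun i _ => ?_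
  have h1 := (contDiffAt_coords (r := 0) hm (j := i + 1) (by omega) (by omega)).continuousAt
  have h2 := (hV.contDiffAt_effPotential (j := i + 1) (by omega)
    ((coords_of_mem_interior hm).1 _ (by omega) (by omega))).continuousAt
  exact ContinuousAt.comp (f := fun m : Fin l → ℝ => coords E m (i + 1)) h2 h1

/-- Away from the limit points the energy is larger than the minimum. -/
lemma Generic.exists_energy_gap (hl : C.top ≤ l) (hV : Generic E C V) {p : Fin l → ℝ}
    (hp : p ∈ limitPoints E C V l) {U : Set (Fin l → ℝ)} (hU : IsOpen U)
    (hSU : limitPoints E C V l ⊆ U) :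
    ∃ δ > 0, ∀ m ∈ relInterior E C l, m ∉ U → momentEnergy E C V p + δ ≤ momentEnergy E C V m := by
  obtain ⟨S, hS1, hS2, hS3⟩ := hV.exists_compact_energy_sublevel hl (momentEnergy E C V p + 1)
  have hK : IsCompact (S \ U) := hS1.diff hU
  rcases (S \ U).eq_empty_or_nonempty with he | hne
  · refine ⟨1, one_pos, fun m hm hmU => ?_⟩
    by_contra! hlt
    have : m ∈ S \ U := ⟨hS3 m hm hlt.le, hmU⟩
    simp [he] at this
  · obtain ⟨q, hq, hmin⟩ := hK.exists_isMinOn hne (f := momentEnergy E C V) fun m hm =>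
      (hV.continuousAt_momentEnergy (hS2 hm.1).2).continuousWithinAt
    have hlt : momentEnergy E C V p < momentEnergy E C V q := by
      by_contra! hle
      exact hq.2 (hSU (mem_limitPoints_of_momentEnergy_le hl hp (hS2 hq.1) hle))
    refine ⟨min 1 (momentEnergy E C V q - momentEnergy E C V p), lt_min one_pos (by linarith),
      fun m hm hmU => ?_⟩
    by_contra! hcon
    have h1 : m ∈ S := hS3 m hm (by linarith [min_le_left 1 (momentEnergy E C V q - momentEnergy E C V p)])
    have h2 := hmin ⟨h1, hmU⟩
    simp only [mem_ofPred_eq] at h2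
    linarith [min_le_right 1 (momentEnergy E C V q - momentEnergy E C V p)]

/-- Moments are polynomial in the coordinates. The bound `B ^ 2` covers the products `(1 - y_{k-1})
y_k`, and `2 * n` covers the order after symmetrization. -/
lemma abs_mom_le {y : ℕ → ℝ} {n j : ℕ} {B : ℝ} (hB : 1 ≤ B) (hy : ∀ i, 1 ≤ i → i ≤ n → 1 + |y i| ≤ B)
    (hj : j ≤ n) : |mom E y j| ≤ (3 * B ^ 2) ^ (2 * n) := by
  have hB2 : B ≤ B ^ 2 := by nlinarith
  set y' : ℕ → ℝ := fun i => if 1 ≤ i ∧ i ≤ n then y i else 0 with hy'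
  have hyb : ∀ i, 1 + |y' i| ≤ B := by
    intro i
    simp only [hy']
    split_ifs with h
    · exact hy i h.1 h.2
    · simpa using hB
  have habs : ∀ i, |y' i| ≤ B := fun i => by linarith [hyb i]
  rw [mom_congr (y' := y') fun i h1 h2 => by simp only [hy']; rw [if_pos ⟨h1, h2.trans hj⟩]]
  have h3 : 1 ≤ 3 * B ^ 2 := by nlinarith
  have hle : jacobiOrder E j ≤ 2 * n := by
    rcases E with _ | _ | _ <;> simp only [jacobiOrder] <;> omega
  refine (abs_pathSum_le (B := B ^ 2) (hB.trans hB2) ?_ ?_ _ _).trans (pow_le_pow_right₀ h3 hle)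
  · intro i
    rcases E with _ | _ | _ <;> simp only [jacobiA]
    · simp; positivity
    · simp; positivity
    · exact (habs _).trans hB2
  · intro i
    rcases E with _ | _ | _ <;> simp only [jacobiB]
    · rw [chainParam, abs_mul, sq]
      refine mul_le_mul ?_ (habs i) (abs_nonneg _) (by linarith)
      split_ifs
      · simpa using hB
      · exact (abs_sub _ _).trans (by simpa using hyb (i - 1))
    · exact (habs _).trans hB2
    · exact (habs _).trans hB2

/-- The moments grow at most exponentially in the energy. -/
lemma Generic.exists_norm_le_exp_energy (hV : Generic E C V) :
    ∃ κ > 0, ∃ A > 0, ∀ m ∈ relInterior E C l,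
      1 + ‖m‖ ≤ A * Real.exp (κ * momentEnergy E C V m) := by
  obtain ⟨ε, hε, B, hB⟩ := hV.exists_lower_bound
  refine ⟨4 * l + 1, by positivity, 2 * 9 ^ l * Real.exp ((4 * l + 1) * -(l * B)), by positivity,
    fun m hm => ?_⟩
  obtain ⟨hd, hy⟩ := coords_of_mem_interior hm.2
  set b : ℝ := Real.exp (momentEnergy E C V m - l * B) with hb
  have hsum : ∑ i : Fin l, Real.log (1 + |coords E m (i + 1)|) ≤ momentEnergy E C V m - l * B := by
    have : ∑ i : Fin l, (B + Real.log (1 + |coords E m (i + 1)|)) ≤ momentEnergy E C V m := by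
      refine Finset.sum_le_sum fun i _ => ?_
      have h1 := (hB (i + 1) (by omega) _ (coords_mem hm i)).2
      have h2 : 0 ≤ Real.log (1 + |coords E m (i + 1)|) :=
        Real.log_nonneg (by linarith [abs_nonneg (coords E m (i + 1))])
      nlinarith
    rw [Finset.sum_add_distrib, Finset.sum_const, Finset.card_univ, Fintype.card_fin,
      nsmul_eq_mul] at this
    linarith
  have hnn : ∀ i : Fin l, 0 ≤ Real.log (1 + |coords E m (i + 1)|) := fun i =>
    Real.log_nonneg (by linarith [abs_nonneg (coords E m (i + 1))])
  have hb1 : 1 ≤ b := Real.one_le_exp ((Finset.sum_nonneg fun i _ => hnn i).trans hsum)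
  have hcb : ∀ j, 1 ≤ j → j ≤ l → 1 + |coords E m j| ≤ b := by
    refine forall_fin_iff.1 fun i => ?_
    rw [hb, ← Real.log_le_iff_le_exp (by positivity)]
    exact (Finset.single_le_sum (fun i _ => hnn i) (Finset.mem_univ i)).trans hsum
  have hP : 1 ≤ (3 * b ^ 2) ^ (2 * l) := one_le_pow₀ (by nlinarith)
  have hnorm : ‖m‖ ≤ (3 * b ^ 2) ^ (2 * l) := by
    refine (pi_norm_le_iff_of_nonneg (by linarith)).2 fun i => ?_
    rw [Real.norm_eq_abs, ← momentSeq_val_succ m, hy _ (by omega)]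
    exact abs_mom_le hb1 hcb (by omega)
  calc 1 + ‖m‖ ≤ 2 * (3 * b ^ 2) ^ (2 * l) := by linarith
    _ = 2 * 9 ^ l * b ^ (4 * l) := by
        rw [show (9 : ℝ) ^ l = 3 ^ (2 * l) by rw [pow_mul]; norm_num, mul_pow, ← pow_mul, ← mul_assoc]
        ring
    _ ≤ 2 * 9 ^ l * b ^ (4 * l + 1) := by
        gcongr
        exact Nat.le_succ _
    _ = 2 * 9 ^ l * Real.exp ((4 * l + 1) * -(l * B))
        * Real.exp ((4 * l + 1) * momentEnergy E C V m) := by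
        rw [mul_assoc _ (Real.exp _), ← Real.exp_add, hb, ← Real.exp_nat_mul]
        congr 2
        push_cast
        ring

end Energy

/-! ## Marginal distributions -/

section Marginal

variable {E : Support} {C : Constraint} {U : ℕ → ℝ → ℝ}

/-- The unnormalized density of the first `k` moments if `n` moments are drawn. -/
noncomputable def momentDensity (E : Support) (U : ℕ → ℝ → ℝ) (n : ℕ) {k : ℕ} (m : Fin k → ℝ) : ℝ :=
  Real.exp (-(n : ℝ) * ∑ i : Fin k, U (i + 1) (coords E m (i + 1)))
    -- Each of the `n - k` later moments has a Jacobian factor whose part in the first `k`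
    -- coordinates is this weight.
    * coordWeight E (coords E m) (k + 1) ^ (n - k)

lemma continuousAt_momentDensity (hU : ∀ j, 1 ≤ j → ContinuousOn (U j) (coordDomain E j)) (n : ℕ)
    {k : ℕ} {m : Fin k → ℝ} (hm : m ∈ interior (momentSpace E k)) :
    ContinuousAt (fun m : Fin k → ℝ => momentDensity E U n m) m := by
  have hc : ∀ j, 1 ≤ j → j ≤ k → ContinuousAt (fun m : Fin k → ℝ => coords E m j) m :=
    fun j h1 h2 => (contDiffAt_coords (r := 0) hm h1 h2).continuousAt
  refine ContinuousAt.mul (Real.continuous_exp.continuousAt.comp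
    (continuousAt_const.mul (tendsto_finsetSum _ fun i _ => ?_))) (ContinuousAt.pow ?_ _)
  · have h2 := (hU (i + 1) (by omega)).continuousAt ((isOpen_coordDomain E _).mem_nhds
      ((coords_of_mem_interior hm).1 _ (by omega) (by omega)))
    exact ContinuousAt.comp (f := fun m : Fin k → ℝ => coords E m (i + 1)) h2
      (hc _ (by omega) (by omega))
  · refine tendsto_finsetProd _ fun i hi => ?_
    have := Finset.mem_Ico.1 hi
    exact (continuous_coordFactor E i).continuousAt.comp (hc i this.1 (by omega))

lemma measurableSet_relInterior {n : ℕ} (hn : C.top ≤ n) : MeasurableSet (relInterior E C n) := by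
  have : relInterior E C n = interior (momentSpace E n) ∩ ⋂ i ∈ C.idx, {m | momentSeq m i = C.val i} := by
    ext m
    rw [mem_relInterior_iff hn]
    simp
  rw [this]
  refine isOpen_interior.measurableSet.inter (IsClosed.measurableSet (isClosed_biInter fun i _ => ?_))
  exact isClosed_eq (contDiff_momentSeq (r := 0) n i).continuous continuous_const

lemma continuous_firstMoments (l k : ℕ) : Continuous fun m : Fin k → ℝ => firstMoments l m :=
  continuous_pi fun i => (contDiff_momentSeq (r := 0) k (i + 1)).continuous

/-- The unnormalized density of the first `k` moments, restricted to the event that the first `l`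
moments belong to `A`. -/
noncomputable def restrictedDensity (E : Support) (C : Constraint) (U : ℕ → ℝ → ℝ) {l : ℕ}
    (A : Set (Fin l → ℝ)) (n : ℕ) {k : ℕ} : (Fin k → ℝ) → ENNReal :=
  (relInterior E C k ∩ firstMoments l ⁻¹' A).indicator fun m => ENNReal.ofReal (momentDensity E U n m)

lemma measurable_restrictedDensity (hU : ∀ j, 1 ≤ j → ContinuousOn (U j) (coordDomain E j)) {l k : ℕ}
    (hk : C.top ≤ k) {A : Set (Fin l → ℝ)} (hA : MeasurableSet A) (n : ℕ) :
    Measurable (restrictedDensity E C U A n (k := k)) := by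
  classical
  have h1 : Measurable ((interior (momentSpace E k)).indicator fun m : Fin k → ℝ =>
      ENNReal.ofReal (momentDensity E U n m)) := by
    rw [← Set.piecewise_eq_indicator]
    refine ContinuousOn.measurable_piecewise (fun m hm => ?_) continuousOn_const
      isOpen_interior.measurableSet
    exact (ENNReal.continuous_ofReal.continuousAt.comp
      (continuousAt_momentDensity hU n hm)).continuousWithinAt
  have h2 : restrictedDensity E C U A n (k := k) = (relInterior E C k ∩ firstMoments l ⁻¹' A).indicator
      ((interior (momentSpace E k)).indicator fun m : Fin k → ℝ =>
        ENNReal.ofReal (momentDensity E U n m)) := by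
    rw [Set.indicator_indicator, inter_eq_left.2 (fun m hm => hm.1.2)]
    rfl
  rw [h2]
  exact h1.indicator ((measurableSet_relInterior hk).inter
    ((continuous_firstMoments l k).measurable hA))

/-- Splitting off the last coordinate. -/
noncomputable def freeSuccEquiv (C : Constraint) (k : ℕ) (hk : C.top ≤ k) :
    Free C k ⊕ Unit ≃ Free C (k + 1) :=
  Equiv.ofBijective (Sum.elim (fun i => ⟨Fin.castSucc i.1, i.2⟩)
    (fun _ => ⟨Fin.last k, fun h => by
      have := C.le_top h
      rw [Fin.val_last] at this
      omega⟩)) (by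
    constructor
    · rintro (⟨i, hi⟩ | ⟨⟩) (⟨j, hj⟩ | ⟨⟩) h
      · simpa using h
      · simp only [Sum.elim_inl, Sum.elim_inr, Subtype.mk.injEq] at h
        exact absurd h (Fin.castSucc_lt_last i).ne
      · simp only [Sum.elim_inl, Sum.elim_inr, Subtype.mk.injEq] at h
        exact absurd h.symm (Fin.castSucc_lt_last j).ne
      · rfl
    · rintro ⟨i, hi⟩
      induction i using Fin.lastCases with
      | last => exact ⟨Sum.inr (), rfl⟩
      | cast i => exact ⟨Sum.inl ⟨i, by simpa using hi⟩, rfl⟩)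

/-- Index `k + 1` lies beyond all constraints, so the last moment is free and Tonelli's theorem
applies. -/
lemma lintegral_fill_succ {k : ℕ} (hk : C.top ≤ k) {h : (Fin (k + 1) → ℝ) → ENNReal}
    (hh : Measurable h) :
    ∫⁻ v : Free C (k + 1) → ℝ, h (fill C (k + 1) v)
      = ∫⁻ w : Free C k → ℝ, ∫⁻ t : ℝ, h (Fin.snoc (fill C k w) t) := by
  have h1 := (volume_measurePreserving_piCongrLeft (fun _ : Free C (k + 1) => ℝ)
    (freeSuccEquiv C k hk)).symm
  have h2 := volume_measurePreserving_sumPiEquivProdPi (fun _ : Free C k ⊕ Unit => ℝ)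
  have h3 := (MeasurePreserving.id (volume : Measure (Free C k → ℝ))).prod
    (volume_preserving_funUnique Unit ℝ)
  have h4 := (h3.comp h2).comp h1
  have hsn : Continuous fun p : (Free C k → ℝ) × ℝ =>
      (Fin.snoc (fill C k p.1) p.2 : Fin (k + 1) → ℝ) :=
    Continuous.finSnoc ((contDiff_fill (r := 0)).continuous.comp continuous_fst) continuous_snd
  have hm : Measurable fun p : (Free C k → ℝ) × ℝ =>
      h (Fin.snoc (fill C k p.1) p.2 : Fin (k + 1) → ℝ) := hh.comp hsn.measurable
  rw [← lintegral_prod _ hm.aemeasurable]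
  change _ = ∫⁻ p, _ ∂(Measure.prod volume volume)
  rw [← h4.lintegral_comp hm]
  refine lintegral_congr fun v => ?_
  congr 1
  ext i
  induction i using Fin.lastCases with
  | last =>
    have hn : ((Fin.last k : Fin (k + 1)) : ℕ) + 1 ∉ C.idx := fun h => by
      have := C.le_top h
      rw [Fin.val_last] at this
      omega
    rw [fill_of_notMem _ hn, Fin.snoc_last]
    rfl
  | cast i =>
    rw [Fin.snoc_castSucc]
    by_cases hi : (i : ℕ) + 1 ∈ C.idx
    · rw [fill_of_mem _ hi, fill_of_mem _ (by simpa using hi), Fin.val_castSucc]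
    · rw [fill_of_notMem _ hi, fill_of_notMem _ (by simpa using hi)]
      rfl

lemma momentSeq_snoc {k : ℕ} (m : Fin k → ℝ) (t : ℝ) {j : ℕ} (hj : j ≤ k) :
    momentSeq (Fin.snoc m t : Fin (k + 1) → ℝ) j = momentSeq m j := by
  rcases Nat.eq_zero_or_pos j with rfl | h0
  · rw [momentSeq_zero, momentSeq_zero]
  · obtain ⟨i, rfl⟩ : ∃ i : Fin k, j = i + 1 := ⟨⟨j - 1, by omega⟩, by simp; omega⟩
    rw [momentSeq_val_succ, ← Fin.val_castSucc, momentSeq_val_succ, Fin.snoc_castSucc]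

lemma momentSeq_snoc_last {k : ℕ} (m : Fin k → ℝ) (t : ℝ) :
    momentSeq (Fin.snoc m t : Fin (k + 1) → ℝ) (k + 1) = t := by
  have := momentSeq_val_succ (Fin.snoc m t : Fin (k + 1) → ℝ) (Fin.last k)
  rwa [Fin.val_last, Fin.snoc_last] at this

lemma firstMoments_snoc {l k : ℕ} (hl : l ≤ k) (m : Fin k → ℝ) (t : ℝ) :
    firstMoments l (Fin.snoc m t : Fin (k + 1) → ℝ) = firstMoments l m := by
  ext i
  exact momentSeq_snoc m t (by omega)

lemma firstMoments_self {l : ℕ} (m : Fin l → ℝ) : firstMoments l m = m :=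
  funext fun i => momentSeq_val_succ m i

/-- The coordinates of a vector of moments extended by one moment. -/
lemma snoc_mem_relInterior {k : ℕ} (hk : C.top ≤ k) {m : Fin k → ℝ} (hm : m ∈ relInterior E C k)
    {s : ℝ} (hs : s ∈ coordDomain E (k + 1)) :
    (Fin.snoc m (momBase E (coords E m) (k + 1) + coordWeight E (coords E m) (k + 1) * s) :
      Fin (k + 1) → ℝ) ∈ relInterior E C (k + 1) ∧
    ∀ j, 1 ≤ j → j ≤ k + 1 → coords E (Fin.snoc m (momBase E (coords E m) (k + 1)
      + coordWeight E (coords E m) (k + 1) * s) : Fin (k + 1) → ℝ) j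
        = Function.update (coords E m) (k + 1) s j := by
  obtain ⟨h1, h2⟩ := (mem_relInterior_iff hk).1 hm
  obtain ⟨hd, hy⟩ := coords_of_mem_interior h1
  have hup : ∀ i < k + 1, Function.update (coords E m) (k + 1) s i = coords E m i := fun i hi =>
    Function.update_of_ne hi.ne _ _
  have hd' : InDomain E (Function.update (coords E m) (k + 1) s) (k + 1) := by
    intro j hj1 hj2
    rcases hj2.lt_or_eq with hj2 | rfl
    · rw [hup j hj2]; exact hd j hj1 (by omega)
    · rwa [Function.update_self]
  have hy' : ∀ j ≤ k + 1, momentSeq (Fin.snoc m (momBase E (coords E m) (k + 1)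
      + coordWeight E (coords E m) (k + 1) * s) : Fin (k + 1) → ℝ) j
      = mom E (Function.update (coords E m) (k + 1) s) j := by
    intro j hj
    rcases hj.lt_or_eq with hj | rfl
    · rw [momentSeq_snoc _ _ (by omega), hy j (by omega)]
      exact mom_congr fun i _ hi => (hup i (by omega)).symm
    · rw [momentSeq_snoc_last, mom_eq (by omega), momBase_congr (y' := coords E m)
        fun i _ hi => hup i hi, coordWeight_congr (y' := coords E m) fun i _ hi => hup i hi,
        Function.update_self]
  refine ⟨mem_relInterior_of_inDomain (hk.trans k.le_succ) hd' hy' fun i hi => ?_, fun j hj1 hj2 =>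
    coords_eq hd' hy' hj1 hj2⟩
  have := C.le_top hi
  rw [← hy' i (by omega), momentSeq_snoc _ _ (by omega), h2 i hi]

lemma of_snoc_mem_relInterior {k : ℕ} (hk : C.top ≤ k) {m : Fin k → ℝ} {t : ℝ}
    (hm : (Fin.snoc m t : Fin (k + 1) → ℝ) ∈ relInterior E C (k + 1)) :
    m ∈ relInterior E C k ∧ ∃ s ∈ coordDomain E (k + 1),
      momBase E (coords E m) (k + 1) + coordWeight E (coords E m) (k + 1) * s = t := by
  obtain ⟨h1, h2⟩ := (mem_relInterior_iff (hk.trans k.le_succ)).1 hm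
  obtain ⟨hd, hy⟩ := coords_of_mem_interior h1
  have hy' : ∀ j ≤ k, momentSeq m j = mom E (coords E (Fin.snoc m t : Fin (k + 1) → ℝ)) j :=
    fun j hj => by rw [← hy j (by omega), momentSeq_snoc _ _ hj]
  have hco : ∀ i, 1 ≤ i → i < k + 1 → coords E m i = coords E (Fin.snoc m t : Fin (k + 1) → ℝ) i :=
    fun i hi1 hi2 => coords_eq (hd.mono k.le_succ) hy' hi1 (by omega)
  refine ⟨mem_relInterior_of_inDomain hk (hd.mono k.le_succ) hy' fun i hi => ?_,
    coords E (Fin.snoc m t : Fin (k + 1) → ℝ) (k + 1), hd _ (by omega) le_rfl, ?_⟩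
  · have := C.le_top hi
    rw [← hy i (by omega), h2 i hi]
  · rw [momBase_congr hco, coordWeight_congr hco, ← mom_eq (by omega), ← hy _ le_rfl,
      momentSeq_snoc_last]

/-- The normalizing constant of the `j`-th canonical coordinate. -/
noncomputable def coordMass (E : Support) (U : ℕ → ℝ → ℝ) (n j : ℕ) : ENNReal :=
  ∫⁻ s in coordDomain E j, ENNReal.ofReal (Real.exp (-(n : ℝ) * U j s) * coordFactor E j s ^ (n - j))

/-- Under `t = momBase + coordWeight * s` the Jacobian supplies one power of the weight. The
remaining `n - k - 1` powers split into the old weight and `coordFactor`, so the integral over `s`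
does not depend on `m`. -/
lemma lintegral_restrictedDensity_snoc {l k n : ℕ} (hk : C.top ≤ k) (hl : l ≤ k) (hn : k < n)
    (A : Set (Fin l → ℝ)) (m : Fin k → ℝ) :
    ∫⁻ t : ℝ, restrictedDensity E C U A n (Fin.snoc m t : Fin (k + 1) → ℝ)
      = restrictedDensity E C U A n m * coordMass E U n (k + 1) := by
  by_cases hm : m ∈ relInterior E C k ∩ firstMoments l ⁻¹' A
  swap
  · rw [show restrictedDensity E C U A n m = 0 from indicator_of_notMem hm _, zero_mul]
    refine (lintegral_congr fun t => ?_).trans lintegral_zero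
    refine indicator_of_notMem (fun h => hm ⟨(of_snoc_mem_relInterior hk h.1).1, ?_⟩) _
    have := h.2
    rwa [mem_preimage, firstMoments_snoc hl] at this
  set b := momBase E (coords E m) (k + 1)
  have hd := (coords_of_mem_interior hm.1.2).1
  have hw : 0 < coordWeight E (coords E m) (k + 1) := coordWeight_pos hd
  set w := coordWeight E (coords E m) (k + 1) with hwdef
  have hset : {t : ℝ | (Fin.snoc m t : Fin (k + 1) → ℝ) ∈ relInterior E C (k + 1)
      ∩ firstMoments l ⁻¹' A} = (fun s => b + w * s) '' coordDomain E (k + 1) := by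
    ext t
    constructor
    · exact fun h => (of_snoc_mem_relInterior hk h.1).2
    · rintro ⟨s, hs, rfl⟩
      refine ⟨(snoc_mem_relInterior hk hm.1 hs).1, ?_⟩
      rw [mem_preimage, firstMoments_snoc hl]
      exact hm.2
  have hmeas : MeasurableSet ((fun s => b + w * s) '' coordDomain E (k + 1)) := by
    have : (fun s => b + w * s) = (Homeomorph.mulLeft₀ w hw.ne').trans (Homeomorph.addLeft b) := rfl
    rw [this]
    exact ((Homeomorph.isOpen_image _).2 (isOpen_coordDomain E _)).measurableSet
  have hfun : (fun t : ℝ => restrictedDensity E C U A n (Fin.snoc m t : Fin (k + 1) → ℝ))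
      = ((fun s => b + w * s) '' coordDomain E (k + 1)).indicator
        fun t => ENNReal.ofReal (momentDensity E U n (Fin.snoc m t : Fin (k + 1) → ℝ)) := by
    rw [← hset]
    rfl
  rw [hfun, lintegral_indicator hmeas, lintegral_image_eq_lintegral_abs_deriv_mul (f' := fun _ => w)
    (isOpen_coordDomain E _).measurableSet
    (fun x _ => by
      simpa using (((hasDerivAt_id x).const_mul w).const_add b).hasDerivWithinAt)
    (fun x _ y _ h => by
      have h' : b + w * x = b + w * y := h
      exact mul_left_cancel₀ hw.ne' (add_left_cancel h')),
    coordMass, restrictedDensity, indicator_of_mem hm, ← lintegral_const_mul' _ _ ENNReal.ofReal_ne_top]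
  refine setLIntegral_congr_fun (isOpen_coordDomain E _).measurableSet fun s hs => ?_
  have hco := (snoc_mem_relInterior hk hm.1 hs).2
  have hup : ∀ i < k + 1, Function.update (coords E m) (k + 1) s i = coords E m i := fun i hi =>
    Function.update_of_ne hi.ne _ _
  rw [abs_of_pos hw, ← ENNReal.ofReal_mul hw.le, ← ENNReal.ofReal_mul]
  swap
  · exact mul_nonneg (Real.exp_pos _).le (pow_nonneg hw.le _)
  congr 1
  rw [momentDensity, momentDensity, Fin.sum_univ_castSucc, coordWeight_succ (by omega),
    hco _ (by omega) (by simp), Fin.val_last, hco _ (by omega) le_rfl, Function.update_self,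
    coordWeight_congr (y' := coords E m) (n := k + 1) fun i hi1 hi2 => (hco i hi1 hi2.le).trans (hup i hi2)]
  have hsum : ∑ i : Fin k, U ((Fin.castSucc i : Fin (k + 1)) + 1)
      (coords E (Fin.snoc m (b + w * s) : Fin (k + 1) → ℝ) ((Fin.castSucc i : Fin (k + 1)) + 1))
      = ∑ i : Fin k, U (i + 1) (coords E m (i + 1)) :=
    Finset.sum_congr rfl fun i _ => by
      rw [Fin.val_castSucc, hco _ (by omega) (by omega), hup _ (by omega)]
  rw [hsum, mul_add, Real.exp_add, ← hwdef, mul_pow, show n - k = n - (k + 1) + 1 by omega, pow_succ]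
  ring

lemma lintegral_restrictedDensity (hU : ∀ j, 1 ≤ j → ContinuousOn (U j) (coordDomain E j))
    {l n : ℕ} (hl : C.top ≤ l) {A : Set (Fin l → ℝ)} (hA : MeasurableSet A) :
    ∀ k, l ≤ k → k ≤ n → ∫⁻ v, restrictedDensity E C U A n (fill C k v)
      = (∫⁻ v, restrictedDensity E C U A n (fill C l v)) * ∏ j ∈ Finset.Ico l k, coordMass E U n (j + 1) := by
  intro k hk
  induction k, hk using Nat.le_induction with
  | base => simp
  | succ k hk ih =>
    intro hkn
    have hm := measurable_restrictedDensity hU (hl.trans (hk.trans k.le_succ)) hA n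
    rw [lintegral_fill_succ (hl.trans hk) hm, Finset.prod_Ico_succ_top hk, ← mul_assoc,
      ← ih (by omega), ← lintegral_mul_const]
    · exact lintegral_congr fun w => lintegral_restrictedDensity_snoc (hl.trans hk) hk (by omega) A _
    · exact (measurable_restrictedDensity hU (hl.trans hk) hA n).comp (contDiff_fill (r := 0)).continuous.measurable

/-- The law of the first `l` moments. -/
lemma momentLaw_preimage {V : ℕ → ℝ → ℝ} (hV : Generic E C V) {l n : ℕ} (hl : C.top ≤ l) (hn : l ≤ n)
    (hmass : ∀ j ∈ Finset.Ico l n, coordMass E (extendPotential C.top V) n (j + 1) ≠ 0 ∧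
      coordMass E (extendPotential C.top V) n (j + 1) ≠ ⊤)
    {A : Set (Fin l → ℝ)} (hA : MeasurableSet A) :
    momentLaw E C V n (firstMoments l ⁻¹' A)
      = (∫⁻ v, restrictedDensity E C (extendPotential C.top V) A n (fill C l v)) /
        ∫⁻ v, restrictedDensity E C (extendPotential C.top V) (univ : Set (Fin l → ℝ)) n (fill C l v) := by
  set U := extendPotential C.top V
  have hU : ∀ j, 1 ≤ j → ContinuousOn (U j) (coordDomain E j) := fun j hj => hV.continuousOn_potential hj
  have key : ∀ B : Set (Fin l → ℝ), MeasurableSet B →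
      ∫⁻ m in firstMoments l ⁻¹' B, ENNReal.ofReal (Real.exp (-(n : ℝ) *
        ∑ i : Fin n, U (i + 1) (canonicalVec E m i)))
          ∂(((volume : Measure (Free C n → ℝ)).map (fill C n)).restrict (relInterior E C n))
      = ∫⁻ v, restrictedDensity E C U B n (fill C n v) := by
    intro B hB
    have hBm : MeasurableSet ((firstMoments l : (Fin n → ℝ) → _) ⁻¹' B) :=
      (continuous_firstMoments l n).measurable hB
    rw [Measure.restrict_restrict hBm, inter_comm, ← lintegral_indicator
      ((measurableSet_relInterior (hl.trans hn)).inter hBm)]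
    have : ((relInterior E C n ∩ firstMoments l ⁻¹' B).indicator fun m =>
        ENNReal.ofReal (Real.exp (-(n : ℝ) * ∑ i : Fin n, U (i + 1) (canonicalVec E m i))))
        = restrictedDensity E C U B n := by
      ext m
      simp only [restrictedDensity, momentDensity, Nat.sub_self, pow_zero, mul_one]
      rfl
    rw [this, lintegral_map (measurable_restrictedDensity hU (hl.trans hn) hB n)
      (contDiff_fill (r := 0)).continuous.measurable]
  have huniv := key univ MeasurableSet.univ
  rw [preimage_univ, Measure.restrict_univ] at huniv
  have hBm : MeasurableSet ((firstMoments l : (Fin n → ℝ) → _) ⁻¹' A) :=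
      (continuous_firstMoments l n).measurable hA
  rw [momentLaw]
  simp only [Measure.smul_apply, smul_eq_mul, withDensity_apply _ hBm]
  rw [key A hA, huniv, lintegral_restrictedDensity hU hl hA n hn le_rfl,
    lintegral_restrictedDensity hU hl MeasurableSet.univ n hn le_rfl, mul_comm, ← div_eq_mul_inv]
  -- The same product of masses occurs in the normalising constant and cancels.
  exact ENNReal.mul_div_mul_right _ _ (Finset.prod_ne_zero_iff.2 fun j hj => (hmass j hj).1)
    (ENNReal.prod_ne_top fun j hj => (hmass j hj).2)

/-- The exponent is `-(j V_j + (n - j) W_j)`. Both potentials grow at least like `(1 + ε) log (1 +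
|s|)`, so the integrand is dominated by a multiple of `(1 + |s|) ^ (-(1 + ε))`; it is positive on a
nonempty open set. -/
lemma Generic.coordMass_ne {V : ℕ → ℝ → ℝ} (hV : Generic E C V) {n j : ℕ} (hj : 1 ≤ j) (hjn : j ≤ n) :
    coordMass E (extendPotential C.top V) n j ≠ 0 ∧ coordMass E (extendPotential C.top V) n j ≠ ⊤ := by
  obtain ⟨ε, hε, B, hB⟩ := hV.exists_lower_bound
  have hcont : ContinuousOn (fun s => ENNReal.ofReal (Real.exp (-(n : ℝ) * extendPotential C.top V j s)
      * coordFactor E j s ^ (n - j))) (coordDomain E j) := by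
    refine ENNReal.continuous_ofReal.comp_continuousOn (ContinuousOn.mul ?_ ?_)
    · exact Real.continuous_exp.comp_continuousOn (continuousOn_const.mul (hV.continuousOn_potential hj))
    · exact ((continuous_coordFactor E j).pow _).continuousOn
  have hD := (isOpen_coordDomain E j).measurableSet
  constructor
  · intro h
    rw [coordMass, lintegral_eq_zero_iff' (hcont.aemeasurable hD), Filter.EventuallyEq,
      ae_restrict_iff' hD] at h
    have h1 : ∀ᵐ s : ℝ, s ∉ coordDomain E j := by
      filter_upwards [h] with s hs hmem
      have h2 := hs hmem
      rw [Pi.zero_apply, ENNReal.ofReal_eq_zero] at h2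
      exact absurd h2 (not_le.2 (mul_pos (Real.exp_pos _) (pow_pos (coordFactor_pos hmem) _)))
    have h3 : volume (coordDomain E j) = 0 := by
      have := measure_eq_zero_iff_ae_notMem.2 h1
      exact this
    exact ((isOpen_coordDomain E j).measure_pos volume ⟨_, half_mem_coordDomain E j⟩).ne' h3
  · have hint : Integrable (fun s : ℝ => (1 + ‖s‖) ^ (-((1 + ε)))) volume :=
      integrable_one_add_norm (by simp; linarith)
    refine ne_top_of_le_ne_top ((hint.const_mul (Real.exp (-(n * B)))).lintegral_lt_top.ne) ?_
    refine (setLIntegral_mono' hD fun s hs => ?_).trans (setLIntegral_le_lintegral _ _)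
    refine ENNReal.ofReal_le_ofReal ?_
    obtain ⟨h1, h2⟩ := hB j hj s hs
    have hpos := coordFactor_pos hs
    have hl0 : 0 ≤ Real.log (1 + |s|) := Real.log_nonneg (by linarith [abs_nonneg s])
    rw [effPotential_eq] at h2
    rw [Real.norm_eq_abs, Real.rpow_def_of_pos (by positivity), ← Real.exp_add,
      ← Real.exp_log (pow_pos hpos _), ← Real.exp_add, Real.exp_le_exp, Real.log_pow,
      Nat.cast_sub hjn]
    have hj1 : (1 : ℝ) ≤ j := by exact_mod_cast hj
    have hjn' : (j : ℝ) ≤ n := by exact_mod_cast hjn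
    have h3 := mul_le_mul_of_nonneg_left h1 (by linarith : (0 : ℝ) ≤ j)
    have h4 := mul_le_mul_of_nonneg_left h2 (by linarith : (0 : ℝ) ≤ n - j)
    have h5 : (1 + ε) * Real.log (1 + |s|) ≤ n * ((1 + ε) * Real.log (1 + |s|)) :=
      le_mul_of_one_le_left (by positivity) (by linarith)
    nlinarith

end Marginal

/-! ## Second order expansions at minimizers -/

section Taylor

variable {X : Type*} [NormedAddCommGroup X] {f : X → ℝ} {x : X}

/-- Quadratic growth at a point. -/
def QuadraticGrowth (f : X → ℝ) (x : X) : Prop :=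
  ∃ c > 0, ∀ᶠ y in 𝓝 x, f x + c * ‖y - x‖ ^ 2 ≤ f y

lemma QuadraticGrowth.isLocalMin (h : QuadraticGrowth f x) : IsLocalMin f x := by
  obtain ⟨c, hc, h⟩ := h
  filter_upwards [h] with y hy
  have : 0 ≤ c * ‖y - x‖ ^ 2 := by positivity
  linarith

variable [NormedSpace ℝ X]

lemma taylor_two_isLittleO (hf : ContDiffAt ℝ 2 f x) (h0 : fderiv ℝ f x = 0) :
    (fun y => f y - f x - 1 / 2 * fderiv ℝ (fderiv ℝ f) x (y - x) (y - x))
      =o[𝓝 x] fun y => ‖y - x‖ ^ 2 := by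
  have h1 : DifferentiableAt ℝ (fderiv ℝ f) x :=
    (hf.fderiv_right (m := 1) le_rfl).differentiableAt one_ne_zero
  have h2 : ∀ᶠ y in 𝓝 x, DifferentiableAt ℝ f y := by
    filter_upwards [hf.eventually (by simp)] with y hy
    exact hy.differentiableAt two_ne_zero
  rw [Asymptotics.isLittleO_iff]
  intro η hη
  have h3 := (hasFDerivAt_iff_isLittleO.1 h1.hasFDerivAt).def hη
  obtain ⟨r, hr, hball⟩ := Metric.eventually_nhds_iff_ball.1 (h2.and h3)
  refine Metric.eventually_nhds_iff_ball.2 ⟨r, hr, fun y hy => ?_⟩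
  set h := y - x with hh
  have hmem : ∀ t ∈ Icc (0 : ℝ) 1, x + t • h ∈ Metric.ball x r := by
    intro t ht
    rw [Metric.mem_ball, dist_eq_norm, add_sub_cancel_left, norm_smul, Real.norm_eq_abs,
      abs_of_nonneg ht.1]
    rw [Metric.mem_ball, dist_eq_norm] at hy
    exact (mul_le_of_le_one_left (norm_nonneg _) ht.2).trans_lt hy
  -- The mean value inequality is applied along the segment to `f` minus its quadratic part. The
  -- derivative is then the first-order error of `fderiv ℝ f` at `x`, so the second derivative is
  -- needed at `x` only.
  have hder : ∀ t ∈ Icc (0 : ℝ) 1, HasDerivWithinAt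
      (fun t : ℝ => f (x + t • h) - t ^ 2 / 2 * fderiv ℝ (fderiv ℝ f) x h h)
      (fderiv ℝ f (x + t • h) h - t * fderiv ℝ (fderiv ℝ f) x h h) (Icc 0 1) t := by
    intro t ht
    have ha : HasDerivAt (fun t : ℝ => x + t • h) h t := by
      simpa using ((hasDerivAt_id t).smul_const h).const_add x
    have hb := (hball _ (hmem t ht)).1.hasFDerivAt.comp_hasDerivAt t ha
    have hc : HasDerivAt (fun t : ℝ => t ^ 2 / 2 * fderiv ℝ (fderiv ℝ f) x h h)
        (t * fderiv ℝ (fderiv ℝ f) x h h) t := by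
      have := (((hasDerivAt_id t).pow 2).div_const 2).mul_const (fderiv ℝ (fderiv ℝ f) x h h)
      refine this.congr_deriv ?_
      norm_num
    exact (hb.sub hc).hasDerivWithinAt
  have hbound : ∀ t ∈ Ico (0 : ℝ) 1,
      ‖fderiv ℝ f (x + t • h) h - t * fderiv ℝ (fderiv ℝ f) x h h‖ ≤ η * ‖h‖ ^ 2 := by
    intro t ht
    have hd := (hball _ (hmem t (Ico_subset_Icc_self ht))).2
    rw [h0, sub_zero, add_sub_cancel_left, map_smul] at hd
    have he : fderiv ℝ f (x + t • h) h - t * fderiv ℝ (fderiv ℝ f) x h h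
        = (fderiv ℝ f (x + t • h) - t • fderiv ℝ (fderiv ℝ f) x h) h := by simp
    rw [he]
    refine (ContinuousLinearMap.le_opNorm _ _).trans ?_
    rw [norm_smul, Real.norm_eq_abs, abs_of_nonneg ht.1] at hd
    have h4 : t * ‖h‖ ≤ ‖h‖ := mul_le_of_le_one_left (norm_nonneg _) ht.2.le
    calc _ ≤ η * (t * ‖h‖) * ‖h‖ := by gcongr
      _ ≤ η * ‖h‖ * ‖h‖ := by gcongr
      _ = η * ‖h‖ ^ 2 := by ring
  have hfin := norm_image_sub_le_of_norm_deriv_le_segment_01' hder hbound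
  have hxy : x + h = y := by rw [hh]; abel
  simp only [one_smul, hxy, zero_smul, add_zero] at hfin
  rw [norm_pow, norm_norm]
  refine le_of_eq_of_le ?_ hfin
  congr 1
  ring

lemma eventually_abs_taylor_two_le (hf : ContDiffAt ℝ 2 f x) (h0 : fderiv ℝ f x = 0) {η : ℝ}
    (hη : 0 < η) : ∀ᶠ y in 𝓝 x,
      |f y - f x - 1 / 2 * fderiv ℝ (fderiv ℝ f) x (y - x) (y - x)| ≤ η * ‖y - x‖ ^ 2 := by
  filter_upwards [(taylor_two_isLittleO hf h0).def hη] with y hy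
  simpa using hy

/-- If `f` grows at least like `c ‖y - x‖ ^ 2`, then the second derivative is at least `2 c`. -/
lemma le_sndDeriv_of_growth (hf : ContDiffAt ℝ 2 f x) {c : ℝ} (hc : 0 ≤ c)
    (hg : ∀ᶠ y in 𝓝 x, f x + c * ‖y - x‖ ^ 2 ≤ f y) (h : X) :
    2 * c * ‖h‖ ^ 2 ≤ fderiv ℝ (fderiv ℝ f) x h h := by
  have hmin : IsLocalMin f x := by
    filter_upwards [hg] with y hy
    have : 0 ≤ c * ‖y - x‖ ^ 2 := by positivity
    linarith
  have h0 := hmin.fderiv_eq_zero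
  have key : ∀ η > 0, 2 * c * ‖h‖ ^ 2 ≤ fderiv ℝ (fderiv ℝ f) x h h + 2 * η * ‖h‖ ^ 2 := by
    intro η hη
    have hlim : Tendsto (fun t : ℝ => x + t • h) (𝓝[>] 0) (𝓝 x) := by
      have : Continuous fun t : ℝ => x + t • h := by fun_prop
      have := this.tendsto 0
      simp only [zero_smul, add_zero] at this
      exact this.mono_left nhdsWithin_le_nhds
    obtain ⟨t, ⟨h1, h2⟩, ht⟩ := ((hlim.eventually (hg.and (eventually_abs_taylor_two_le hf h0 hη))).and
      self_mem_nhdsWithin).exists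
    have ht' : 0 < t := ht
    simp only [add_sub_cancel_left, map_smul, smul_apply, smul_eq_mul, norm_smul,
      Real.norm_eq_abs, abs_of_pos ht', mul_pow] at h1 h2
    have h3 := (abs_le.1 h2).2
    have h4 : t ^ 2 * (2 * c * ‖h‖ ^ 2) ≤ t ^ 2 * (fderiv ℝ (fderiv ℝ f) x h h + 2 * η * ‖h‖ ^ 2) := by
      nlinarith
    exact le_of_mul_le_mul_left h4 (by positivity)
  refine le_of_forall_pos_le_add fun δ hδ => (key (δ / (2 * (‖h‖ ^ 2 + 1))) (by positivity)).trans ?_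
  gcongr
  rw [show 2 * (δ / (2 * (‖h‖ ^ 2 + 1))) * ‖h‖ ^ 2 = δ * (‖h‖ ^ 2 / (‖h‖ ^ 2 + 1)) by field_simp]
  refine mul_le_of_le_one_right hδ.le ((div_le_one (by positivity)).2 (by linarith))

lemma sndDeriv_nonneg_of_isLocalMin (hf : ContDiffAt ℝ 2 f x) (hmin : IsLocalMin f x) (h : X) :
    0 ≤ fderiv ℝ (fderiv ℝ f) x h h := by
  simpa using le_sndDeriv_of_growth hf le_rfl (hmin.mono fun y hy => by simpa using hy) h

lemma quadraticGrowth_of_sndDeriv (hf : ContDiffAt ℝ 2 f x) (h0 : fderiv ℝ f x = 0) {c : ℝ}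
    (hc : 0 < c) (h : ∀ h, c * ‖h‖ ^ 2 ≤ fderiv ℝ (fderiv ℝ f) x h h) : QuadraticGrowth f x := by
  refine ⟨c / 4, by linarith, ?_⟩
  filter_upwards [eventually_abs_taylor_two_le hf h0 (show 0 < c / 4 by linarith)] with y hy
  have h1 := (abs_le.1 hy).1
  have h2 := h (y - x)
  linarith

end Taylor

lemma quadraticGrowth_of_iteratedDeriv {f : ℝ → ℝ} {x : ℝ} (hf : ContDiffAt ℝ 2 f x)
    (hmin : IsLocalMin f x) (h : iteratedDeriv 2 f x ≠ 0) : QuadraticGrowth f x := by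
  have h1 : fderiv ℝ (fderiv ℝ f) x 1 1 = iteratedDeriv 2 f x := by
    rw [iteratedDeriv_eq_iteratedFDeriv, iteratedFDeriv_two_apply]
  have h2 := sndDeriv_nonneg_of_isLocalMin hf hmin 1
  rw [h1] at h2
  refine quadraticGrowth_of_sndDeriv hf hmin.fderiv_eq_zero (lt_of_le_of_ne h2 h.symm) fun t => ?_
  have h3 : fderiv ℝ (fderiv ℝ f) x t t = t * (t * fderiv ℝ (fderiv ℝ f) x 1 1) := by
    conv_lhs => rw [show t = t • (1 : ℝ) by simp]
    rw [map_smul, map_smul]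
    rfl
  rw [h3, h1, Real.norm_eq_abs, sq_abs]
  exact le_of_eq (by ring)

/-! ### Hessians, matrix square roots and quadratic forms. -/

section Matrix

variable {ι : Type*} [Fintype ι]

/-- Injective linear maps in finite dimension are bounded below. The norm is the supremum norm, the
dot product Euclidean. -/
lemma exists_le_dotProduct_mulVec {κ : Type*} [Fintype κ] {A : Matrix κ ι ℝ}
    (hA : Function.Injective A.mulVec) :
    ∃ c > 0, ∀ h, c * ‖h‖ ^ 2 ≤ A.mulVec h ⬝ᵥ A.mulVec h := by
  obtain ⟨K, hK, hanti⟩ := (LinearMap.injective_iff_antilipschitz A.mulVecLin).1 hA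
  refine ⟨((K : ℝ) ^ 2)⁻¹, by positivity, fun h => ?_⟩
  have h1 : ‖h‖ ≤ K * ‖A.mulVec h‖ := by
    simpa [dist_eq_norm] using hanti.le_mul_dist h 0
  have h2 : ‖A.mulVec h‖ ^ 2 ≤ A.mulVec h ⬝ᵥ A.mulVec h := by
    have h3 : ‖A.mulVec h‖ ≤ √(A.mulVec h ⬝ᵥ A.mulVec h) := by
      refine (pi_norm_le_iff_of_nonneg (Real.sqrt_nonneg _)).2 fun i => ?_
      rw [Real.norm_eq_abs]
      refine Real.abs_le_sqrt ?_
      rw [sq, dotProduct]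
      exact Finset.single_le_sum (f := fun i => A.mulVec h i * A.mulVec h i)
        (fun i _ => mul_self_nonneg _) (Finset.mem_univ i)
    have h4 : 0 ≤ A.mulVec h ⬝ᵥ A.mulVec h := Finset.sum_nonneg fun i _ => mul_self_nonneg _
    calc ‖A.mulVec h‖ ^ 2 ≤ √(A.mulVec h ⬝ᵥ A.mulVec h) ^ 2 := by gcongr
      _ = _ := Real.sq_sqrt h4
  rw [inv_mul_le_iff₀ (by positivity)]
  calc ‖h‖ ^ 2 ≤ (K * ‖A.mulVec h‖) ^ 2 := by gcongr
    _ = K ^ 2 * ‖A.mulVec h‖ ^ 2 := mul_pow _ _ _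
    _ ≤ _ := by gcongr

variable [DecidableEq ι]

lemma dotProduct_hessian_mulVec (f : (ι → ℝ) → ℝ) (x h : ι → ℝ) :
    h ⬝ᵥ (hessian f x).mulVec h = fderiv ℝ (fderiv ℝ f) x h h := by
  conv_rhs => rw [show h = ∑ j, h j • Pi.single j (1 : ℝ) by
    ext k; simp [Finset.sum_apply, Pi.single_apply]]
  simp only [map_sum, map_smul, sum_apply, smul_apply,
    dotProduct, Matrix.mulVec, hessian, Matrix.of_apply, iteratedFDeriv_two_apply, smul_eq_mul,
    Finset.mul_sum, Matrix.cons_val_zero, Matrix.cons_val_one]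
  rw [Finset.sum_comm]
  exact Finset.sum_congr rfl fun i _ => Finset.sum_congr rfl fun j _ => by ring

lemma hessian_isHermitian {f : (ι → ℝ) → ℝ} {x : ι → ℝ} (hf : ContDiffAt ℝ 2 f x) :
    (hessian f x).IsHermitian := by
  have := hf.isSymmSndFDerivAt (by simp)
  ext i j
  simp only [hessian, Matrix.conjTranspose_apply, Matrix.of_apply, iteratedFDeriv_two_apply,
    star_trivial, Matrix.cons_val_zero, Matrix.cons_val_one]
  exact this.eq _ _

lemma hessian_posSemidef {f : (ι → ℝ) → ℝ} {x : ι → ℝ} (hf : ContDiffAt ℝ 2 f x)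
    (hmin : IsLocalMin f x) : (hessian f x).PosSemidef :=
  Matrix.PosSemidef.of_dotProduct_mulVec_nonneg (hessian_isHermitian hf) fun h => by
    rw [star_trivial, dotProduct_hessian_mulVec]
    exact sndDeriv_nonneg_of_isLocalMin hf hmin h

lemma hessian_posDef {f : (ι → ℝ) → ℝ} {x : ι → ℝ} (hf : ContDiffAt ℝ 2 f x)
    (h : QuadraticGrowth f x) : (hessian f x).PosDef := by
  obtain ⟨c, hc, hg⟩ := h
  refine Matrix.PosDef.of_dotProduct_mulVec_pos (hessian_isHermitian hf) fun h hh => ?_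
  rw [star_trivial, dotProduct_hessian_mulVec]
  refine lt_of_lt_of_le ?_ (le_sndDeriv_of_growth hf hc.le hg h)
  have := norm_pos_iff.2 hh
  positivity

section

open scoped MatrixOrder Matrix.Norms.L2Operator

lemma dotProduct_matrixSqrt_mulVec {A : Matrix ι ι ℝ} (hA : A.PosSemidef) (h : ι → ℝ) :
    (matrixSqrt A).mulVec h ⬝ᵥ (matrixSqrt A).mulVec h = h ⬝ᵥ A.mulVec h := by
  have h1 : matrixSqrt A * matrixSqrt A = A := CFC.sqrt_mul_sqrt_self A hA.nonneg
  have h2 : (matrixSqrt A).transpose = matrixSqrt A := by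
    have : (matrixSqrt A).IsHermitian :=
      (Matrix.nonneg_iff_posSemidef.1 (CFC.sqrt_nonneg A)).1
    rwa [Matrix.IsHermitian, Matrix.conjTranspose_eq_transpose_of_trivial] at this
  conv_rhs => rw [← h1, ← Matrix.mulVec_mulVec, Matrix.dotProduct_mulVec, ← Matrix.mulVec_transpose, h2]

end

lemma matrixSqrt_mulVec_injective {A : Matrix ι ι ℝ} (hA : A.PosDef) :
    Function.Injective (matrixSqrt A).mulVec := by
  intro x y h
  by_contra hne
  have h1 := hA.dotProduct_mulVec_pos (sub_ne_zero.2 hne)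
  rw [star_trivial, ← dotProduct_matrixSqrt_mulVec hA.posSemidef, Matrix.mulVec_sub, h] at h1
  simp at h1

/-- At a local minimum the Hessian is positive semidefinite, so a nonzero determinant makes it
positive definite. -/
lemma quadraticGrowth_of_hessian_det_ne_zero {f : (ι → ℝ) → ℝ} {x : ι → ℝ} (hf : ContDiffAt ℝ 2 f x)
    (hmin : IsLocalMin f x) (hdet : (hessian f x).det ≠ 0) : QuadraticGrowth f x := by
  have hpos : (hessian f x).PosDef := (hessian_posSemidef hf hmin).posDef_iff_isUnit.2
    ((Matrix.isUnit_iff_isUnit_det _).2 (isUnit_iff_ne_zero.2 hdet))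
  obtain ⟨c, hc, h⟩ := exists_le_dotProduct_mulVec (matrixSqrt_mulVec_injective hpos)
  refine quadraticGrowth_of_sndDeriv hf hmin.fderiv_eq_zero hc fun y => ?_
  rw [← dotProduct_hessian_mulVec, ← dotProduct_matrixSqrt_mulVec hpos.posSemidef]
  exact h y

/-- The quadratic expansion of `f ∘ F` at a nondegenerate minimizer of `f`. -/
lemma eventually_abs_comp_sub_le {f : (ι → ℝ) → ℝ} {F : (ι → ℝ) → (ι → ℝ)} {v : ι → ℝ}
    (hf : ContDiffAt ℝ 2 f (F v)) (hg : QuadraticGrowth f (F v)) (hF : DifferentiableAt ℝ F v)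
    (hinj : Function.Injective (jacobian F v).mulVec) :
    Function.Injective (matrixSqrt (hessian f (F v)) * jacobian F v).mulVec ∧
    ∀ η > 0, ∀ᶠ w in 𝓝 v, |f (F w) - f (F v)
      - 1 / 2 * ((matrixSqrt (hessian f (F v)) * jacobian F v).mulVec (w - v) ⬝ᵥ
        (matrixSqrt (hessian f (F v)) * jacobian F v).mulVec (w - v))|
      ≤ η * ((matrixSqrt (hessian f (F v)) * jacobian F v).mulVec (w - v) ⬝ᵥ
        (matrixSqrt (hessian f (F v)) * jacobian F v).mulVec (w - v)) := by
  have hpos := hessian_posDef hf hg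
  set S := matrixSqrt (hessian f (F v)) with hS
  set D := jacobian F v with hD
  have hAinj : Function.Injective (S * D).mulVec := by
    intro x y h
    rw [← Matrix.mulVec_mulVec, ← Matrix.mulVec_mulVec] at h
    exact hinj (matrixSqrt_mulVec_injective hpos h)
  refine ⟨hAinj, fun η hη => ?_⟩
  have h1 : (fun w => F w - F v - D.mulVec (w - v)) =o[𝓝 v] fun w => w - v := by
    simp only [hD, jacobian_mulVec]
    exact hasFDerivAt_iff_isLittleO.1 hF.hasFDerivAt
  have hSO : ∀ g : (ι → ℝ) → (ι → ℝ), (fun w => S.mulVec (g w)) =O[𝓝 v] g := fun g =>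
    (LinearMap.toContinuousLinearMap S.mulVecLin).isBigO_comp g _
  have h2 : (fun w => S.mulVec (F w - F v) - (S * D).mulVec (w - v)) =o[𝓝 v] fun w => ‖w - v‖ := by
    have : (fun w => S.mulVec (F w - F v) - (S * D).mulVec (w - v))
        = fun w => S.mulVec (F w - F v - D.mulVec (w - v)) := by
      ext1 w; rw [Matrix.mulVec_sub S (F w - F v), Matrix.mulVec_mulVec]
    rw [this]
    exact ((hSO _).trans_isLittleO h1).norm_right
  have h3 : (fun w => F w - F v) =O[𝓝 v] fun w => w - v := hF.hasFDerivAt.isBigO_sub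
  have h4 : (fun w => S.mulVec (F w - F v) + (S * D).mulVec (w - v)) =O[𝓝 v] fun w => ‖w - v‖ := by
    refine (((hSO _).trans h3).add ?_).norm_right
    exact (LinearMap.toContinuousLinearMap (S * D).mulVecLin).isBigO_comp (fun w => w - v) _
  -- A difference of squares factors into an `o(‖w - v‖)` and an `O(‖w - v‖)` term. A first-order
  -- expansion of `F` suffices because the derivative of `f` vanishes at `F v`.
  have h5 : (fun w => S.mulVec (F w - F v) ⬝ᵥ S.mulVec (F w - F v)
      - (S * D).mulVec (w - v) ⬝ᵥ (S * D).mulVec (w - v)) =o[𝓝 v] fun w => ‖w - v‖ ^ 2 := by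
    have : (fun w => S.mulVec (F w - F v) ⬝ᵥ S.mulVec (F w - F v)
        - (S * D).mulVec (w - v) ⬝ᵥ (S * D).mulVec (w - v))
        = fun w => ∑ i, (S.mulVec (F w - F v) - (S * D).mulVec (w - v)) i
          * (S.mulVec (F w - F v) + (S * D).mulVec (w - v)) i := by
      ext1 w
      rw [dotProduct, dotProduct, ← Finset.sum_sub_distrib]
      exact Finset.sum_congr rfl fun i _ => by simp only [Pi.sub_apply, Pi.add_apply]; ring
    rw [this]
    refine Asymptotics.IsLittleO.fun_sum fun i _ => ?_
    simp only [sq]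
    exact (Asymptotics.isLittleO_pi.1 h2 i).mul_isBigO (Asymptotics.isBigO_pi.1 h4 i)
  have h6 := (taylor_two_isLittleO hf hg.isLocalMin.fderiv_eq_zero).comp_tendsto hF.continuousAt
  have h7 : (fun w => f (F w) - f (F v) - 1 / 2 * ((S * D).mulVec (w - v) ⬝ᵥ (S * D).mulVec (w - v)))
      =o[𝓝 v] fun w => ‖w - v‖ ^ 2 := by
    have h8 := (h6.trans_isBigO ((h3.norm_norm).pow 2)).add (h5.const_mul_left (1 / 2))
    refine h8.congr_left fun w => ?_
    simp only [Function.comp]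
    rw [← dotProduct_hessian_mulVec, ← dotProduct_matrixSqrt_mulVec hpos.posSemidef]
    ring
  -- Coercivity of the form turns an error relative to `‖w - v‖ ^ 2` into one relative to the form
  -- itself.
  obtain ⟨c, hc, hcb⟩ := exists_le_dotProduct_mulVec hAinj
  filter_upwards [h7.def (show 0 < η * c by positivity)] with w hw
  rw [Real.norm_eq_abs, norm_pow, norm_norm, mul_assoc] at hw
  exact hw.trans (mul_le_mul_of_nonneg_left (hcb _) hη.le)

end Matrix

/-! ## Moderate deviations by Laplace's method -/

section Laplace

variable {ι : Type*} [Fintype ι]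

lemma integrable_exp_neg_mul_norm_sq {c : ℝ} (hc : 0 < c) :
    Integrable fun w : ι → ℝ => Real.exp (-c * ‖w‖ ^ 2) := by
  have hd : (0 : ℝ) < Fintype.card ι + 1 := by positivity
  have h1 : Integrable fun w : ι → ℝ => ∏ i, Real.exp (-(c / (Fintype.card ι + 1)) * w i ^ 2) :=
    Integrable.fintype_prod fun i => integrable_exp_neg_mul_sq (div_pos hc hd)
  refine h1.mono' (by fun_prop) (Eventually.of_forall fun w => ?_)
  rw [Real.norm_eq_abs, abs_of_pos (Real.exp_pos _), ← Real.exp_sum, Real.exp_le_exp,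
    ← Finset.mul_sum, neg_mul, neg_mul, neg_le_neg_iff, div_mul_eq_mul_div, div_le_iff₀ hd, mul_assoc]
  refine mul_le_mul_of_nonneg_left ?_ hc.le
  calc ∑ i, w i ^ 2 ≤ ∑ _i : ι, ‖w‖ ^ 2 := Finset.sum_le_sum fun i _ => by
        rw [← sq_abs, ← Real.norm_eq_abs]; gcongr; exact norm_le_pi_norm w i
    _ = ‖w‖ ^ 2 * Fintype.card ι := by simp [mul_comm]
    _ ≤ _ := by gcongr; linarith

lemma lintegral_exp_neg_mul_norm_sub_sq {c s : ℝ} (hc : 0 < c) (hs : 0 < s) (q : ι → ℝ) :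
    ∫⁻ v : ι → ℝ, ENNReal.ofReal (Real.exp (-c * (s * ‖v - q‖) ^ 2))
      = ENNReal.ofReal ((s ^ Fintype.card ι)⁻¹ * ∫ w : ι → ℝ, Real.exp (-c * ‖w‖ ^ 2)) := by
  rw [lintegral_sub_right_eq_self (fun v : ι → ℝ => ENNReal.ofReal (Real.exp (-c * (s * ‖v‖) ^ 2)))]
  have h1 : ∀ v : ι → ℝ, s * ‖v‖ = ‖s • v‖ := fun v => by
    rw [norm_smul, Real.norm_eq_abs, abs_of_pos hs]
  simp only [h1]
  have h2 : Integrable fun v : ι → ℝ => Real.exp (-c * ‖s • v‖ ^ 2) :=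
    (integrable_comp_smul_iff volume (fun v : ι → ℝ => Real.exp (-c * ‖v‖ ^ 2)) hs.ne').2
      (integrable_exp_neg_mul_norm_sq hc)
  rw [← ofReal_integral_eq_lintegral_ofReal h2 (Eventually.of_forall fun v => (Real.exp_pos _).le),
    Measure.integral_comp_smul volume (fun v : ι → ℝ => Real.exp (-c * ‖v‖ ^ 2)),
    Module.finrank_fintype_fun_eq_card, abs_of_pos (by positivity), smul_eq_mul]

/-- The quadratic form `h ↦ |A h|²`. -/
def quadForm (A : Matrix ι ι ℝ) (h : ι → ℝ) : ℝ := A.mulVec h ⬝ᵥ A.mulVec h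

lemma dotProduct_self_nonneg (x : ι → ℝ) : 0 ≤ x ⬝ᵥ x :=
  Finset.sum_nonneg fun _ _ => mul_self_nonneg _

lemma continuous_quadForm (A : Matrix ι ι ℝ) : Continuous (quadForm A) := by
  unfold quadForm; fun_prop

/-- The hypotheses for Laplace's method on `Ω`: the phase `Φ` attains its minimum `Φ₀` exactly at
the points `q` of a finite set `S`, where it has the quadratic expansion `Φ₀ + |A_q (v - q)|² / 2`
with `A_q` invertible, and it is well separated from its minimum elsewhere. -/
structure LaplaceSetup (Ω : Set (ι → ℝ)) (Φ g : (ι → ℝ) → ℝ) (S : Set (ι → ℝ)) (Φ₀ : ℝ)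
    (A : (ι → ℝ) → Matrix ι ι ℝ) : Prop where
  measurableSet : MeasurableSet Ω
  finite : S.Finite
  nonempty : S.Nonempty
  injective : ∀ q ∈ S, Function.Injective (A q).mulVec
  expansion : ∀ q ∈ S, ∀ η > 0, ∀ᶠ v in 𝓝 q, v ∈ Ω ∧
    |Φ v - Φ₀ - 1 / 2 * quadForm (A q) (v - q)| ≤ η * quadForm (A q) (v - q)
  bounds : ∀ q ∈ S, ∃ c > 0, ∃ K, ∀ᶠ v in 𝓝 q, c ≤ g v ∧ g v ≤ K
  gap : ∀ U, IsOpen U → S ⊆ U → ∃ δ > 0, ∀ v ∈ Ω, v ∉ U → Φ₀ + δ ≤ Φ v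
  integrable : ∃ N : ℕ, ∫⁻ v in Ω, ENNReal.ofReal (Real.exp (-N * Φ v) * g v) ≠ ⊤

/-- The mass of `B` under the unnormalized measure with density `exp (-n Φ) g`. -/
noncomputable def laplaceMass (Ω : Set (ι → ℝ)) (Φ g : (ι → ℝ) → ℝ) (n : ℕ) (B : Set (ι → ℝ)) :
    ENNReal :=
  ∫⁻ v in Ω ∩ B, ENNReal.ofReal (Real.exp (-n * Φ v) * g v)

/-- The natural normalization of `laplaceMass`. -/
noncomputable def laplaceScale (ι : Type*) [Fintype ι] (Φ₀ : ℝ) (n : ℕ) : ℝ :=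
  (√n ^ Fintype.card ι)⁻¹ * Real.exp (-n * Φ₀)

variable {Ω : Set (ι → ℝ)} {Φ g : (ι → ℝ) → ℝ} {S : Set (ι → ℝ)} {Φ₀ : ℝ}
  {A : (ι → ℝ) → Matrix ι ι ℝ}

/-- The contribution of a neighbourhood of a minimizer. -/
lemma LaplaceSetup.mass_near_le (h : LaplaceSetup Ω Φ g S Φ₀ A) {q : ι → ℝ} (hq : q ∈ S) {η : ℝ}
    (hη : 0 < η) (hη4 : η < 1 / 4) :
    ∃ C ≥ 0, ∃ N ∈ 𝓝 q, IsOpen N ∧ ∀ n : ℕ, 0 < n → ∀ t ≥ 0,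
      laplaceMass Ω Φ g n (N ∩ {v | 2 * t ≤ n * quadForm (A q) (v - q)})
        ≤ ENNReal.ofReal (C * laplaceScale ι Φ₀ n * Real.exp (-((1 - 4 * η) * t))) := by
  obtain ⟨c₀, hc₀, K, hK⟩ := h.bounds q hq
  obtain ⟨c, hc, hcQ⟩ := exists_le_dotProduct_mulVec (h.injective q hq)
  obtain ⟨N, hN, hNo, hqN⟩ := eventually_nhds_iff.1 ((h.expansion q hq η hη).and hK)
  have hG : 0 ≤ ∫ w : ι → ℝ, Real.exp (-(η * c) * ‖w‖ ^ 2) :=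
    integral_nonneg fun w => (Real.exp_pos _).le
  have hK0 : 0 ≤ K := by
    have := (hN q hqN).2
    linarith
  refine ⟨K * ∫ w : ι → ℝ, Real.exp (-(η * c) * ‖w‖ ^ 2), by positivity, N, hNo.mem_nhds hqN, hNo,
    fun n hn t ht => ?_⟩
  have hn' : (0 : ℝ) < n := by exact_mod_cast hn
  have hmeas : MeasurableSet (Ω ∩ (N ∩ {v | 2 * t ≤ n * quadForm (A q) (v - q)})) := by
    refine h.measurableSet.inter (hNo.measurableSet.inter ?_)
    have := continuous_quadForm (A q)
    exact measurableSet_le measurable_const (by fun_prop : Continuous fun v => (n : ℝ) * quadForm (A q) (v - q)).measurable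
  have key : ∀ v ∈ Ω ∩ (N ∩ {v | 2 * t ≤ n * quadForm (A q) (v - q)}),
      ENNReal.ofReal (Real.exp (-n * Φ v) * g v)
      ≤ ENNReal.ofReal (K * Real.exp (-n * Φ₀) * Real.exp (-((1 - 4 * η) * t)))
        * ENNReal.ofReal (Real.exp (-(η * c) * (√n * ‖v - q‖) ^ 2)) := by
    rintro v ⟨-, hv, hvt⟩
    obtain ⟨⟨-, h1⟩, h2, h3⟩ := hN v hv
    rw [← ENNReal.ofReal_mul (by positivity)]
    refine ENNReal.ofReal_le_ofReal ?_
    rw [mul_assoc K, mul_assoc K, ← Real.exp_add, ← Real.exp_add, mul_comm]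
    have h4 := (abs_le.1 h1).1
    have h5 := hcQ (v - q)
    change 2 * t ≤ n * quadForm (A q) (v - q) at hvt
    change c * ‖v - q‖ ^ 2 ≤ quadForm (A q) (v - q) at h5
    refine mul_le_mul h3 (Real.exp_le_exp.2 ?_) (Real.exp_pos _).le hK0
    rw [mul_pow, Real.sq_sqrt hn'.le]
    have h6 : (n : ℝ) * (Φ₀ + 1 / 2 * quadForm (A q) (v - q) - η * quadForm (A q) (v - q)) ≤ n * Φ v :=
      mul_le_mul_of_nonneg_left (by linarith) hn'.le
    -- The available `(1 / 2 - η) * quadForm` is split: `1 / 2 - 2 * η` produces the decay in `t`,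
    -- and the remaining `η` gives an integrable Gaussian.
    have h7 : (1 / 2 - 2 * η) * (2 * t) ≤ (1 / 2 - 2 * η) * (n * quadForm (A q) (v - q)) :=
      mul_le_mul_of_nonneg_left hvt (by linarith)
    have h8 : η * n * (c * ‖v - q‖ ^ 2) ≤ η * n * quadForm (A q) (v - q) :=
      mul_le_mul_of_nonneg_left h5 (by positivity)
    linarith
  calc laplaceMass Ω Φ g n (N ∩ {v | 2 * t ≤ n * quadForm (A q) (v - q)})
      ≤ ∫⁻ v in Ω ∩ (N ∩ {v | 2 * t ≤ n * quadForm (A q) (v - q)}),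
        ENNReal.ofReal (K * Real.exp (-n * Φ₀) * Real.exp (-((1 - 4 * η) * t)))
        * ENNReal.ofReal (Real.exp (-(η * c) * (√n * ‖v - q‖) ^ 2)) := setLIntegral_mono' hmeas key
    _ ≤ ∫⁻ v, ENNReal.ofReal (K * Real.exp (-n * Φ₀) * Real.exp (-((1 - 4 * η) * t)))
        * ENNReal.ofReal (Real.exp (-(η * c) * (√n * ‖v - q‖) ^ 2)) := setLIntegral_le_lintegral _ _
    _ = ENNReal.ofReal (K * Real.exp (-n * Φ₀) * Real.exp (-((1 - 4 * η) * t)))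
        * ENNReal.ofReal ((√n ^ Fintype.card ι)⁻¹ * ∫ w : ι → ℝ, Real.exp (-(η * c) * ‖w‖ ^ 2)) := by
      rw [lintegral_const_mul' _ _ ENNReal.ofReal_ne_top,
        lintegral_exp_neg_mul_norm_sub_sq (by positivity) (Real.sqrt_pos.2 hn')]
    _ = _ := by
      rw [← ENNReal.ofReal_mul (by positivity), laplaceScale]
      congr 1
      ring

lemma tendsto_sqrt_pow_mul_exp_neg (d : ℕ) {c : ℝ} (hc : 0 < c) :
    Tendsto (fun n : ℕ => √(n : ℝ) ^ d * Real.exp (-c * n)) atTop (𝓝 0) := by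
  have h1 : Tendsto (fun n : ℕ => (n : ℝ) ^ d * Real.exp (-c * n)) atTop (𝓝 0) :=
    by simpa [Function.comp_def] using (tendsto_rpow_mul_exp_neg_mul_atTop_nhds_zero d c hc).comp tendsto_natCast_atTop_atTop
  refine squeeze_zero' (Eventually.of_forall fun n => by positivity) ?_ h1
  filter_upwards [eventually_ge_atTop 1] with n hn
  have : √(n : ℝ) ≤ n := by
    have h1 : (1 : ℝ) ≤ n := by exact_mod_cast hn
    exact Real.sqrt_le_iff.2 ⟨by linarith, by nlinarith⟩
  gcongr

/-- The contribution of the points away from the minimizers is exponentially small. -/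
lemma LaplaceSetup.mass_far_le (h : LaplaceSetup Ω Φ g S Φ₀ A) {U : Set (ι → ℝ)} (hU : IsOpen U)
    (hSU : S ⊆ U) :
    ∃ C ≥ 0, ∃ δ > 0, ∀ᶠ n : ℕ in atTop,
      laplaceMass Ω Φ g n Uᶜ ≤ ENNReal.ofReal (C * laplaceScale ι Φ₀ n * Real.exp (-(δ * n))) := by
  obtain ⟨δ, hδ, hgap⟩ := h.gap U hU hSU
  obtain ⟨N, hN⟩ := h.integrable
  set J := ∫⁻ v in Ω, ENNReal.ofReal (Real.exp (-N * Φ v) * g v) with hJ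
  -- Half of the gap absorbs the power of `√n` in `laplaceScale`; the other half is the decay
  -- claimed.
  refine ⟨Real.exp (N * (Φ₀ + δ)) * J.toReal, by positivity, δ / 2, by positivity, ?_⟩
  have h1 : ∀ᶠ n : ℕ in atTop, √(n : ℝ) ^ Fintype.card ι * Real.exp (-(δ / 2) * n) < 1 :=
    (tendsto_sqrt_pow_mul_exp_neg _ (by positivity)).eventually (gt_mem_nhds one_pos)
  filter_upwards [h1, eventually_ge_atTop N, eventually_gt_atTop 0] with n hn hnN hn0
  have hn0' : (0 : ℝ) < n := by exact_mod_cast hn0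
  have hnN' : (N : ℝ) ≤ n := by exact_mod_cast hnN
  -- `N` copies of the phase are kept for integrability, and the gap is used on the other `n - N`.
  have key : ∀ v ∈ Ω ∩ Uᶜ, ENNReal.ofReal (Real.exp (-n * Φ v) * g v)
      ≤ ENNReal.ofReal (Real.exp (-(n - N) * (Φ₀ + δ))) * ENNReal.ofReal (Real.exp (-N * Φ v) * g v) := by
    rintro v ⟨hv, hvU⟩
    have h2 : Real.exp (-n * Φ v) * g v
        = Real.exp (-(n - N) * Φ v) * (Real.exp (-N * Φ v) * g v) := by
      rw [← mul_assoc, ← Real.exp_add]; congr 2; ring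
    rw [h2, ENNReal.ofReal_mul (Real.exp_pos _).le]
    gcongr ?_ * _
    refine ENNReal.ofReal_le_ofReal (Real.exp_le_exp.2 ?_)
    have := mul_le_mul_of_nonneg_left (hgap v hv hvU) (sub_nonneg.2 hnN')
    linarith
  calc laplaceMass Ω Φ g n Uᶜ
      ≤ ∫⁻ v in Ω ∩ Uᶜ, ENNReal.ofReal (Real.exp (-(n - N) * (Φ₀ + δ)))
          * ENNReal.ofReal (Real.exp (-N * Φ v) * g v) :=
        setLIntegral_mono' (h.measurableSet.inter hU.measurableSet.compl) key
    _ ≤ ENNReal.ofReal (Real.exp (-(n - N) * (Φ₀ + δ))) * J := by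
      rw [lintegral_const_mul' _ _ ENNReal.ofReal_ne_top]
      gcongr
      exact lintegral_mono_set inter_subset_left
    _ = ENNReal.ofReal (Real.exp (-(n - N) * (Φ₀ + δ)) * J.toReal) := by
      rw [ENNReal.ofReal_mul (Real.exp_pos _).le, ENNReal.ofReal_toReal hN]
    _ ≤ _ := by
      refine ENNReal.ofReal_le_ofReal ?_
      have hs : 0 < √(n : ℝ) := Real.sqrt_pos.2 hn0'
      have h3 : Real.exp (-(δ / 2) * n) ≤ (√(n : ℝ) ^ Fintype.card ι)⁻¹ := by
        rw [← one_div, le_div_iff₀ (by positivity), mul_comm]; exact hn.le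
      calc Real.exp (-(n - N) * (Φ₀ + δ)) * J.toReal
          = Real.exp (N * (Φ₀ + δ)) * J.toReal * (Real.exp (-(δ / 2) * n) * Real.exp (-n * Φ₀))
            * Real.exp (-(δ / 2 * n)) := by
            have : Real.exp (-(n - N) * (Φ₀ + δ)) = Real.exp (N * (Φ₀ + δ))
              * (Real.exp (-(δ / 2) * n) * Real.exp (-n * Φ₀)) * Real.exp (-(δ / 2 * n)) := by
              rw [← Real.exp_add, ← Real.exp_add, ← Real.exp_add]; congr 1; ring
            rw [this]; ring
        _ ≤ _ := by
          unfold laplaceScale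
          gcongr

variable {a : ℕ → ℝ} {Z : ℕ → (ι → ℝ) → (ι → ℝ)}

lemma tendsto_speed (ha : Tendsto a atTop atTop) (ha' : a =o[atTop] fun n : ℕ => √(n : ℝ)) :
    Tendsto (fun n : ℕ => (n : ℝ) / a n ^ 2) atTop atTop := by
  have h1 : Tendsto (fun n => a n / √(n : ℝ)) atTop (𝓝 0) := ha'.tendsto_div_nhds_zero
  have h2 : Tendsto (fun n => (a n / √(n : ℝ)) ^ 2) atTop (𝓝[>] 0) := by
    refine tendsto_nhdsWithin_iff.2 ⟨by simpa using h1.pow 2, ?_⟩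
    filter_upwards [ha.eventually_gt_atTop 0, eventually_gt_atTop 0] with n hn hn0
    have : 0 < √(n : ℝ) := Real.sqrt_pos.2 (by exact_mod_cast hn0)
    exact pow_pos (div_pos hn this) 2
  refine (h2.inv_tendsto_nhdsGT_zero).congr fun n => ?_
  rw [Pi.inv_apply, div_pow, Real.sq_sqrt (Nat.cast_nonneg n), inv_div]

lemma laplaceMass_union_le (n : ℕ) (B B' : Set (ι → ℝ)) :
    laplaceMass Ω Φ g n (B ∪ B') ≤ laplaceMass Ω Φ g n B + laplaceMass Ω Φ g n B' := by
  unfold laplaceMass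
  rw [inter_union_distrib_left]
  exact lintegral_union_le _ _ _

lemma laplaceMass_iUnion_le {κ : Type*} [Fintype κ] (n : ℕ) (B : κ → Set (ι → ℝ)) :
    laplaceMass Ω Φ g n (⋃ k, B k) ≤ ∑ k, laplaceMass Ω Φ g n (B k) := by
  unfold laplaceMass
  rw [inter_iUnion, ← tsum_fintype (L := SummationFilter.unconditional κ)]
  exact lintegral_iUnion_le _ _

lemma laplaceMass_mono (n : ℕ) {B B' : Set (ι → ℝ)} (h : B ⊆ B') :
    laplaceMass Ω Φ g n B ≤ laplaceMass Ω Φ g n B' :=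
  lintegral_mono_set (inter_subset_inter_right _ h)

/-- Near a minimizer `n * quadForm` is `(n / a n ^ 2) * (Z ⬝ᵥ Z)`, so the local bounds apply with `t
= r * n / a n ^ 2`. The constant `C` must not depend on `r`, since it is later absorbed by the
speed. -/
lemma LaplaceSetup.mass_le (h : LaplaceSetup Ω Φ g S Φ₀ A) (ha : Tendsto a atTop atTop)
    (hZ : ∀ q ∈ S, ∀ᶠ v in 𝓝 q, ∀ n, Z n v = a n • (A q).mulVec (v - q)) {η : ℝ}
    (hη : 0 < η) (hη4 : η < 1 / 4) :
    ∃ C > 0, ∀ r ≥ 0, ∀ᶠ n : ℕ in atTop,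
      laplaceMass Ω Φ g n {v | 2 * r ≤ Z n v ⬝ᵥ Z n v}
        ≤ ENNReal.ofReal (C * laplaceScale ι Φ₀ n * Real.exp (-((1 - 4 * η) * (r * (n / a n ^ 2))))) := by
  have hfin := h.finite.fintype
  have hnear := fun q : S => h.mass_near_le q.2 hη hη4
  choose C hC N hNq hNo hN using hnear
  have hZ' := fun q : S => eventually_nhds_iff.1 (hZ q q.2)
  choose M hM hMo hqM using hZ'
  obtain ⟨C', hC', δ, hδ, hfar⟩ := h.mass_far_le (U := ⋃ q : S, N q ∩ M q)
    (isOpen_iUnion fun q => (hNo q).inter (hMo q))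
    fun q hq => mem_iUnion.2 ⟨⟨q, hq⟩, mem_of_mem_nhds (hNq ⟨q, hq⟩), hqM ⟨q, hq⟩⟩
  refine ⟨∑ q, C q + C' + 1, by have := Finset.sum_nonneg (s := Finset.univ) fun q _ => hC q; positivity,
    fun r hr => ?_⟩
  -- As `a n → ∞`, the speed is negligible against `n`, and the far part decays fast enough.
  have h1 : ∀ᶠ n in atTop, r / a n ^ 2 < δ := by
    have : Tendsto (fun n => r / a n ^ 2) atTop (𝓝 0) :=
      tendsto_const_nhds.div_atTop ((tendsto_pow_atTop two_ne_zero).comp ha)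
    exact this.eventually (gt_mem_nhds hδ)
  filter_upwards [hfar, h1, ha.eventually_gt_atTop 0, eventually_gt_atTop 0] with n hfar hn han hn0
  have hn0' : (0 : ℝ) < n := by exact_mod_cast hn0
  have hb : 0 ≤ (n : ℝ) / a n ^ 2 := by positivity
  have hscale : 0 ≤ laplaceScale ι Φ₀ n := by unfold laplaceScale; positivity
  have hsub : {v | 2 * r ≤ Z n v ⬝ᵥ Z n v} ⊆
      (⋃ q : S, N q ∩ {v | 2 * (r * (n / a n ^ 2)) ≤ n * quadForm (A q) (v - q)})
        ∪ (⋃ q : S, N q ∩ M q)ᶜ := by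
    intro v hv
    by_cases hvU : v ∈ ⋃ q : S, N q ∩ M q
    · obtain ⟨q, hvN, hvM⟩ := mem_iUnion.1 hvU
      refine Or.inl (mem_iUnion.2 ⟨q, hvN, ?_⟩)
      have h2 : 2 * r ≤ Z n v ⬝ᵥ Z n v := hv
      rw [hM q v hvM n, smul_dotProduct, dotProduct_smul, smul_eq_mul, smul_eq_mul] at h2
      change 2 * (r * (n / a n ^ 2)) ≤ n * ((A q).mulVec (v - q) ⬝ᵥ (A q).mulVec (v - q))
      have h3 := mul_le_mul_of_nonneg_left h2 hb
      have h4 : (n : ℝ) / a n ^ 2 * (a n * (a n * ((A q).mulVec (v - q) ⬝ᵥ (A q).mulVec (v - q))))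
          = n * ((A q).mulVec (v - q) ⬝ᵥ (A q).mulVec (v - q)) := by
        field_simp
      linarith
    · exact Or.inr hvU
  calc laplaceMass Ω Φ g n {v | 2 * r ≤ Z n v ⬝ᵥ Z n v}
      ≤ ∑ q : S, laplaceMass Ω Φ g n
          (N q ∩ {v | 2 * (r * (n / a n ^ 2)) ≤ n * quadForm (A q) (v - q)})
        + laplaceMass Ω Φ g n (⋃ q : S, N q ∩ M q)ᶜ :=
        (laplaceMass_mono n hsub).trans ((laplaceMass_union_le n _ _).trans
          (add_le_add_left (laplaceMass_iUnion_le n _) _))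
    _ ≤ ∑ q : S, ENNReal.ofReal
          (C q * laplaceScale ι Φ₀ n * Real.exp (-((1 - 4 * η) * (r * (n / a n ^ 2)))))
        + ENNReal.ofReal (C' * laplaceScale ι Φ₀ n * Real.exp (-((1 - 4 * η) * (r * (n / a n ^ 2))))) := by
        refine add_le_add (Finset.sum_le_sum fun q _ => hN q n hn0 _ (by positivity)) (hfar.trans ?_)
        refine ENNReal.ofReal_le_ofReal (mul_le_mul_of_nonneg_left (Real.exp_le_exp.2 ?_) (by positivity))
        have h5 : r * (n / a n ^ 2) ≤ δ * n := by
          have := mul_le_mul_of_nonneg_right hn.le hn0'.le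
          calc r * (n / a n ^ 2) = r / a n ^ 2 * n := by ring
            _ ≤ _ := this
        have h6 : 0 ≤ η * (r * (n / a n ^ 2)) := by positivity
        linarith
    _ ≤ _ := by
      rw [← ENNReal.ofReal_sum_of_nonneg fun q _ => by have := hC q; positivity,
        ← ENNReal.ofReal_add (Finset.sum_nonneg fun q _ => by have := hC q; positivity) (by positivity),
        ← Finset.sum_mul, ← Finset.sum_mul]
      refine ENNReal.ofReal_le_ofReal ?_
      rw [← add_mul, ← add_mul]
      exact mul_le_mul_of_nonneg_right (mul_le_mul_of_nonneg_right (by linarith) hscale)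
        (Real.exp_pos _).le

lemma quadForm_add_le (x y : ι → ℝ) {η : ℝ} (hη : 0 < η) :
    (x + y) ⬝ᵥ (x + y) ≤ (1 + η) * (x ⬝ᵥ x) + (1 + η⁻¹) * (y ⬝ᵥ y) := by
  simp only [dotProduct, Finset.mul_sum, ← Finset.sum_add_distrib]
  refine Finset.sum_le_sum fun i _ => ?_
  have h1 : 0 ≤ (η * x i - y i) ^ 2 * η⁻¹ := by positivity
  have h2 : (η * x i - y i) ^ 2 * η⁻¹ = η * x i ^ 2 - 2 * (x i * y i) + η⁻¹ * y i ^ 2 := by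
    field_simp
    ring
  simp only [Pi.add_apply]
  nlinarith

lemma dotProduct_self_le (x : ι → ℝ) : x ⬝ᵥ x ≤ Fintype.card ι * ‖x‖ ^ 2 := by
  calc x ⬝ᵥ x ≤ ∑ _i : ι, ‖x‖ ^ 2 := Finset.sum_le_sum fun i _ => by
        rw [← sq, ← sq_abs, ← Real.norm_eq_abs]; gcongr; exact norm_le_pi_norm x i
    _ = _ := by simp

/-- One minimizer suffices. The ball of radius `1 / √n` around `q + x₀ / a n`, with `A x₀ = z`, is
mapped by `Z` to within `M * a n / √n → 0` of `z`. Its volume has the order of the power of `n` in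
`laplaceScale`. -/
lemma LaplaceSetup.le_mass (h : LaplaceSetup Ω Φ g S Φ₀ A) (ha : Tendsto a atTop atTop)
    (ha' : a =o[atTop] fun n : ℕ => √(n : ℝ))
    (hZ : ∀ q ∈ S, ∀ᶠ v in 𝓝 q, ∀ n, Z n v = a n • (A q).mulVec (v - q)) {η : ℝ}
    (hη : 0 < η) (z : ι → ℝ) {ρ : ℝ} (hρ : 0 < ρ) :
    ∃ c > 0, ∀ᶠ n : ℕ in atTop,
      ENNReal.ofReal (c * laplaceScale ι Φ₀ n
        * Real.exp (-((1 / 2 + η) * (1 + η) * (z ⬝ᵥ z) * (n / a n ^ 2))))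
      ≤ laplaceMass Ω Φ g n {v | ‖Z n v - z‖ < ρ} := by
  obtain ⟨q, hq⟩ := h.nonempty
  obtain ⟨c₀, hc₀, K, hK⟩ := h.bounds q hq
  obtain ⟨R, hR, hball⟩ := Metric.eventually_nhds_iff_ball.1
    (((h.expansion q hq η hη).and hK).and (hZ q hq))
  obtain ⟨x₀, hx₀⟩ := (LinearMap.injective_iff_surjective (f := (A q).mulVecLin)).1 (h.injective q hq) z
  replace hx₀ : (A q).mulVec x₀ = z := hx₀
  obtain ⟨M, hM0, hM⟩ : ∃ M > 0, ∀ v, ‖(A q).mulVec v‖ ≤ M * ‖v‖ :=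
    ⟨_, (LinearMap.toContinuousLinearMap (A q).mulVecLin).bound.choose_spec⟩
  -- The phase cost of the ball's radius: `n` times a squared radius `1 / n`, hence a constant.
  set D : ℝ := (1 / 2 + η) * ((1 + η⁻¹) * (Fintype.card ι * M ^ 2)) with hD
  refine ⟨c₀ * Real.exp (-D) * 2 ^ Fintype.card ι, by positivity, ?_⟩
  have hs0 : Tendsto (fun n : ℕ => (√(n : ℝ))⁻¹) atTop (𝓝 0) :=
    ((Real.tendsto_sqrt_atTop).comp tendsto_natCast_atTop_atTop).inv_tendsto_atTop
  have h1 : Tendsto (fun n => (a n)⁻¹ * ‖x₀‖ + (√(n : ℝ))⁻¹) atTop (𝓝 0) := by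
    simpa using (ha.inv_tendsto_atTop.mul_const ‖x₀‖).add hs0
  have h2 : Tendsto (fun n => M * (a n / √(n : ℝ))) atTop (𝓝 0) := by
    simpa using ha'.tendsto_div_nhds_zero.const_mul M
  filter_upwards [h1.eventually (gt_mem_nhds hR), h2.eventually (gt_mem_nhds hρ),
    ha.eventually_gt_atTop 0, eventually_gt_atTop 0] with n hn1 hn2 han hn0
  have hn0' : (0 : ℝ) < n := by exact_mod_cast hn0
  have hs : 0 < √(n : ℝ) := Real.sqrt_pos.2 hn0'
  set B := Metric.ball (q + (a n)⁻¹ • x₀) (√(n : ℝ))⁻¹ with hB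
  have hmem : ∀ v ∈ B, v ∈ Metric.ball q R := by
    intro v hv
    rw [hB, mem_ball_iff_norm] at hv
    rw [mem_ball_iff_norm]
    calc ‖v - q‖ = ‖(v - (q + (a n)⁻¹ • x₀)) + (a n)⁻¹ • x₀‖ := by congr 1; abel
      _ ≤ ‖v - (q + (a n)⁻¹ • x₀)‖ + ‖(a n)⁻¹ • x₀‖ := norm_add_le _ _
      _ ≤ (√(n : ℝ))⁻¹ + (a n)⁻¹ * ‖x₀‖ := by
        rw [norm_smul, norm_inv, Real.norm_eq_abs, abs_of_pos han]; gcongr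
      _ < R := by linarith
  have hZB : ∀ v ∈ B, ‖Z n v - z‖ ≤ M * (a n / √(n : ℝ)) := by
    intro v hv
    rw [(hball v (hmem v hv)).2 n]
    rw [hB, mem_ball_iff_norm] at hv
    have : a n • (A q).mulVec (v - q) - z = a n • (A q).mulVec (v - (q + (a n)⁻¹ • x₀)) := by
      rw [← sub_sub, Matrix.mulVec_sub _ (v - q), Matrix.mulVec_smul, hx₀, smul_sub, smul_smul,
        mul_inv_cancel₀ han.ne', one_smul]
    rw [this, norm_smul, Real.norm_eq_abs, abs_of_pos han]
    calc a n * ‖(A q).mulVec (v - (q + (a n)⁻¹ • x₀))‖ ≤ a n * (M * (√(n : ℝ))⁻¹) := by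
          gcongr; exact (hM _).trans (by gcongr)
      _ = _ := by ring
  have key : ∀ v ∈ B, ENNReal.ofReal (c₀ * Real.exp (-D) * Real.exp (-n * Φ₀)
        * Real.exp (-((1 / 2 + η) * (1 + η) * (z ⬝ᵥ z) * (n / a n ^ 2))))
      ≤ ENNReal.ofReal (Real.exp (-n * Φ v) * g v) := by
    intro v hv
    obtain ⟨⟨⟨-, he⟩, hg, -⟩, hZv⟩ := hball v (hmem v hv)
    refine ENNReal.ofReal_le_ofReal ?_
    rw [mul_comm _ (g v), mul_assoc c₀, mul_assoc c₀, ← Real.exp_add, ← Real.exp_add]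
    refine mul_le_mul hg (Real.exp_le_exp.2 ?_) (Real.exp_pos _).le (hc₀.le.trans hg)
    have e1 : (n : ℝ) * quadForm (A q) (v - q) = n / a n ^ 2 * (Z n v ⬝ᵥ Z n v) := by
      rw [hZv n, smul_dotProduct, dotProduct_smul, smul_eq_mul, smul_eq_mul, quadForm]
      field_simp
    have e2 : Z n v ⬝ᵥ Z n v ≤ (1 + η) * (z ⬝ᵥ z)
        + (1 + η⁻¹) * (Fintype.card ι * (M * (a n / √(n : ℝ))) ^ 2) := by
      have := quadForm_add_le z (Z n v - z) hη
      rw [add_sub_cancel] at this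
      refine this.trans ?_
      gcongr
      exact (dotProduct_self_le _).trans (by gcongr; exact hZB v hv)
    have e3 : (n : ℝ) / a n ^ 2 * ((1 + η⁻¹) * (Fintype.card ι * (M * (a n / √(n : ℝ))) ^ 2))
        = (1 + η⁻¹) * (Fintype.card ι * M ^ 2) := by
      rw [mul_pow, div_pow, Real.sq_sqrt hn0'.le]
      field_simp
    have e4 : (n : ℝ) * quadForm (A q) (v - q)
        ≤ n / a n ^ 2 * ((1 + η) * (z ⬝ᵥ z)) + (1 + η⁻¹) * (Fintype.card ι * M ^ 2) := by
      rw [e1, ← e3, ← mul_add]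
      gcongr
    have e5 := mul_le_mul_of_nonneg_left e4 (show 0 ≤ 1 / 2 + η by positivity)
    have e6 := mul_le_mul_of_nonneg_left (abs_le.1 he).2 hn0'.le
    rw [hD]
    linarith
  calc ENNReal.ofReal (c₀ * Real.exp (-D) * 2 ^ Fintype.card ι * laplaceScale ι Φ₀ n
        * Real.exp (-((1 / 2 + η) * (1 + η) * (z ⬝ᵥ z) * (n / a n ^ 2))))
      = ENNReal.ofReal (c₀ * Real.exp (-D) * Real.exp (-n * Φ₀)
        * Real.exp (-((1 / 2 + η) * (1 + η) * (z ⬝ᵥ z) * (n / a n ^ 2)))) * volume B := by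
        rw [hB, Real.volume_pi_ball _ (by positivity), ← ENNReal.ofReal_mul (by positivity),
          laplaceScale, mul_pow, inv_pow]
        congr 1
        ring
    _ = ∫⁻ _v in B, ENNReal.ofReal (c₀ * Real.exp (-D) * Real.exp (-n * Φ₀)
        * Real.exp (-((1 / 2 + η) * (1 + η) * (z ⬝ᵥ z) * (n / a n ^ 2)))) := (setLIntegral_const _ _).symm
    _ ≤ ∫⁻ v in B, ENNReal.ofReal (Real.exp (-n * Φ v) * g v) :=
      setLIntegral_mono' Metric.isOpen_ball.measurableSet key
    _ ≤ _ := lintegral_mono_set (subset_inter (fun v hv => (hball v (hmem v hv)).1.1.1)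
      fun v hv => (hZB v hv).trans_lt hn2)

lemma laplaceScale_pos {n : ℕ} (hn : 0 < n) : 0 < laplaceScale ι Φ₀ n := by
  have : 0 < √(n : ℝ) := Real.sqrt_pos.2 (by exact_mod_cast hn)
  unfold laplaceScale
  positivity

/-- Take `z = 0` in the lower bound and `r = 0` in the upper bound. -/
lemma LaplaceSetup.mass_univ (h : LaplaceSetup Ω Φ g S Φ₀ A) (ha : Tendsto a atTop atTop)
    (ha' : a =o[atTop] fun n : ℕ => √(n : ℝ))
    (hZ : ∀ q ∈ S, ∀ᶠ v in 𝓝 q, ∀ n, Z n v = a n • (A q).mulVec (v - q)) :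
    ∃ c > 0, ∃ K > 0, ∀ᶠ n : ℕ in atTop,
      ENNReal.ofReal (c * laplaceScale ι Φ₀ n) ≤ laplaceMass Ω Φ g n univ ∧
      laplaceMass Ω Φ g n univ ≤ ENNReal.ofReal (K * laplaceScale ι Φ₀ n) := by
  obtain ⟨c, hc, h1⟩ := h.le_mass ha ha' hZ one_pos 0 one_pos
  obtain ⟨K, hK, h2⟩ := h.mass_le ha hZ (η := 1 / 8) (by norm_num) (by norm_num)
  refine ⟨c, hc, K, hK, ?_⟩
  filter_upwards [h1, h2 0 le_rfl] with n hn1 hn2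
  constructor
  · refine le_trans (le_of_eq ?_) (hn1.trans (laplaceMass_mono n (subset_univ _)))
    simp
  · refine (laplaceMass_mono n fun v _ => ?_).trans (hn2.trans (le_of_eq ?_))
    · change 2 * (0 : ℝ) ≤ Z n v ⬝ᵥ Z n v
      rw [mul_zero]
      exact dotProduct_self_nonneg _
    · simp

lemma LaplaceSetup.mass_univ_ne (h : LaplaceSetup Ω Φ g S Φ₀ A) (ha : Tendsto a atTop atTop)
    (ha' : a =o[atTop] fun n : ℕ => √(n : ℝ))
    (hZ : ∀ q ∈ S, ∀ᶠ v in 𝓝 q, ∀ n, Z n v = a n • (A q).mulVec (v - q)) :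
    ∀ᶠ n in atTop, laplaceMass Ω Φ g n univ ≠ 0 ∧ laplaceMass Ω Φ g n univ ≠ ⊤ := by
  obtain ⟨c, hc, K, hK, h1⟩ := h.mass_univ ha ha' hZ
  filter_upwards [h1, eventually_gt_atTop 0] with n hn hn0
  refine ⟨fun h0 => ?_, ne_top_of_le_ne_top ENNReal.ofReal_ne_top hn.2⟩
  have h2 := hn.1
  rw [h0, nonpos_iff_eq_zero, ENNReal.ofReal_eq_zero] at h2
  exact absurd h2 (not_le.2 (mul_pos hc (laplaceScale_pos hn0)))

/-- The upper bound of the moderate deviations principle. -/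
lemma LaplaceSetup.mass_upper (h : LaplaceSetup Ω Φ g S Φ₀ A) (ha : Tendsto a atTop atTop)
    (ha' : a =o[atTop] fun n : ℕ => √(n : ℝ))
    (hZ : ∀ q ∈ S, ∀ᶠ v in 𝓝 q, ∀ n, Z n v = a n • (A q).mulVec (v - q)) {r ε : ℝ}
    (hr : 0 ≤ r) (hε : 0 < ε) :
    ∀ᶠ n : ℕ in atTop, laplaceMass Ω Φ g n {v | 2 * r ≤ Z n v ⬝ᵥ Z n v}
      ≤ ENNReal.ofReal (Real.exp (-((r - ε) * (n / a n ^ 2)))) * laplaceMass Ω Φ g n univ := by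
  obtain ⟨c, hc, K₀, -, h1⟩ := h.mass_univ ha ha' hZ
  -- This makes the loss `4 * η * r` at most `ε / 2`; the other `ε / 2` absorbs the quotient of the
  -- constants.
  set η := min (1 / 8) (ε / (8 * (r + 1))) with hη
  have hη0 : 0 < η := by positivity
  have hη1 : η < 1 / 4 := (min_le_left _ _).trans_lt (by norm_num)
  have hη2 : 4 * η * r ≤ ε / 2 := by
    have : η * (8 * (r + 1)) ≤ ε := (le_div_iff₀ (by positivity)).1 (min_le_right _ _)
    nlinarith
  obtain ⟨K, hK, h2⟩ := h.mass_le ha hZ hη0 hη1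
  have hb := tendsto_speed ha ha'
  have h3 : Tendsto (fun n : ℕ => c * Real.exp (ε / 2 * (n / a n ^ 2))) atTop atTop :=
    (Real.tendsto_exp_atTop.comp (hb.const_mul_atTop (by positivity))).const_mul_atTop hc
  filter_upwards [h1, h2 r hr, h3.eventually_ge_atTop K, eventually_gt_atTop 0,
    hb.eventually_ge_atTop 0] with n hn1 hn2 hn3 hn0 hbn
  have hs := laplaceScale_pos (ι := ι) (Φ₀ := Φ₀) hn0
  refine hn2.trans (le_trans ?_ (mul_le_mul_right hn1.1 _))
  rw [← ENNReal.ofReal_mul (Real.exp_pos _).le]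
  refine ENNReal.ofReal_le_ofReal ?_
  calc K * laplaceScale ι Φ₀ n * Real.exp (-((1 - 4 * η) * (r * (n / a n ^ 2))))
      ≤ c * Real.exp (ε / 2 * (n / a n ^ 2)) * laplaceScale ι Φ₀ n
        * Real.exp (-((1 - 4 * η) * (r * (n / a n ^ 2)))) := by gcongr
    _ = Real.exp (ε / 2 * (n / a n ^ 2) + -((1 - 4 * η) * (r * (n / a n ^ 2))))
        * (c * laplaceScale ι Φ₀ n) := by rw [Real.exp_add]; ring
    _ ≤ _ := by
      gcongr
      have := mul_le_mul_of_nonneg_right hη2 hbn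
      linarith

/-- The lower bound of the moderate deviations principle. -/
lemma LaplaceSetup.mass_lower (h : LaplaceSetup Ω Φ g S Φ₀ A) (ha : Tendsto a atTop atTop)
    (ha' : a =o[atTop] fun n : ℕ => √(n : ℝ))
    (hZ : ∀ q ∈ S, ∀ᶠ v in 𝓝 q, ∀ n, Z n v = a n • (A q).mulVec (v - q)) (z : ι → ℝ) {ρ ε : ℝ}
    (hρ : 0 < ρ) (hε : 0 < ε) :
    ∀ᶠ n : ℕ in atTop,
      ENNReal.ofReal (Real.exp (-((z ⬝ᵥ z / 2 + ε) * (n / a n ^ 2)))) * laplaceMass Ω Φ g n univ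
      ≤ laplaceMass Ω Φ g n {v | ‖Z n v - z‖ < ρ} := by
  obtain ⟨c₀, -, K, hK, h1⟩ := h.mass_univ ha ha' hZ
  have hz : 0 ≤ z ⬝ᵥ z := dotProduct_self_nonneg z
  -- For `η ≤ 1` the coefficient `(1 / 2 + η) * (1 + η)` exceeds `1 / 2` by at most `5 / 2 * η`, a
  -- loss below `ε / 2`; the rest of `ε` absorbs the constants.
  set η := min 1 (ε / (8 * (z ⬝ᵥ z + 1))) with hη
  have hη0 : 0 < η := by positivity
  have hη1 : η ≤ 1 := min_le_left _ _
  have hη2 : (1 / 2 + η) * (1 + η) * (z ⬝ᵥ z) ≤ z ⬝ᵥ z / 2 + ε / 2 := by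
    have h1 : η * (8 * (z ⬝ᵥ z + 1)) ≤ ε := (le_div_iff₀ (by positivity)).1 (min_le_right _ _)
    have h2 : η * η * (z ⬝ᵥ z) ≤ η * 1 * (z ⬝ᵥ z) := by gcongr
    nlinarith
  obtain ⟨c, hc, h2⟩ := h.le_mass ha ha' hZ hη0 z hρ
  have hb := tendsto_speed ha ha'
  have h3 : Tendsto (fun n : ℕ => c * Real.exp (ε / 2 * (n / a n ^ 2))) atTop atTop :=
    (Real.tendsto_exp_atTop.comp (hb.const_mul_atTop (by positivity))).const_mul_atTop hc
  filter_upwards [h1, h2, h3.eventually_ge_atTop K, eventually_gt_atTop 0,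
    hb.eventually_ge_atTop 0] with n hn1 hn2 hn3 hn0 hbn
  have hs := laplaceScale_pos (ι := ι) (Φ₀ := Φ₀) hn0
  refine le_trans (mul_le_mul_right hn1.2 _) (le_trans ?_ hn2)
  rw [← ENNReal.ofReal_mul (Real.exp_pos _).le]
  refine ENNReal.ofReal_le_ofReal ?_
  calc Real.exp (-((z ⬝ᵥ z / 2 + ε) * (n / a n ^ 2))) * (K * laplaceScale ι Φ₀ n)
      ≤ Real.exp (-((z ⬝ᵥ z / 2 + ε) * (n / a n ^ 2)))
        * (c * Real.exp (ε / 2 * (n / a n ^ 2)) * laplaceScale ι Φ₀ n) := by gcongr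
    _ = c * laplaceScale ι Φ₀ n
        * Real.exp (-((z ⬝ᵥ z / 2 + ε) * (n / a n ^ 2)) + ε / 2 * (n / a n ^ 2)) := by
        rw [Real.exp_add]; ring
    _ ≤ _ := by
      gcongr
      have := mul_le_mul_of_nonneg_right hη2 hbn
      linarith

end Laplace

/-! ## The energy at the limit points -/

section LimitPoints

variable {E : Support} {C : Constraint} {V : ℕ → ℝ → ℝ} {l : ℕ}

lemma Generic.contDiffAt_energy (hl : C.top ≤ l) (hV : Generic E C V) {u : Free C l → ℝ}
    (hu : u ∈ freeDomain E C l) : ContDiffAt ℝ 2 (energy E C V l) u := by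
  refine ContDiffAt.sum fun i _ => ?_
  have hm := momentsOfFree_mem hu
  have h1 := (contDiffAt_coords (r := 2) hm.2 (j := i + 1) (by omega) (by omega)).comp u
    (contDiffAt_momentsOfFree hl hu)
  exact (hV.contDiffAt_effPotential (by omega) (coords_mem hm i)).comp u h1

/-- Growth in each coordinate separately is enough, as the supremum norm is attained at some
coordinate. -/
lemma quadraticGrowth_pi {ι : Type*} [Fintype ι] {f : (ι → ℝ) → ℝ} {x : ι → ℝ}
    (h : ∀ j, ∃ c > 0, ∀ᶠ y in 𝓝 x, f x + c * (y j - x j) ^ 2 ≤ f y) : QuadraticGrowth f x := by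
  choose c hc h using h
  rcases isEmpty_or_nonempty ι with hι | hι
  · exact ⟨1, one_pos, Eventually.of_forall fun y => by simp [Subsingleton.elim y x]⟩
  obtain ⟨j₀, hj₀⟩ := Finite.exists_min c
  refine ⟨c j₀, hc j₀, ?_⟩
  filter_upwards [eventually_all.2 h] with y hy
  obtain ⟨j, hj⟩ : ∃ j, ‖y - x‖ = |y j - x j| := by
    obtain ⟨j, hj⟩ := Finite.exists_max fun j => |y j - x j|
    refine ⟨j, le_antisymm ((pi_norm_le_iff_of_nonneg (abs_nonneg _)).2 hj) (norm_le_pi_norm (y - x) j)⟩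
  rw [hj, sq_abs]
  exact le_trans (by gcongr; exact hj₀ j) (hy j)

lemma coords_momentsOfFree {u : Free C l → ℝ} (hu : u ∈ freeDomain E C l) (j : Free C l) :
    coords E (momentsOfFree E C l u) (j.1 + 1) = u j :=
  congrFun (freeCoords_momentsOfFree hu) j

lemma energy_eq_split (hl : C.top ≤ l) {u : Free C l → ℝ} (hu : u ∈ freeDomain E C l) :
    energy E C V l u
      = energy E C V C.top (freeCoords E C (firstMoments C.top (momentsOfFree E C l u)))
        + ∑ i : Fin l, if C.top < (i : ℕ) + 1 then
            effPotential E C V (i + 1) (coords E (momentsOfFree E C l u) (i + 1)) else 0 := by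
  have hm := momentsOfFree_mem hu
  rw [energy_freeCoords le_rfl (firstMoments_mem_relInterior le_rfl hl hm), ← momentEnergy_split hl hm]
  rfl

/-- The energy is a block term plus separate terms `W_j`, all minimal at the limit point. Growth in
a given coordinate thus follows from the one term containing it: the Hessian condition for the
block, the second derivative of `W_j` beyond it. -/
lemma Generic.quadraticGrowth_energy (hl : C.top ≤ l) (hV : Generic E C V) {m : Fin l → ℝ}
    (hm : m ∈ limitPoints E C V l) : QuadraticGrowth (energy E C V l) (freeCoords E C m) := by
  obtain ⟨hm1, hm2, hm3⟩ := hm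
  have hu₀ := freeCoords_mem_freeDomain hm1
  have hmo := momentsOfFree_freeCoords hl hm1
  have hterm : ∀ u ∈ freeDomain E C l, ∀ i : Fin l,
      (if C.top < (i : ℕ) + 1 then effPotential E C V (i + 1) (coords E m (i + 1)) else 0)
      ≤ if C.top < (i : ℕ) + 1 then
          effPotential E C V (i + 1) (coords E (momentsOfFree E C l u) (i + 1)) else 0 := by
    intro u hu i
    split_ifs with hi
    · exact (hm3 i hi).2 _ (coords_mem (momentsOfFree_mem hu) i)
    · exact le_rfl
  have hblock : ∀ u ∈ freeDomain E C l, freeCoords E C (firstMoments C.top (momentsOfFree E C l u))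
      ∈ freeDomain E C C.top := fun u hu =>
    freeCoords_mem_freeDomain (firstMoments_mem_relInterior le_rfl hl (momentsOfFree_mem hu))
  refine quadraticGrowth_pi fun j => ?_
  rcases lt_or_ge C.top ((j.1 : ℕ) + 1) with hj | hj
  · obtain ⟨c, hc, h⟩ := quadraticGrowth_of_iteratedDeriv
      (hV.contDiffAt_effPotential (by omega) (hm3 j.1 hj).1)
      (by
        filter_upwards [(isOpen_coordDomain E _).mem_nhds (hm3 j.1 hj).1] with t ht
        exact (hm3 j.1 hj).2 t ht)
      (hV.nondegenerate_minimizer hj (hm3 j.1 hj))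
    refine ⟨c, hc, ?_⟩
    have hj' : Tendsto (fun u : Free C l → ℝ => u j) (𝓝 (freeCoords E C m))
      (𝓝 (canonicalVec E m j.1)) := (continuous_apply j).tendsto _
    filter_upwards [hj'.eventually h, (isOpen_freeDomain hl).mem_nhds hu₀] with u hu hud
    rw [energy_eq_split hl hu₀, energy_eq_split hl hud, hmo, add_assoc]
    refine add_le_add (hm2.2 _ (hblock u hud)) ?_
    have hsum := Finset.sum_le_sum fun i (_ : i ∈ Finset.univ.erase j.1) => hterm u hud i
    have e₁ := Finset.add_sum_erase Finset.univ (fun i : Fin l => if C.top < (i : ℕ) + 1 then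
      effPotential E C V (i + 1) (coords E m (i + 1)) else 0) (Finset.mem_univ j.1)
    have e₂ := Finset.add_sum_erase Finset.univ (fun i : Fin l => if C.top < (i : ℕ) + 1 then
      effPotential E C V (i + 1) (coords E (momentsOfFree E C l u) (i + 1)) else 0)
      (Finset.mem_univ j.1)
    simp only [if_pos hj] at e₁ e₂
    rw [coords_momentsOfFree hud j] at e₂
    rw [← e₁, ← e₂, add_right_comm]
    refine add_le_add ?_ hsum
    rw [Real.norm_eq_abs, sq_abs] at hu
    exact hu
  · obtain ⟨c, hc, h⟩ := quadraticGrowth_of_hessian_det_ne_zero (hV.contDiffAt_energy le_rfl hm2.1)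
      (by
        filter_upwards [(isOpen_freeDomain le_rfl).mem_nhds hm2.1] with t ht
        exact hm2.2 t ht)
      (hV.nondegenerate_block _ hm2)
    refine ⟨c, hc, ?_⟩
    have hR : ∀ u ∈ freeDomain E C l, freeCoords E C (firstMoments C.top (momentsOfFree E C l u))
        = fun i : Free C C.top => u ⟨Fin.castLE hl i.1, i.2⟩ := by
      intro u hu
      ext i
      rw [← coords_momentsOfFree hu]
      exact coords_firstMoments hl (momentsOfFree_mem hu) (by omega) (by omega)
    have hR₀ := hR _ hu₀
    rw [hmo] at hR₀
    have hcont : Tendsto (fun (u : Free C l → ℝ) (i : Free C C.top) => u ⟨Fin.castLE hl i.1, i.2⟩)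
        (𝓝 (freeCoords E C m)) (𝓝 (freeCoords E C (firstMoments C.top m))) := by
      rw [hR₀]
      exact Continuous.tendsto (by fun_prop) _
    filter_upwards [hcont.eventually h, (isOpen_freeDomain hl).mem_nhds hu₀] with u hu hud
    rw [energy_eq_split hl hu₀, energy_eq_split hl hud, hmo, hR u hud, add_right_comm]
    refine add_le_add (le_trans ?_ hu) (Finset.sum_le_sum fun i _ => hterm u hud i)
    rw [← sq_abs, hR₀]
    refine add_le_add_right (mul_le_mul_of_nonneg_left (pow_le_pow_left₀ (abs_nonneg _) ?_ 2) hc.le) _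
    exact norm_le_pi_norm ((fun i : Free C C.top => u ⟨Fin.castLE hl i.1, i.2⟩)
      - fun i : Free C C.top => freeCoords E C m ⟨Fin.castLE hl i.1, i.2⟩) ⟨⟨j.1, hj⟩, j.2⟩

/-- The energy as a function of the free moments. -/
noncomputable def freeEnergy (E : Support) (C : Constraint) (V : ℕ → ℝ → ℝ) (l : ℕ)
    (v : Free C l → ℝ) : ℝ :=
  momentEnergy E C V (fill C l v)

/-- The subexponential part of the density of the free moments. -/
noncomputable def inverseWeight (E : Support) (C : Constraint) (l : ℕ) (v : Free C l → ℝ) : ℝ :=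
  (coordWeight E (coords E (fill C l v)) (l + 1) ^ l)⁻¹

/-- The standardizing matrix acting on the free moments. -/
noncomputable def freeStandardizer (E : Support) (C : Constraint) (V : ℕ → ℝ → ℝ) (l : ℕ)
    (m : Fin l → ℝ) : Matrix (Free C l) (Free C l) ℝ :=
  matrixSqrt (hessian (energy E C V l) (freeCoords E C m)) *
    jacobian (fun u => freeCoords E C (fill C l u)) (freePart C m)

lemma coordWeight_coords_pos {m : Fin l → ℝ} (hm : m ∈ relInterior E C l) :
    0 < coordWeight E (coords E m) (l + 1) :=
  coordWeight_pos (coords_of_mem_interior hm.2).1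

/-- The logarithms in the `W_j` add up to that of the Jacobian weight of the next moment. -/
lemma momentEnergy_eq {m : Fin l → ℝ} (hm : m ∈ relInterior E C l) :
    momentEnergy E C V m = ∑ i : Fin l, extendPotential C.top V (i + 1) (coords E m (i + 1))
      - Real.log (coordWeight E (coords E m) (l + 1)) := by
  have h : Real.log (coordWeight E (coords E m) (l + 1))
      = ∑ i : Fin l, Real.log (coordFactor E (i + 1) (coords E m (i + 1))) := by
    rw [coordWeight, Real.log_prod fun i hi => ?_]
    · rw [Finset.sum_Ico_eq_sum_range, Nat.add_sub_cancel, Finset.sum_range]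
      simp only [add_comm 1]
    · have := Finset.mem_Ico.1 hi
      exact (coordFactor_pos ((coords_of_mem_interior hm.2).1 i this.1 (by omega))).ne'
  rw [h, ← Finset.sum_sub_distrib]
  exact Finset.sum_congr rfl fun i _ => effPotential_eq E C V _ _

/-- The `n`-th power of the weight enters the exponent, leaving the `n`-independent amplitude
`inverseWeight`. -/
lemma momentDensity_fill {n : ℕ} (hn : l ≤ n) {v : Free C l → ℝ} (hv : v ∈ freeRegion E C l) :
    momentDensity E (extendPotential C.top V) n (fill C l v)
      = Real.exp (-n * freeEnergy E C V l v) * inverseWeight E C l v := by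
  have hw := coordWeight_coords_pos hv
  rw [momentDensity, freeEnergy, inverseWeight, momentEnergy_eq hv, mul_sub, Real.exp_sub, neg_mul,
    neg_mul, Real.exp_neg (_ * Real.log _), ← Real.rpow_natCast _ (n - l), mul_comm (n : ℝ) (Real.log _),
    Real.exp_mul, Real.exp_log hw, Real.rpow_natCast, Real.rpow_natCast, div_inv_eq_mul, mul_assoc,
    pow_sub₀ _ hw.ne' hn]

lemma lintegral_restrictedDensity_fill (hl : C.top ≤ l) {n : ℕ} (hn : l ≤ n) {A : Set (Fin l → ℝ)}
    (hA : MeasurableSet A) :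
    ∫⁻ v, restrictedDensity E C (extendPotential C.top V) A n (fill C l v)
      = laplaceMass (freeRegion E C l) (freeEnergy E C V l) (inverseWeight E C l) n (fill C l ⁻¹' A) := by
  have hm : MeasurableSet (freeRegion E C l ∩ fill C l ⁻¹' A) :=
    (isOpen_freeRegion hl).measurableSet.inter ((contDiff_fill (r := 0)).continuous.measurable hA)
  rw [laplaceMass, ← lintegral_indicator hm]
  refine lintegral_congr fun v => ?_
  by_cases hv : v ∈ freeRegion E C l ∩ fill C l ⁻¹' A
  · rw [indicator_of_mem hv, restrictedDensity, indicator_of_mem, momentDensity_fill hn hv.1]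
    refine ⟨hv.1, ?_⟩
    rw [mem_preimage, firstMoments_self]
    exact hv.2
  · rw [indicator_of_notMem hv, restrictedDensity, indicator_of_notMem]
    intro h
    refine hv ⟨h.1, ?_⟩
    have := h.2
    rwa [mem_preimage, firstMoments_self] at this

lemma norm_le_norm_fill (v : Free C l → ℝ) : ‖v‖ ≤ ‖fill C l v‖ := by
  refine (pi_norm_le_iff_of_nonneg (norm_nonneg _)).2 fun i => ?_
  rw [← fill_of_notMem v i.2]
  exact norm_le_pi_norm _ _

lemma Generic.exists_inverseWeight_le (hV : Generic E C V) :
    ∃ K > 0, ∀ v ∈ freeRegion E C l,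
      inverseWeight E C l v ≤ K * Real.exp (l * freeEnergy E C V l v) := by
  obtain ⟨ε, hε, B, hB⟩ := hV.exists_lower_bound
  refine ⟨Real.exp (l * -(l * B)), Real.exp_pos _, fun v hv => ?_⟩
  have hw := coordWeight_coords_pos hv
  have hsum : (l : ℝ) * B ≤ ∑ i : Fin l, extendPotential C.top V (i + 1) (coords E (fill C l v) (i + 1)) := by
    have : ∑ _i : Fin l, B ≤ ∑ i : Fin l, extendPotential C.top V (i + 1) (coords E (fill C l v) (i + 1)) := by
      refine Finset.sum_le_sum fun i _ => ?_
      have h1 := (hB (i + 1) (by omega) _ (coords_mem hv i)).1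
      have h2 : 0 ≤ Real.log (1 + |coords E (fill C l v) (i + 1)|) :=
        Real.log_nonneg (by linarith [abs_nonneg (coords E (fill C l v) (i + 1))])
      nlinarith
    simpa using this
  -- The reciprocal weight is `exp (Φ - ∑ V_j)`, and the potentials are bounded below.
  rw [← Real.exp_add, inverseWeight, ← Real.exp_log hw, ← Real.exp_nat_mul, ← Real.exp_neg,
    Real.exp_le_exp, freeEnergy, momentEnergy_eq hv, ← mul_add, ← mul_neg]
  gcongr
  linarith

/-- Since `exp (-κ Φ)` is at most a multiple of `(1 + ‖v‖)⁻¹`, taking `N / κ` larger than the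
dimension gives integrability. The additional `l` copies of `Φ` pay for `inverseWeight`. -/
lemma Generic.integrable_density (hl : C.top ≤ l) (hV : Generic E C V) :
    ∃ N : ℕ, ∫⁻ v in freeRegion E C l, ENNReal.ofReal
      (Real.exp (-N * freeEnergy E C V l v) * inverseWeight E C l v) ≠ ⊤ := by
  obtain ⟨κ, hκ, A, hA, hnorm⟩ := hV.exists_norm_le_exp_energy (l := l)
  obtain ⟨K, hK, hinv⟩ := hV.exists_inverseWeight_le (l := l)
  set d : ℝ := ((Module.finrank ℝ (Free C l → ℝ) : ℕ) : ℝ)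
  obtain ⟨N, hN⟩ := exists_nat_gt (κ * d)
  set p : ℝ := N / κ with hp
  have hdp : d < p := by rwa [hp, lt_div_iff₀ hκ, mul_comm]
  have hp0 : 0 ≤ p := by positivity
  refine ⟨N + l, ?_⟩
  have hint : Integrable fun v : Free C l → ℝ => K * A ^ p * (1 + ‖v‖) ^ (-p) :=
    (integrable_one_add_norm hdp).const_mul _
  refine ne_top_of_le_ne_top hint.lintegral_lt_top.ne
    ((setLIntegral_mono' (isOpen_freeRegion hl).measurableSet fun v hv => ?_).trans
      (setLIntegral_le_lintegral _ _))
  refine ENNReal.ofReal_le_ofReal ?_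
  have h1 : Real.exp (-(κ * freeEnergy E C V l v)) ≤ A * (1 + ‖v‖)⁻¹ := by
    rw [Real.exp_neg, ← div_eq_mul_inv, le_div_iff₀ (by positivity), inv_mul_le_iff₀ (Real.exp_pos _),
      mul_comm]
    exact (by gcongr; exact norm_le_norm_fill v : 1 + ‖v‖ ≤ 1 + ‖fill C l v‖).trans (hnorm _ hv)
  calc Real.exp (-((N + l : ℕ) : ℝ) * freeEnergy E C V l v) * inverseWeight E C l v
      ≤ Real.exp (-((N + l : ℕ) : ℝ) * freeEnergy E C V l v)
        * (K * Real.exp (l * freeEnergy E C V l v)) := by gcongr; exact hinv v hv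
    _ = K * Real.exp (-(κ * freeEnergy E C V l v)) ^ p := by
      rw [mul_left_comm, ← Real.exp_add, ← Real.exp_mul, hp]
      congr 2
      push_cast
      field_simp
      ring
    _ ≤ K * (A * (1 + ‖v‖)⁻¹) ^ p := by gcongr
    _ = _ := by
      rw [Real.mul_rpow hA.le (by positivity), Real.inv_rpow (by positivity), ← Real.rpow_neg (by positivity),
        mul_assoc]

lemma continuousAt_inverseWeight {v : Free C l → ℝ} (hv : v ∈ freeRegion E C l) :
    ContinuousAt (inverseWeight E C l) v := by
  refine ContinuousAt.inv₀ ?_ (pow_pos (coordWeight_coords_pos hv) l).ne'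
  -- With zero potentials and `n = l + l`, `momentDensity` is just the `l`-th power of the weight.
  have h := (continuousAt_momentDensity (E := E) (U := fun _ _ => 0) (fun _ _ => continuousOn_const)
    (l + l) hv.2).comp (f := fill C l) (contDiff_fill (r := 0)).continuous.continuousAt
  simpa [Function.comp_def, momentDensity] using h

/-- Laplace's method applies to the law of the free moments. -/
lemma Generic.laplaceSetup (hl : C.top ≤ l) (hV : Generic E C V) {p : Fin l → ℝ}
    (hp : p ∈ limitPoints E C V l) :
    LaplaceSetup (freeRegion E C l) (freeEnergy E C V l) (inverseWeight E C l)
      (freePart C '' limitPoints E C V l) (momentEnergy E C V p)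
      fun q => freeStandardizer E C V l (fill C l q) where
  measurableSet := (isOpen_freeRegion hl).measurableSet
  finite := (finite_limitPoints hl hV).image _
  nonempty := ⟨_, p, hp, rfl⟩
  injective := by
    rintro _ ⟨m, hm, rfl⟩
    have hq := freePart_mem_freeRegion hl hm.1
    have hfill := fill_freePart hl hm.1
    have h := eventually_abs_comp_sub_le (f := energy E C V l)
      (F := fun u => freeCoords E C (fill C l u)) (v := freePart C m)
      (by rw [hfill]; exact hV.contDiffAt_energy hl (freeCoords_mem_freeDomain hm.1))
      (by rw [hfill]; exact hV.quadraticGrowth_energy hl hm)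
      ((contDiffAt_freeCoords_fill (r := 1) hl hq).differentiableAt one_ne_zero)
      (jacobian_mulVec_injective hl hq)
    rw [freeStandardizer, freePart_fill]
    exact h.1
  expansion := by
    rintro _ ⟨m, hm, rfl⟩ η hη
    have hq := freePart_mem_freeRegion hl hm.1
    have hfill := fill_freePart hl hm.1
    have h := eventually_abs_comp_sub_le (f := energy E C V l)
      (F := fun u => freeCoords E C (fill C l u)) (v := freePart C m)
      (by rw [hfill]; exact hV.contDiffAt_energy hl (freeCoords_mem_freeDomain hm.1))
      (by rw [hfill]; exact hV.quadraticGrowth_energy hl hm)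
      ((contDiffAt_freeCoords_fill (r := 1) hl hq).differentiableAt one_ne_zero)
      (jacobian_mulVec_injective hl hq)
    have hpm : momentEnergy E C V p = energy E C V l (freeCoords E C (fill C l (freePart C m))) := by
      rw [hfill, energy_freeCoords hl hm.1]
      exact le_antisymm (momentEnergy_le_of_mem_limitPoints hl hp hm.1)
        (momentEnergy_le_of_mem_limitPoints hl hm hp.1)
    filter_upwards [(isOpen_freeRegion hl).mem_nhds hq, h.2 η hη] with v hv hv'
    refine ⟨hv, ?_⟩
    rw [energy_freeCoords hl hv] at hv'
    rw [freeEnergy, hpm, freeStandardizer, freePart_fill]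
    exact hv'
  bounds := by
    rintro _ ⟨m, hm, rfl⟩
    have hq := freePart_mem_freeRegion hl hm.1
    have hc := continuousAt_inverseWeight hq
    have hpos : 0 < inverseWeight E C l (freePart C m) :=
      inv_pos.2 (pow_pos (coordWeight_coords_pos hq) l)
    refine ⟨_, half_pos hpos, inverseWeight E C l (freePart C m) + 1, ?_⟩
    filter_upwards [hc.eventually (lt_mem_nhds (half_lt_self hpos)),
      hc.eventually (gt_mem_nhds (lt_add_one _))] with v h1 h2
    exact ⟨h1.le, h2.le⟩
  gap := by
    intro U hU hSU
    obtain ⟨δ, hδ, h⟩ := hV.exists_energy_gap hl hp (U := freePart C ⁻¹' U)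
      (hU.preimage (continuous_pi fun i => continuous_apply i.1))
      fun m hm => hSU ⟨m, hm, rfl⟩
    refine ⟨δ, hδ, fun v hv hvU => h _ hv ?_⟩
    rwa [mem_preimage, freePart_fill]
  integrable := hV.integrable_density hl

end LimitPoints

/-! ## The rate function -/

section Rate

variable {C : Constraint} {l : ℕ}

lemma continuous_euclNorm : Continuous (euclNorm : (Fin l → ℝ) → ℝ) :=
  (PiLp.continuous_toLp 2 _).norm

lemma euclNorm_sq (x : Fin l → ℝ) : euclNorm x ^ 2 = ∑ i, x i ^ 2 := by
  rw [euclNorm, EuclideanSpace.norm_sq_eq]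
  simp

lemma euclNorm_pos {x : Fin l → ℝ} (hx : x ≠ 0) : 0 < euclNorm x := by
  rw [euclNorm, norm_pos_iff]
  simpa using hx

lemma norm_le_euclNorm (x : Fin l → ℝ) : ‖x‖ ≤ euclNorm x := by
  refine (pi_norm_le_iff_of_nonneg (norm_nonneg _)).2 fun i => ?_
  exact PiLp.norm_apply_le (WithLp.toLp 2 x) i

lemma euclNorm_sq_eq_dotProduct {x : Fin l → ℝ} (hx : ∀ i : Fin l, (i : ℕ) + 1 ∈ C.idx → x i = 0) :
    euclNorm x ^ 2 = freePart C x ⬝ᵥ freePart C x := by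
  rw [euclNorm_sq, dotProduct, ← Finset.sum_filter_of_ne (p := fun i : Fin l => (i : ℕ) + 1 ∉ C.idx)
    fun i _ h hi => h (by rw [hx i hi]; norm_num), Finset.sum_subtype (p := fun i : Fin l => (i : ℕ) + 1 ∉ C.idx)
    _ (by simp)]
  exact Finset.sum_congr rfl fun i _ => sq (x i.1)

lemma gaussianRate_le_iff {α : NNReal} {x : Fin l → ℝ} : gaussianRate C l x ≤ α ↔
    (∀ i : Fin l, (i : ℕ) + 1 ∈ C.idx → x i = 0) ∧ euclNorm x ^ 2 / 2 ≤ α := by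
  rw [gaussianRate]
  split_ifs with h
  · rw [and_iff_right h, ← ENNReal.ofReal_coe_nnreal]
    exact ENNReal.ofReal_le_ofReal_iff α.2
  · simp [h]

lemma isClosed_gaussianRate_le (α : NNReal) : IsClosed {x | gaussianRate C l x ≤ α} := by
  simp only [gaussianRate_le_iff, Set.ofPred_and, Set.ofPred_forall]
  refine (isClosed_iInter fun i => isClosed_iInter fun _ =>
    isClosed_eq (continuous_apply i) continuous_const).inter ?_
  have := continuous_euclNorm (l := l)
  exact isClosed_le (by fun_prop) continuous_const

lemma lowerSemicontinuous_gaussianRate : LowerSemicontinuous (gaussianRate C l) := by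
  rw [lowerSemicontinuous_iff_isClosed_preimage]
  intro y
  induction y with
  | top => simp
  | coe α => exact isClosed_gaussianRate_le α

lemma isCompact_gaussianRate_le (α : NNReal) : IsCompact {x | gaussianRate C l x ≤ α} := by
  refine Metric.isCompact_of_isClosed_isBounded (isClosed_gaussianRate_le α)
    ((Metric.isBounded_closedBall (x := 0) (r := 2 * α + 1)).subset fun x hx => ?_)
  rw [mem_closedBall_zero_iff]
  have h := (gaussianRate_le_iff.1 hx).2
  refine (norm_le_euclNorm x).trans ?_
  nlinarith [sq_nonneg (euclNorm x - 1)]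

end Rate

/-! ## The fluctuations -/

section Fluctuation

variable {E : Support} {C : Constraint} {V : ℕ → ℝ → ℝ} {l : ℕ}

/-- Near `m` all other points of the finite set are strictly farther away. The neighbourhood is
independent of `n`, however ties are broken. -/
lemma IsNearestPointMap.eventually_eq {κ : Type*} {S : Set (Fin l → ℝ)} (hS : S.Finite)
    {sel : κ → (Fin l → ℝ) → (Fin l → ℝ)} (hsel : ∀ n, IsNearestPointMap S (sel n))
    {m : Fin l → ℝ} (hm : m ∈ S) : ∀ᶠ x in 𝓝 m, ∀ n, sel n x = m := by
  have h : ∀ y ∈ S, ∀ᶠ x in 𝓝 m, y ≠ m → euclNorm (x - m) < euclNorm (x - y) := by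
    intro y _
    by_cases hy : y = m
    · exact Eventually.of_forall fun x h => absurd hy h
    have hc : ∀ z : Fin l → ℝ, Continuous fun x => euclNorm (x - z) := fun z => by
      have := continuous_euclNorm (l := l)
      fun_prop
    have h1 := (hc m).tendsto m
    have h2 := (hc y).tendsto m
    have h0 : euclNorm (m - m) = 0 := by simp [euclNorm]
    rw [h0] at h1
    filter_upwards [h1.eventually_lt h2 (euclNorm_pos (sub_ne_zero.2 (Ne.symm hy)))] with x hx _
    exact hx
  filter_upwards [(eventually_all_finite hS).2 h] with x hx n
  by_contra hne
  exact absurd ((hsel n).2 x |>.2 m hm) (not_le.2 (hx _ ((hsel n).2 x).1 hne))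

lemma freePart_insertZeros_mulVec (A : Matrix (Free C l) (Free C l) ℝ) (x : Fin l → ℝ) :
    freePart C ((insertZeros C l A).mulVec x) = A.mulVec (freePart C x) := by
  ext i
  simp only [freePart, Matrix.mulVec, dotProduct]
  rw [← Finset.sum_filter_of_ne (p := fun j : Fin l => (j : ℕ) + 1 ∉ C.idx)
    (f := fun j => insertZeros C l A i.1 j * x j) fun j _ h hj => h (by simp [insertZeros, hj]),
    Finset.sum_subtype (p := fun j : Fin l => (j : ℕ) + 1 ∉ C.idx) _ (by simp)]
  refine Finset.sum_congr rfl fun j _ => ?_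
  rw [insertZeros, Matrix.of_apply, dif_pos ⟨i.2, j.2⟩]

lemma insertZeros_mulVec_apply_of_mem (A : Matrix (Free C l) (Free C l) ℝ) (x : Fin l → ℝ)
    {i : Fin l} (hi : (i : ℕ) + 1 ∈ C.idx) : (insertZeros C l A).mulVec x i = 0 := by
  simp only [Matrix.mulVec, dotProduct]
  exact Finset.sum_eq_zero fun j _ => by simp [insertZeros, hi]

lemma fluctuation_apply_of_mem (sel : (Fin l → ℝ) → (Fin l → ℝ)) (r : ℝ) (x : Fin l → ℝ)
    {i : Fin l} (hi : (i : ℕ) + 1 ∈ C.idx) : fluctuation E C V l sel r x i = 0 := by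
  rw [fluctuation, Pi.smul_apply, standardizer, insertZeros_mulVec_apply_of_mem _ _ hi, smul_zero]

lemma freePart_fluctuation (sel : (Fin l → ℝ) → (Fin l → ℝ)) (r : ℝ) (x : Fin l → ℝ) :
    freePart C (fluctuation E C V l sel r x)
      = r • (freeStandardizer E C V l (sel x)).mulVec (freePart C x - freePart C (sel x)) := by
  change r • freePart C ((standardizer E C V l (sel x)).mulVec (x - sel x)) = _
  rw [standardizer, freePart_insertZeros_mulVec]
  rfl

lemma measurable_fluctuation {S : Set (Fin l → ℝ)} (hS : S.Finite)
    {sel : (Fin l → ℝ) → (Fin l → ℝ)} (hsel : IsNearestPointMap S sel) (r : ℝ) :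
    Measurable (fluctuation E C V l sel r) := by
  -- Having finitely many values, `sel` is a simple function, so no regularity of `standardizer` is
  -- needed.
  let f : SimpleFunc (Fin l → ℝ) (Fin l → ℝ) :=
    ⟨sel, fun x => hsel.1 (measurableSet_singleton x),
      hS.subset (range_subset_iff.2 fun x => (hsel.2 x).1)⟩
  refine measurable_pi_iff.2 fun i => ?_
  change Measurable fun x => r * ∑ j, standardizer E C V l (sel x) i j * (x j - sel x j)
  refine Measurable.const_mul (Finset.measurable_fun_sum _ fun j _ => Measurable.mul ?_ ?_) r
  · exact (f.map fun m => standardizer E C V l m i j).measurable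
  · exact (measurable_pi_apply j).sub ((measurable_pi_apply j).comp hsel.1)

lemma eventually_freePart_fluctuation (hl : C.top ≤ l) (hV : Generic E C V) (a : ℕ → ℝ)
    {sel : ℕ → (Fin l → ℝ) → (Fin l → ℝ)}
    (hsel : ∀ n, IsNearestPointMap (limitPoints E C V l) (sel n)) :
    ∀ q ∈ freePart C '' limitPoints E C V l, ∀ᶠ v in 𝓝 q, ∀ n,
      freePart C (fluctuation E C V l (sel n) (a n) (fill C l v))
        = a n • (freeStandardizer E C V l (fill C l q)).mulVec (v - q) := by
  rintro _ ⟨m, hm, rfl⟩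
  have hfill := fill_freePart hl hm.1
  have hc : Tendsto (fill C l) (𝓝 (freePart C m)) (𝓝 m) := by
    have := (contDiff_fill (C := C) (n := l) (r := 0)).continuous.tendsto (freePart C m)
    rwa [hfill] at this
  filter_upwards [hc.eventually (IsNearestPointMap.eventually_eq (finite_limitPoints hl hV) hsel hm)]
    with v hv n
  rw [freePart_fluctuation, hv n, freePart_fill, hfill]

end Fluctuation

/-! ## The moderate deviations principle -/

section Deviations

variable {E : Support} {C : Constraint} {V : ℕ → ℝ → ℝ} {l : ℕ}

lemma log_ofReal_exp (x : ℝ) : ENNReal.log (ENNReal.ofReal (Real.exp x)) = x := by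
  rw [ENNReal.log_ofReal_of_pos (Real.exp_pos x), Real.log_exp]

lemma coe_le_log_div {b s : ℝ} (hb : 0 < b) {P : ENNReal} (h : ENNReal.ofReal (Real.exp (s * b)) ≤ P) :
    (s : EReal) ≤ ENNReal.log P / b := by
  rw [EReal.le_div_iff_mul_le (by exact_mod_cast hb) (EReal.coe_ne_top _), ← EReal.coe_mul,
    ← log_ofReal_exp]
  exact ENNReal.log_monotone h

lemma log_div_le_coe {b s : ℝ} (hb : 0 < b) {P : ENNReal} (h : P ≤ ENNReal.ofReal (Real.exp (s * b))) :
    ENNReal.log P / b ≤ (s : EReal) := by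
  rw [EReal.div_le_iff_le_mul (by exact_mod_cast hb) (EReal.coe_ne_top _), mul_comm, ← EReal.coe_mul,
    ← log_ofReal_exp]
  exact ENNReal.log_monotone h

/-- Reduction of a large deviations principle with Gaussian rate function to exponential bounds. -/
lemma satisfiesGoodLDP_gaussianRate {P : ℕ → Measure (Fin l → ℝ)} {b : ℕ → ℝ}
    (hP : ∀ᶠ n in atTop, IsProbabilityMeasure (P n)) (hb : Tendsto b atTop atTop)
    (hlower : ∀ x : Fin l → ℝ, (∀ i : Fin l, (i : ℕ) + 1 ∈ C.idx → x i = 0) → ∀ Γ, MeasurableSet Γ →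
      x ∈ interior Γ → ∀ ε > 0, ∀ᶠ n in atTop,
        ENNReal.ofReal (Real.exp (-(euclNorm x ^ 2 / 2 + ε) * b n)) ≤ P n Γ)
    (hupper : ∀ Γ, MeasurableSet Γ → ∀ r ≥ 0,
      (∀ x ∈ Γ, (∀ i : Fin l, (i : ℕ) + 1 ∈ C.idx → x i = 0) → r ≤ euclNorm x ^ 2 / 2) →
      ∀ ε > 0, ∀ᶠ n in atTop, P n Γ ≤ ENNReal.ofReal (Real.exp (-(r - ε) * b n))) :
    SatisfiesGoodLDP P b (gaussianRate C l) where
  isProbability := hP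
  speed := hb
  lowerSemicontinuous := lowerSemicontinuous_gaussianRate
  good := isCompact_gaussianRate_le
  lower := by
    intro Γ hΓ
    rw [EReal.neg_le]
    refine le_iInf₂ fun x hx => ?_
    rw [EReal.neg_le]
    by_cases h0 : ∀ i : Fin l, (i : ℕ) + 1 ∈ C.idx → x i = 0
    swap
    · rw [gaussianRate, if_neg h0]
      simp
    rw [gaussianRate, if_pos h0, EReal.coe_ennreal_ofReal, max_eq_left (by positivity)]
    refine le_of_forall_lt fun c hc => ?_
    obtain ⟨s, hs, hsx⟩ := EReal.lt_iff_exists_real_btwn.1 hc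
    have hlt : s < -(euclNorm x ^ 2 / 2) := by exact_mod_cast hsx
    refine hs.trans_le (le_liminf_of_le (by isBoundedDefault) ?_)
    filter_upwards [hlower x h0 Γ hΓ hx _ (sub_pos.2 hlt), hb.eventually_gt_atTop 0] with n hn hbn
    refine coe_le_log_div hbn (le_trans (le_of_eq ?_) hn)
    congr 3
    ring
  upper := by
    intro Γ hΓ
    rw [EReal.le_neg]
    refine le_of_forall_lt fun c hc => ?_
    obtain ⟨s', hs', hs'Γ⟩ := EReal.lt_iff_exists_real_btwn.1 hc
    obtain ⟨s, hs, hss'⟩ := EReal.lt_iff_exists_real_btwn.1 hs'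
    refine hs.trans_le ?_
    rw [EReal.le_neg, ← EReal.coe_neg]
    have hlt : s < s' := by exact_mod_cast hss'
    -- Thresholds must be nonnegative; as the rate is nonnegative, replacing `s'` by `max s' 0` is
    -- harmless. The room between `s` and `s'` serves as `ε`.
    have h := hupper Γ hΓ (max s' 0) (le_max_right _ _) (fun x hx h0 => ?_) (s' - s) (sub_pos.2 hlt)
    · refine limsup_le_of_le (by isBoundedDefault) ?_
      filter_upwards [h, hb.eventually_gt_atTop 0] with n hn hbn
      refine log_div_le_coe hbn (hn.trans (ENNReal.ofReal_le_ofReal (Real.exp_le_exp.2 ?_)))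
      have := le_max_left s' 0
      gcongr
      linarith
    · have h1 := hs'Γ.trans_le (iInf₂_le x (subset_closure hx))
      rw [gaussianRate, if_pos h0, EReal.coe_ennreal_ofReal, max_eq_left (by positivity)] at h1
      exact max_le (by exact_mod_cast h1.le) (by positivity)

/-- The law of the standardized fluctuations in terms of the law of the free moments. -/
lemma Generic.map_fluctuation_apply (hl : C.top ≤ l) (hV : Generic E C V)
    {sel : (Fin l → ℝ) → (Fin l → ℝ)} (hsel : IsNearestPointMap (limitPoints E C V l) sel) (r : ℝ)
    {n : ℕ} (hn : l ≤ n) {Γ : Set (Fin l → ℝ)} (hΓ : MeasurableSet Γ) :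
    (momentLaw E C V n).map (fun m => fluctuation E C V l sel r (firstMoments l m)) Γ
      = laplaceMass (freeRegion E C l) (freeEnergy E C V l) (inverseWeight E C l) n
          {v | fluctuation E C V l sel r (fill C l v) ∈ Γ} /
        laplaceMass (freeRegion E C l) (freeEnergy E C V l) (inverseWeight E C l) n univ := by
  have hmeas : Measurable (fluctuation E C V l sel r) :=
    measurable_fluctuation (finite_limitPoints hl hV) hsel r
  have hmeas' : Measurable fun m : Fin n → ℝ => fluctuation E C V l sel r (firstMoments l m) :=
    hmeas.comp (continuous_firstMoments l n).measurable
  rw [Measure.map_apply hmeas' hΓ]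
  have h := momentLaw_preimage hV hl hn (fun j hj => hV.coordMass_ne (by omega)
    (by have := Finset.mem_Ico.1 hj; omega)) (hmeas hΓ)
  rw [lintegral_restrictedDensity_fill hl hn (hmeas hΓ),
    lintegral_restrictedDensity_fill hl hn MeasurableSet.univ, preimage_univ] at h
  exact h

theorem satisfiesGoodLDP_fluctuation (hV : Generic E C V) (hl : C.top ≤ l) {a : ℕ → ℝ}
    (ha : Tendsto a atTop atTop) (ha' : a =o[atTop] fun n : ℕ => √(n : ℝ))
    {sel : ℕ → (Fin l → ℝ) → (Fin l → ℝ)}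
    (hsel : ∀ n, IsNearestPointMap (limitPoints E C V l) (sel n)) :
    SatisfiesGoodLDP
      (fun n => (momentLaw E C V n).map
        fun m => fluctuation E C V l (sel n) (a n) (firstMoments l m))
      (fun n => (n : ℝ) / a n ^ 2) (gaussianRate C l) := by
  -- A value of the nearest-point map is itself a limit point, which provides the minimum level of
  -- the phase.
  have hsetup := hV.laplaceSetup hl ((hsel 0).2 0).1
  have hZ := eventually_freePart_fluctuation hl hV a hsel
  have hne := hsetup.mass_univ_ne ha ha' hZ
  refine satisfiesGoodLDP_gaussianRate ?_ (tendsto_speed ha ha') ?_ ?_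
  · filter_upwards [hne, eventually_ge_atTop l] with n hn hnl
    refine ⟨?_⟩
    rw [hV.map_fluctuation_apply hl (hsel n) _ hnl MeasurableSet.univ]
    exact ENNReal.div_self hn.1 hn.2
  · intro x hx Γ hΓ hxΓ ε hε
    obtain ⟨ρ, hρ, hball⟩ := Metric.mem_nhds_iff.1 (mem_interior_iff_mem_nhds.1 hxΓ)
    filter_upwards [hne, eventually_ge_atTop l,
      hsetup.mass_lower ha ha' hZ (freePart C x) hρ hε] with n hn hnl hlow
    rw [hV.map_fluctuation_apply hl (hsel n) _ hnl hΓ, ENNReal.le_div_iff_mul_le (Or.inl hn.1)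
      (Or.inl hn.2), neg_mul, euclNorm_sq_eq_dotProduct hx]
    refine hlow.trans (laplaceMass_mono n fun v hv => hball ?_)
    rw [mem_ball_iff_norm, pi_norm_lt_iff hρ]
    intro i
    -- At constrained positions both vectors vanish, so closeness of the free parts suffices.
    by_cases hi : (i : ℕ) + 1 ∈ C.idx
    · rw [Pi.sub_apply, fluctuation_apply_of_mem _ _ _ hi, hx i hi]
      simpa using hρ
    · exact (norm_le_pi_norm (freePart C (fluctuation E C V l (sel n) (a n) (fill C l v))
        - freePart C x) ⟨i, hi⟩).trans_lt hv
  · intro Γ hΓ r hr hΓr ε hε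
    filter_upwards [hne, eventually_ge_atTop l, hsetup.mass_upper ha ha' hZ hr hε] with n hn hnl hup
    rw [hV.map_fluctuation_apply hl (hsel n) _ hnl hΓ, ENNReal.div_le_iff_le_mul (Or.inl hn.1)
      (Or.inl hn.2), neg_mul]
    -- The fluctuation lies in `Γ` and vanishes at constrained positions, so its free part has
    -- squared length at least `2 * r`.
    refine (laplaceMass_mono n fun v hv => ?_).trans hup
    have h0 := fun i hi => fluctuation_apply_of_mem (E := E) (C := C) (V := V) (sel n) (a n)
      (fill C l v) (i := i) hi
    have h1 := hΓr _ hv h0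
    rw [euclNorm_sq_eq_dotProduct h0] at h1
    change 2 * r ≤ _
    linarith

end Deviations

end RandomMoments

theorem mainTheorem10 (E : RandomMoments.Support) (C : RandomMoments.Constraint)
    (hC : RandomMoments.Admissible E C) (V : ℕ → ℝ → ℝ) (hV : RandomMoments.Generic E C V)
    (l : ℕ) (hl : C.top ≤ l)
    (a : ℕ → ℝ) (ha : Filter.Tendsto a Filter.atTop Filter.atTop)
    (ha' : a =o[Filter.atTop] (fun n : ℕ => Real.sqrt n))
    (sel : ℕ → (Fin l → ℝ) → (Fin l → ℝ))
    (hsel : ∀ n, RandomMoments.IsNearestPointMap (RandomMoments.limitPoints E C V l) (sel n)) :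
    SatisfiesGoodLDP
      (fun n => (RandomMoments.momentLaw E C V n).map
        (fun m => RandomMoments.fluctuation E C V l (sel n) (a n)
          (RandomMoments.firstMoments l m)))
      (fun n => (n : ℝ) / a n ^ 2)
      (RandomMoments.gaussianRate C l) :=
  RandomMoments.satisfiesGoodLDP_fluctuation hV hl ha ha' hsel
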